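/- **Theorem (Shale).** Let $V$ be a complex Hilbert space with inner product $\langle\cdot|\cdot\rangle$ (antilinear in the first variable), let $J=i\cdot$ and $\Omega=\operatorname{Im}\langle\cdot|\cdot\rangle$, and let $\mathrm{Sp}(V)$ be the group of all real-linear automorphisms $g$ of $V$ with $\Omega(gx,gy)=\Omega(x,y)$ for all $x,y\in V$. For $g\in \mathrm{Sp}(V)$ put $C_g=\tfrac12(g-JgJ)$, $A_g=\tfrac12(g+JgJ)$ and $Z_g=C_g^{-1}A_g$ ($C_g$ is always invertible). Let $SV$ be the symmetric algebra of $V$ with inner product determined by orthogonality of the homogeneous summands and $\langle x_1\cdots x_n|y_1\cdots y_n\rangle=\sum_{p}\prod_j\langle x_j|y_{p(j)}\rangle$, $SV'$ the space of all antilinear functionals on $SV$, and $S[V]$ (Fock space) the Hilbert space completion of $SV$, so that $SV\subset S[V]\subset SV'$ by $\Phi\mapsto\langle\cdot|\Phi\rangle$. For $v\in V$ let $c(v)$ be multiplication by $v$ on $SV$, $a(v)$ the derivation of $SV$ with $a(v)w=\langle v|w\rangle$ for $w\in V$, and $\pi(v)=\tfrac1{\sqrt2}(c(v)+a(v))$;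 on $SV'$ put $[\pi(v)\Phi](\psi)=\Phi(\pi(v)\psi)$, and in $S[V]$ let $\pi(v)$ be the restriction to the natural domain $\{\Phi\in S[V]:\pi(v)\Phi\in S[V]\}$. A *unitary metaplectic operator* for $g$ is a unitary operator $T$ on $S[V]$ with $T\pi(v)\varphi=\pi(gv)T\varphi$ in $SV'$ for all $v\in V$, $\varphi\in SV$. Let $V_{\mathbf C}=\mathbf C\otimes_{\mathbf R} V$ with $\langle x|y\rangle=\Omega_{\mathbf C}(\bar x,J_{\mathbf C}y)$ and $v_\pm=\tfrac1{\sqrt2}(v\mp iJv)$; extend $v\mapsto v_+$ and $v\mapsto v_-$ to a linear, respectively antilinear, algebra homomorphism $\varphi\mapsto\varphi_\pm$ from $SV$ to $SV_{\mathbf C}$. Let $Z:V_{\mathbf C}\to V_{\mathbf C}$ be the symmetric antilinear map with $Z(v_+)=(C_g^{-1}v)_-+(Z_{g^{-1}}v)_+$ and $Z(v_-)=(C_{g^{-1}}^{-1}v)_++(Z_gv)_-$, let $\zeta$ be the antilinear functional on $SV_{\mathbf C}$ concentrated in degree two with $\zeta(xy)=\langle y|Zx\rangle$, and let $u_g=e^Z=\sum_n\zeta^n/n!$,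 where antilinear functionals on $SV_{\mathbf C}$ are multiplied by means of the coproduct of $SV_{\mathbf C}$ for which the elements of $V_{\mathbf C}$ are primitive. Let $U_g:SV\to SV'$ be the linear map $[U_g\varphi](\psi)=u_g(\psi_+\varphi_-)$. Then $g$ admits a unitary metaplectic operator if and only if $Z_g$ is a Hilbert–Schmidt operator. The same holds when a unitary metaplectic operator is required to satisfy $T\pi(v)T^{-1}=\pi(gv)$ for all $v\in V$ as an equality of operators in $S[V]$ with their natural domains. Moreover, if $Z_g$ is Hilbert–Schmidt, then $U_g$ maps $SV$ into $S[V]$ and extends to a bounded operator $\overline{U_g}$ on $S[V]$, and, $\mathrm{Det}$ being the Fredholm determinant, $\mathrm{Det}^{1/4}(I-Z_g^2)\,\overline{U_g}$ is a unitary metaplectic operator for $g$, in both senses. -/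

import Mathlib

open scoped TensorProduct ComplexConjugate InnerProductSpace

noncomputable section

namespace BosonicFock

/-! ### Symmetric algebra, full antidual, Gaussians -/

section Algebraic

variable {W : Type*} [AddCommGroup W] [Module ℂ W]

/-- The symmetric algebra `SW`. -/
abbrev SymAlgC (W : Type*) [AddCommGroup W] [Module ℂ W] : Type _ := SymmetricAlgebra ℂ W

/-- The full antidual `SW'`: all antilinear functionals on `SW`. -/
abbrev AntiDual (W : Type*) [AddCommGroup W] [Module ℂ W] : Type _ := SymAlgC W →ₗ⋆[ℂ] ℂ

/-- The generator of `SW` given by a vector. -/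
abbrev gen (w : W) : SymAlgC W := SymmetricAlgebra.ι ℂ W w

/-- The algebra generated by commuting elements is commutative. -/
abbrev adjoinCommRing {A : Type*} [Ring A] [Algebra ℂ A] (f : W →ₗ[ℂ] A)
    (hf : ∀ x y, f x * f y = f y * f x) : CommRing (Algebra.adjoin ℂ (Set.range f)) :=
  { (inferInstance : Ring (Algebra.adjoin ℂ (Set.range f))) with
    mul_comm := (Algebra.isMulCommutative_adjoin ℂ
      (by rintro _ ⟨x, rfl⟩ _ ⟨y, rfl⟩; exact hf x y)).is_comm.comm }

/-- Extension of a linear map with commuting values to an algebra homomorphism on `SW`. -/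
def liftComm {A : Type*} [Ring A] [Algebra ℂ A] (f : W →ₗ[ℂ] A)
    (hf : ∀ x y, f x * f y = f y * f x) : SymAlgC W →ₐ[ℂ] A :=
  letI := adjoinCommRing f hf
  (Algebra.adjoin ℂ (Set.range f)).val.comp
    (SymmetricAlgebra.lift (f.codRestrict (Subalgebra.toSubmodule (Algebra.adjoin ℂ (Set.range f)))
      fun x => Algebra.subset_adjoin ⟨x, rfl⟩))

theorem liftComm_gen {A : Type*} [Ring A] [Algebra ℂ A] (f : W →ₗ[ℂ] A)
    (hf : ∀ x y, f x * f y = f y * f x) (w : W) : liftComm f hf (gen w) = f w := by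
  let := adjoinCommRing f hf
  have := SymmetricAlgebra.lift_ι_apply (A := Algebra.adjoin ℂ (Set.range f))
    (f.codRestrict (Subalgebra.toSubmodule (Algebra.adjoin ℂ (Set.range f)))
      fun x => Algebra.subset_adjoin ⟨x, rfl⟩) w
  exact congrArg Subtype.val this

theorem adjoin_gen : Algebra.adjoin ℂ (Set.range (gen : W → SymAlgC W)) = ⊤ := by
  refine eq_top_iff.2 fun θ _ => ?_
  induction θ using SymmetricAlgebra.induction with
  | algebraMap r => exact Subalgebra.algebraMap_mem _ r
  | ι x => exact Algebra.subset_adjoin ⟨x, rfl⟩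
  | mul a b ha hb => exact mul_mem (ha trivial) (hb trivial)
  | add a b ha hb => exact add_mem (ha trivial) (hb trivial)

/-- Induction on `SW` by multiplication with generators. -/
theorem sym_induction {P : SymAlgC W → Prop} (one : P 1) (gen_mul : ∀ w θ, P θ → P (gen w * θ))
    (add : ∀ θ η, P θ → P η → P (θ + η)) (smul : ∀ (r : ℂ) θ, P θ → P (r • θ)) (θ : SymAlgC W) :
    P θ := by
  suffices h : ∀ η, P η → P (θ * η) by simpa using h 1 one
  induction θ using SymmetricAlgebra.induction with
  | algebraMap r => intro η hη; rw [← Algebra.smul_def]; exact smul r η hη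
  | ι x => exact fun η hη => gen_mul x η hη
  | mul a b ha hb => intro η hη; rw [mul_assoc]; exact ha _ (hb _ hη)
  | add a b ha hb => intro η hη; rw [add_mul]; exact add _ _ (ha _ hη) (hb _ hη)

/-- Auxiliary algebra homomorphism `SW → SW[ε]` extending `w ↦ w + f(w) ε`. -/
def contractAux (f : W →ₗ[ℂ] ℂ) : SymAlgC W →ₐ[ℂ] DualNumber (SymAlgC W) :=
  SymmetricAlgebra.lift
    ((TrivSqZeroExt.inlAlgHom ℂ (SymAlgC W) (SymAlgC W)).toLinearMap ∘ₗ SymmetricAlgebra.ι ℂ W +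
      ((TrivSqZeroExt.inrHom (SymAlgC W) (SymAlgC W)).restrictScalars ℂ) ∘ₗ
        (Algebra.linearMap ℂ (SymAlgC W)) ∘ₗ f)

theorem contractAux_fst (f : W →ₗ[ℂ] ℂ) (θ : SymAlgC W) : (contractAux f θ).fst = θ := by
  induction θ using SymmetricAlgebra.induction with
  | algebraMap r => simp [TrivSqZeroExt.algebraMap_eq_inl']
  | ι x => simp [contractAux]
  | mul a b ha hb => simp [ha, hb]
  | add a b ha hb => simp [ha, hb]

/-- The unique derivation of `SW` that sends each generator `w` to the scalar `f w`. -/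
def contract (f : W →ₗ[ℂ] ℂ) : Derivation ℂ (SymAlgC W) (SymAlgC W) :=
  Derivation.mk' (((TrivSqZeroExt.sndHom (SymAlgC W) (SymAlgC W)).restrictScalars ℂ) ∘ₗ
    (contractAux f).toLinearMap) (by
      intro a b
      simp [contractAux_fst, mul_comm])

theorem contract_gen (f : W →ₗ[ℂ] ℂ) (w : W) :
    contract f (gen w) = algebraMap ℂ (SymAlgC W) (f w) := by
  simp [contract, contractAux, gen, Algebra.algebraMap_eq_smul_one]

theorem derivation_ext {D D' : Derivation ℂ (SymAlgC W) (SymAlgC W)}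
    (h : ∀ w, D (gen w) = D' (gen w)) : D = D' :=
  Derivation.ext_of_adjoin_eq_top _ adjoin_gen (by rintro _ ⟨w, rfl⟩; exact h w)

theorem contract_comm (f f' : W →ₗ[ℂ] ℂ) (θ : SymAlgC W) :
    contract f (contract f' θ) = contract f' (contract f θ) := by
  have : ⁅contract f, contract f'⁆ = 0 := derivation_ext fun w => by
    simp [Derivation.commutator_apply, contract_gen]
  have h := congrArg (fun D => D θ) this
  simpa [Derivation.commutator_apply, sub_eq_zero] using h

/-- The functional `θ ↦ conj ε(θ)`, `ε` being the projection onto degree zero: the unit of the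
algebra `SW'`. -/
def vac : AntiDual W :=
  (starLinearEquiv ℂ (A := ℂ)).toLinearMap.comp
    (SymmetricAlgebra.algebraMapInv (R := ℂ) (M := W)).toLinearMap

/-- The commutative product of `SW'`, dual to the coproduct of `SW` for which generators are
primitive: `[ΦΨ](θ) = [Φ ⊗ Ψ](Δ θ)`. -/
def antiMul (Φ Ψ : AntiDual W) : AntiDual W :=
  (TensorProduct.lift (LinearMap.mk₂'ₛₗ (starRingEnd ℂ) (starRingEnd ℂ)
    (fun a b => Φ a * Ψ b) (by intros; simp [add_mul]) (by intros; simp [mul_assoc])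
    (by intros; simp [mul_add]) (by intros; simp [mul_left_comm]))).comp
    (Coalgebra.comul (R := ℂ) (A := SymAlgC W))

/-- Powers in the algebra `SW'`. -/
def antiPow (Φ : AntiDual W) : ℕ → AntiDual W
  | 0 => vac
  | n + 1 => antiMul Φ (antiPow Φ n)

/-- Auxiliary operator on `ℂ × W × ℂ` used to construct quadratics. -/
def quadAux (B : W →ₗ[ℂ] W →ₗ[ℂ] ℂ) : W →ₗ[ℂ] Module.End ℂ (ℂ × W × ℂ) :=
  LinearMap.mk₂ ℂ (fun w p => (0, p.1 • w, B w p.2.1))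
    (by intros; ext <;> simp) (by
      intro c w p
      refine Prod.ext (by simp) (Prod.ext ?_ (by simp))
      exact smul_comm p.1 c w)
    (by intros; ext <;> simp [add_smul]) (by intros; ext <;> simp [mul_smul])

theorem quadAux_comm (B : W →ₗ[ℂ] W →ₗ[ℂ] ℂ) (hB : ∀ x y, B x y = B y x) (x y : W) :
    quadAux B x * quadAux B y = quadAux B y * quadAux B x := by
  ext <;> simp [quadAux, hB x y]

/-- Symmetric maps `Z : W → W'`. -/
def IsSymmForm (Z : W →ₗ⋆[ℂ] W →ₗ⋆[ℂ] ℂ) : Prop := ∀ x y, Z x y = Z y x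

/-- The complex-bilinear form `(x, y) ↦ conj (Z x y)`. -/
def conjForm (Z : W →ₗ⋆[ℂ] W →ₗ⋆[ℂ] ℂ) : W →ₗ[ℂ] W →ₗ[ℂ] ℂ :=
  LinearMap.mk₂ ℂ (fun x y => conj (Z x y)) (by intros; simp) (by intros; simp)
    (by intros; simp) (by intros; simp)

/-- The quadratic `ζ ∈ S²W'` corresponding to the symmetric `Z : W → W'`: it vanishes outside
degree two and `ζ(xy) = Z x (y)`. -/
def quadratic (Z : W →ₗ⋆[ℂ] W →ₗ⋆[ℂ] ℂ) (hZ : IsSymmForm Z) : AntiDual W :=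
  (starLinearEquiv ℂ (A := ℂ)).toLinearMap.comp
    ((LinearMap.snd ℂ W ℂ ∘ₗ LinearMap.snd ℂ ℂ (W × ℂ)) ∘ₗ
      (LinearMap.applyₗ ((1, 0, 0) : ℂ × W × ℂ)) ∘ₗ
      (liftComm (quadAux (conjForm Z))
        (quadAux_comm _ fun x y => congrArg conj (hZ x y))).toLinearMap)

theorem quadratic_one (Z : W →ₗ⋆[ℂ] W →ₗ⋆[ℂ] ℂ) (hZ : IsSymmForm Z) : quadratic Z hZ 1 = 0 := by
  simp [quadratic]

theorem quadratic_gen (Z : W →ₗ⋆[ℂ] W →ₗ⋆[ℂ] ℂ) (hZ : IsSymmForm Z) (x : W) :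
    quadratic Z hZ (gen x) = 0 := by
  simp [quadratic, liftComm_gen, quadAux]

theorem quadratic_gen_mul_gen (Z : W →ₗ⋆[ℂ] W →ₗ⋆[ℂ] ℂ) (hZ : IsSymmForm Z) (x y : W) :
    quadratic Z hZ (gen x * gen y) = Z x y := by
  simp [quadratic, liftComm_gen, quadAux, conjForm]

theorem quadratic_of_three (Z : W →ₗ⋆[ℂ] W →ₗ⋆[ℂ] ℂ) (hZ : IsSymmForm Z) (x y z : W) (θ : SymAlgC W) :
    quadratic Z hZ (gen x * (gen y * (gen z * θ))) = 0 := by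
  simp [quadratic, liftComm_gen, quadAux, conjForm]

/-- Annihilator-type operator on `SW'`: `Φ ↦ Φ(a ·)`. -/
def antiShift (a : SymAlgC W) (Φ : AntiDual W) : AntiDual W := Φ.comp (LinearMap.mulLeft ℂ a)

/-- `Φ` vanishes in all degrees below `k`. -/
def LowVanish : ℕ → AntiDual W → Prop
  | 0, _ => True
  | k + 1, Φ => Φ 1 = 0 ∧ ∀ w, LowVanish k (antiShift (gen w) Φ)

theorem LowVanish.add {k : ℕ} {Φ Ψ : AntiDual W} (h : LowVanish k Φ) (h' : LowVanish k Ψ) :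
    LowVanish k (Φ + Ψ) := by
  induction k generalizing Φ Ψ with
  | zero => trivial
  | succ k ih => exact ⟨by simp [h.1, h'.1], fun w => ih (h.2 w) (h'.2 w)⟩

theorem LowVanish.smul {k : ℕ} {Φ : AntiDual W} (r : ℂ) (h : LowVanish k Φ) :
    LowVanish k (r • Φ) := by
  induction k generalizing Φ with
  | zero => trivial
  | succ k ih => exact ⟨by simp [h.1], fun w => ih (h.2 w)⟩

theorem LowVanish.mono {k : ℕ} {Φ : AntiDual W} (h : LowVanish (k + 1) Φ) : LowVanish k Φ := by
  induction k generalizing Φ with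
  | zero => trivial
  | succ k ih => exact ⟨h.1, fun w => ih (h.2 w)⟩

theorem LowVanish.of_le {k m : ℕ} {Φ : AntiDual W} (hkm : m ≤ k) (h : LowVanish k Φ) :
    LowVanish m Φ := by
  induction hkm with
  | refl => exact h
  | step _ ih => exact ih h.mono

theorem antiMul_one (Φ Ψ : AntiDual W) : antiMul Φ Ψ 1 = Φ 1 * Ψ 1 := by
  simp [antiMul, Algebra.TensorProduct.one_def]

theorem antiShift_antiMul (w : W) (Φ Ψ : AntiDual W) :
    antiShift (gen w) (antiMul Φ Ψ) =
      antiMul (antiShift (gen w) Φ) Ψ + antiMul Φ (antiShift (gen w) Ψ) := by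
  ext θ
  simp only [antiShift, antiMul, LinearMap.comp_apply, LinearMap.add_apply,
    LinearMap.mulLeft_apply, Bialgebra.comul_mul, gen, SymmetricAlgebra.comul_ι]
  generalize (Coalgebra.comul (R := ℂ) θ) = t
  induction t using TensorProduct.induction_on with
  | zero => simp
  | tmul a b => simp [add_mul]
  | add s t hs ht => rw [mul_add, map_add, hs, ht]; simp only [map_add]; ring

theorem LowVanish.antiMul {j k : ℕ} {Φ Ψ : AntiDual W} (h : LowVanish j Φ) (h' : LowVanish k Ψ) :
    LowVanish (j + k) (antiMul Φ Ψ) := by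
  obtain ⟨n, hn⟩ : ∃ n, n = j + k := ⟨_, rfl⟩
  rw [← hn]
  induction n generalizing j k Φ Ψ with
  | zero => trivial
  | succ n ih =>
    refine ⟨?_, fun w => ?_⟩
    · rw [antiMul_one]
      rcases j with _ | j
      · rcases k with _ | k
        · omega
        · rw [h'.1, mul_zero]
      · rw [h.1, zero_mul]
    · rw [antiShift_antiMul]
      refine LowVanish.add ?_ ?_
      · rcases j with _ | j
        · rcases k with _ | k
          · omega
          · exact ih (j := 0) (k := k) trivial h'.mono (by omega)
        · exact ih (h.2 w) h' (by omega)
      · rcases k with _ | k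
        · rcases j with _ | j
          · omega
          · exact ih (j := j) (k := 0) h.mono trivial (by omega)
        · exact ih h (h'.2 w) (by omega)

theorem lowVanish_quadratic (Z : W →ₗ⋆[ℂ] W →ₗ⋆[ℂ] ℂ) (hZ : IsSymmForm Z) :
    LowVanish 1 (quadratic Z hZ) :=
  ⟨quadratic_one Z hZ, fun _ => trivial⟩

theorem lowVanish_antiPow {Φ : AntiDual W} (h : LowVanish 1 Φ) (n : ℕ) :
    LowVanish n (antiPow Φ n) := by
  induction n with
  | zero => trivial
  | succ n ih => have := h.antiMul ih; rwa [add_comm] at this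

theorem exists_lowVanish_apply (θ : SymAlgC W) :
    ∃ k, ∀ Φ : AntiDual W, LowVanish k Φ → Φ θ = 0 := by
  suffices h : ∃ k, ∀ m (Φ : AntiDual W), LowVanish (k + m) Φ → LowVanish m (antiShift θ Φ) by
    obtain ⟨k, hk⟩ := h
    exact ⟨k + 1, fun Φ hΦ => by simpa [antiShift] using (hk 1 Φ hΦ).1⟩
  induction θ using SymmetricAlgebra.induction with
  | algebraMap r =>
    refine ⟨0, fun m Φ hΦ => ?_⟩
    have : antiShift (algebraMap ℂ (SymAlgC W) r) Φ = (conj r) • Φ := by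
      ext θ; simp [antiShift, ← Algebra.smul_def]
    rw [this]
    exact (hΦ.of_le (by omega)).smul _
  | ι x => exact ⟨1, fun m Φ hΦ => by rw [add_comm] at hΦ; exact hΦ.2 x⟩
  | mul a b ha hb =>
    obtain ⟨k, hk⟩ := ha
    obtain ⟨l, hl⟩ := hb
    refine ⟨k + l, fun m Φ hΦ => ?_⟩
    have : antiShift (a * b) Φ = antiShift b (antiShift a Φ) := by
      ext θ; simp [antiShift]
    rw [this]
    exact hl m _ (hk (l + m) _ (by rwa [← add_assoc]))
  | add a b ha hb =>
    obtain ⟨k, hk⟩ := ha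
    obtain ⟨l, hl⟩ := hb
    refine ⟨max k l, fun m Φ hΦ => ?_⟩
    have : antiShift (a + b) Φ = antiShift a Φ + antiShift b Φ := by
      ext θ; simp [antiShift, add_mul]
    rw [this]
    exact (hk m Φ (hΦ.of_le (by omega))).add (hl m Φ (hΦ.of_le (by omega)))

theorem summable_antiPow {Φ : AntiDual W} (h : LowVanish 1 Φ) (θ : SymAlgC W) :
    Summable fun n : ℕ => ((n.factorial : ℂ)⁻¹) * antiPow Φ n θ := by
  obtain ⟨k, hk⟩ := exists_lowVanish_apply θ
  refine summable_of_ne_finset_zero (s := Finset.range k) fun n hn => ?_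
  rw [hk _ ((lowVanish_antiPow h n).of_le (by simpa using hn)), mul_zero]

/-- The Gaussian `e^Z = exp ζ = ∑ ζⁿ / n!`, the series converging pointwise on `SW`. -/
def gaussian (Z : W →ₗ⋆[ℂ] W →ₗ⋆[ℂ] ℂ) (hZ : IsSymmForm Z) : AntiDual W where
  toFun θ := ∑' n : ℕ, ((n.factorial : ℂ)⁻¹) * antiPow (quadratic Z hZ) n θ
  map_add' θ η := by
    rw [← (summable_antiPow (lowVanish_quadratic Z hZ) θ).tsum_add
      (summable_antiPow (lowVanish_quadratic Z hZ) η)]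
    simp [mul_add]
  map_smul' r θ := by
    rw [smul_eq_mul, ← tsum_mul_left]
    simp [mul_left_comm]

end Algebraic

/-! ### Fock space -/

section Fock

variable {V : Type*} [NormedAddCommGroup V] [InnerProductSpace ℂ V]

/-- The creator `c(v)` on `SV`: multiplication by `v`. -/
def creator (v : V) : Module.End ℂ (SymAlgC V) := LinearMap.mulLeft ℂ (gen v)

/-- The annihilator `a(v)` on `SV`: the derivation with `a(v) w = ⟨v, w⟩`. -/
def annihilator (v : V) : Module.End ℂ (SymAlgC V) :=
  (contract (innerSL ℂ v).toLinearMap : SymAlgC V →ₗ[ℂ] SymAlgC V)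

theorem annihilator_one (v : V) : annihilator v 1 = 0 := Derivation.map_one_eq_zero _

theorem annihilator_gen_mul (v w : V) (θ : SymAlgC V) :
    annihilator v (gen w * θ) = ⟪v, w⟫_ℂ • θ + gen w * annihilator v θ := by
  have h : contract (innerSL ℂ v).toLinearMap (gen w) = algebraMap ℂ (SymAlgC V) ⟪v, w⟫_ℂ :=
    contract_gen _ w
  simp only [annihilator, Derivation.coeFn_coe, Derivation.leibniz, h, smul_eq_mul]
  rw [Algebra.smul_def]
  ring

theorem annihilator_comm (v w : V) (θ : SymAlgC V) :
    annihilator v (annihilator w θ) = annihilator w (annihilator v θ) :=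
  contract_comm _ _ θ

theorem annihilator_add (v w : V) : annihilator (v + w) = annihilator v + annihilator w := by
  have : contract (innerSL ℂ (v + w)).toLinearMap =
      contract (innerSL ℂ v).toLinearMap + contract (innerSL ℂ w).toLinearMap :=
    derivation_ext fun x => by simp [contract_gen]
  ext1 θ
  exact congrArg (fun D => D θ) this

theorem annihilator_smul (r : ℂ) (v : V) : annihilator (r • v) = conj r • annihilator v := by
  have : contract (innerSL ℂ (r • v)).toLinearMap =
      conj r • contract (innerSL ℂ v).toLinearMap :=
    derivation_ext fun x => by simp [contract_gen, Algebra.smul_def]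
  ext1 θ
  exact congrArg (fun D => D θ) this

/-- The creators on `SV'`, given by `[c(v) Φ](ψ) = Φ(a(v) ψ)`. -/
def dualCreator : V →ₗ[ℂ] Module.End ℂ (AntiDual V) :=
  LinearMap.mk₂ ℂ (fun v Φ => Φ.comp (annihilator v))
    (by intros; ext; simp [annihilator_add]) (by intros; ext; simp [annihilator_smul])
    (by intros; rfl) (by intros; rfl)

theorem dualCreator_comm (v w : V) :
    dualCreator v * dualCreator w = dualCreator w * (dualCreator v : Module.End ℂ (AntiDual V)) := by
  ext Φ ψ
  simp [dualCreator, annihilator_comm v w ψ]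

/-- The canonical inner product in the form of the embedding `SV → SV'`, `φ ↦ ⟨· | φ⟩`: the
functional `⟨· | v₁ ⋯ vₙ⟩` arises from `⟨· | 1⟩` by applying the creators `c(v₁), …, c(vₙ)`. -/
def symToDual : SymAlgC V →ₗ[ℂ] AntiDual V :=
  (LinearMap.applyₗ (vac : AntiDual V)) ∘ₗ (liftComm dualCreator dualCreator_comm).toLinearMap

theorem symToDual_one : symToDual (1 : SymAlgC V) = vac := by
  simp [symToDual]

theorem symToDual_gen_mul (v : V) (φ ψ : SymAlgC V) :
    symToDual (gen v * φ) ψ = symToDual φ (annihilator v ψ) := by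
  simp only [symToDual, LinearMap.comp_apply, AlgHom.toLinearMap_apply, map_mul, liftComm_gen]
  rfl

theorem vac_one : (vac : AntiDual V) 1 = 1 := by simp [vac]

theorem vac_gen_mul (v : V) (θ : SymAlgC V) : vac (gen v * θ) = 0 := by
  simp [vac, SymmetricAlgebra.algebraMapInv_ι]

theorem symToDual_apply_gen_mul (v : V) (φ ψ : SymAlgC V) :
    symToDual φ (gen v * ψ) = symToDual (annihilator v φ) ψ := by
  induction φ using sym_induction generalizing ψ with
  | one => rw [symToDual_one, vac_gen_mul, annihilator_one]; simp
  | gen_mul w φ ih =>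
    rw [symToDual_gen_mul, annihilator_gen_mul, annihilator_gen_mul]
    simp only [map_add, map_smul, LinearMap.add_apply, LinearMap.smul_apply, ih,
      symToDual_gen_mul, map_smulₛₗ, inner_conj_symm]
  | add φ η h h' => simp [h, h']
  | smul r φ h => simp [h]

theorem symToDual_symm (φ ψ : SymAlgC V) : conj (symToDual ψ φ) = symToDual φ ψ := by
  induction φ using sym_induction generalizing ψ with
  | one =>
    rw [symToDual_one]
    induction ψ using sym_induction with
    | one => simp [symToDual_one, vac_one]
    | gen_mul w ψ ih => rw [symToDual_gen_mul, annihilator_one, vac_gen_mul]; simp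
    | add φ η h h' => simp [h, h']
    | smul r φ h => simp [h]
  | gen_mul w φ ih => rw [symToDual_apply_gen_mul, symToDual_gen_mul, ih]
  | add φ η h h' => simp [h, h']
  | smul r φ h => simp [h]

/-- Monomials in vectors `e i`. -/
def monom {ι : Type*} (e : ι → V) : MvPolynomial ι ℂ →ₐ[ℂ] SymAlgC V :=
  MvPolynomial.aeval fun i => gen (e i)

theorem annihilator_monom {ι : Type*} [DecidableEq ι] {e : ι → V} (he : Orthonormal ℂ e) (i : ι)
    (P : MvPolynomial ι ℂ) :
    annihilator (e i) (monom e P) = monom e (MvPolynomial.pderiv i P) := by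
  induction P using MvPolynomial.induction_on with
  | C a => simp [monom, annihilator]
  | add p q hp hq => simp [hp, hq]
  | mul_X p j hp =>
    rw [mul_comm, map_mul, show monom e (MvPolynomial.X j) = gen (e j) by simp [monom],
      annihilator_gen_mul, hp, Derivation.leibniz, orthonormal_iff_ite.1 he i j,
      MvPolynomial.pderiv_X]
    rw [map_add, smul_eq_mul, smul_eq_mul, map_mul, map_mul,
      show monom e (MvPolynomial.X j) = gen (e j) by simp [monom], add_comm]
    by_cases h : i = j
    · subst h; simp
    · simp [h, Ne.symm h]

theorem monom_monomial_add {ι : Type*} (e : ι → V) (i : ι) (α : ι →₀ ℕ) :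
    monom e (MvPolynomial.monomial (α + Finsupp.single i 1) 1) =
      gen (e i) * monom e (MvPolynomial.monomial α 1) := by
  rw [show gen (e i) = monom e (MvPolynomial.X i) by simp [monom], ← map_mul, mul_comm,
    MvPolynomial.X, MvPolynomial.monomial_mul, mul_one]

theorem sub_single_add {ι : Type*} [DecidableEq ι] {α : ι →₀ ℕ} {i : ι} (h : α i ≠ 0) :
    α - Finsupp.single i 1 + Finsupp.single i 1 = α := by
  refine tsub_add_cancel_of_le ?_
  rw [Finsupp.single_le_iff]
  omega

theorem symToDual_monomial {ι : Type*} [DecidableEq ι] {e : ι → V} (he : Orthonormal ℂ e)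
    (α : ι →₀ ℕ) : ∃ c : ℝ, 0 < c ∧ ∀ β : ι →₀ ℕ,
    symToDual (monom e (MvPolynomial.monomial α 1)) (monom e (MvPolynomial.monomial β 1)) =
      if α = β then (c : ℂ) else 0 := by
  obtain ⟨n, hn⟩ : ∃ n, n = α.degree := ⟨_, rfl⟩
  induction n generalizing α with
  | zero =>
    have hα : α = 0 := (Finsupp.degree_eq_zero_iff α).1 hn.symm
    subst hα
    refine ⟨1, one_pos, fun β => ?_⟩
    have h1 : monom e (MvPolynomial.monomial 0 1) = 1 := map_one _
    rw [h1, symToDual_one]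
    by_cases hβ : 0 = β
    · subst hβ
      rw [h1, vac_one]; simp
    · obtain ⟨i, hi⟩ : ∃ i, β i ≠ 0 := by
        by_contra! h
        exact hβ (Finsupp.ext fun i => (h i).symm)
      rw [if_neg hβ, ← sub_single_add hi, monom_monomial_add, vac_gen_mul]
  | succ n ih =>
    obtain ⟨i, hi⟩ : ∃ i, α i ≠ 0 := by
      by_contra! h
      have : α = 0 := Finsupp.ext h
      simp [this] at hn
    obtain ⟨c, hc, h⟩ := ih (α - Finsupp.single i 1) (by
      have := congrArg Finsupp.degree (sub_single_add hi)
      rw [map_add, Finsupp.degree_single] at this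
      omega)
    refine ⟨α i * c, mul_pos (by exact_mod_cast Nat.pos_of_ne_zero hi) hc, fun β => ?_⟩
    have h2 : (MvPolynomial.monomial (β - Finsupp.single i 1) ((1 : ℂ) * (β i : ℂ))) =
        (β i : ℂ) • MvPolynomial.monomial (β - Finsupp.single i 1) 1 := by
      simp [MvPolynomial.smul_monomial]
    conv_lhs => rw [← sub_single_add hi]
    rw [monom_monomial_add, symToDual_gen_mul, annihilator_monom he, MvPolynomial.pderiv_monomial,
      h2, map_smul, map_smulₛₗ, h]
    by_cases hαβ : α = β
    · subst hαβ; simp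
    · rw [if_neg hαβ]
      by_cases hβ : β i = 0
      · simp [hβ]
      · rw [if_neg, smul_zero]
        intro h'
        exact hαβ (by rw [← sub_single_add hi, h', sub_single_add hβ])

theorem symToDual_monom_self {ι : Type*} {e : ι → V} (he : Orthonormal ℂ e)
    (P : MvPolynomial ι ℂ) : ∃ r : ℝ, 0 ≤ r ∧ symToDual (monom e P) (monom e P) = r ∧
      (r = 0 → P = 0) := by
  classical
  choose c hc h using symToDual_monomial he
  refine ⟨∑ α ∈ P.support, c α * ‖P.coeff α‖ ^ 2, Finset.sum_nonneg fun α _ =>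
    mul_nonneg (hc α).le (by positivity), ?_, fun h0 => ?_⟩
  · have hP : monom e P =
        ∑ α ∈ P.support, P.coeff α • monom e (MvPolynomial.monomial α 1) := by
      conv_lhs => rw [P.as_sum]
      rw [map_sum]
      refine Finset.sum_congr rfl fun α _ => ?_
      rw [← map_smul, MvPolynomial.smul_monomial, smul_eq_mul, mul_one]
    rw [hP]
    simp only [map_sum, LinearMap.sum_apply, map_smul, LinearMap.smul_apply, map_smulₛₗ, h]
    push_cast
    refine Finset.sum_congr rfl fun β hβ => ?_
    rw [Finset.sum_eq_single β]
    · rw [if_pos rfl, ← Complex.mul_conj' (P.coeff β)]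
      simp only [smul_eq_mul]
      ring
    · intro α _ hα
      simp [hα]
    · intro hα
      exact absurd hβ hα
  · ext α
    by_contra hα
    have hmem : α ∈ P.support := MvPolynomial.mem_support_iff.2 hα
    have := (Finset.sum_eq_zero_iff_of_nonneg (fun α _ =>
      mul_nonneg (hc α).le (by positivity))).1 h0 α hmem
    have h3 : P.coeff α = 0 := by simpa [(hc α).ne'] using this
    exact hα (by simpa using h3)

theorem exists_monom (θ : SymAlgC V) : ∃ (n : ℕ) (e : Fin n → V) (_ : Orthonormal ℂ e)
    (P : MvPolynomial (Fin n) ℂ), monom e P = θ := by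
  have key : ∃ s : Finset V, θ ∈ Algebra.adjoin ℂ (gen '' (s : Set V)) := by
    classical
    induction θ using SymmetricAlgebra.induction with
    | algebraMap r => exact ⟨∅, Subalgebra.algebraMap_mem _ r⟩
    | ι x => exact ⟨{x}, Algebra.subset_adjoin ⟨x, by simp, rfl⟩⟩
    | mul a b ha hb =>
      obtain ⟨s, hs⟩ := ha
      obtain ⟨t, ht⟩ := hb
      exact ⟨s ∪ t, mul_mem (Algebra.adjoin_mono (Set.image_mono (by simp)) hs)
        (Algebra.adjoin_mono (Set.image_mono (by simp)) ht)⟩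
    | add a b ha hb =>
      obtain ⟨s, hs⟩ := ha
      obtain ⟨t, ht⟩ := hb
      exact ⟨s ∪ t, add_mem (Algebra.adjoin_mono (Set.image_mono (by simp)) hs)
        (Algebra.adjoin_mono (Set.image_mono (by simp)) ht)⟩
  obtain ⟨s, hs⟩ := key
  let E := Submodule.span ℂ (s : Set V)
  let b := stdOrthonormalBasis ℂ E
  refine ⟨_, fun i => (b i : V), b.orthonormal.comp_linearIsometry E.subtypeₗᵢ, ?_⟩
  change θ ∈ (monom fun i => (b i : V)).range
  refine (Algebra.adjoin_le ?_ : Algebra.adjoin ℂ (gen '' (s : Set V)) ≤ _) hs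
  rintro _ ⟨x, hx, rfl⟩
  have hsum : x = ∑ i, b.repr ⟨x, Submodule.subset_span hx⟩ i • (b i : V) := by
    have := congrArg Subtype.val (b.sum_repr ⟨x, Submodule.subset_span hx⟩)
    simpa using this.symm
  rw [hsum]
  change gen _ ∈ (monom fun i => (b i : V)).range
  simp only [gen, map_sum, map_smul]
  refine sum_mem fun i _ => Subalgebra.smul_mem _ ?_ _
  exact (AlgHom.mem_range _).2 ⟨MvPolynomial.X i, by simp [monom]⟩

/-- The canonical inner product of `SV`, antilinear in the first argument. -/
abbrev symCore (V : Type*) [NormedAddCommGroup V] [InnerProductSpace ℂ V] :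
    InnerProductSpace.Core ℂ (SymAlgC V) where
  inner ψ φ := symToDual φ ψ
  conj_inner_symm φ ψ := symToDual_symm ψ φ
  re_inner_nonneg θ := by
    obtain ⟨n, e, he, P, rfl⟩ := exists_monom θ
    obtain ⟨r, hr, h, -⟩ := symToDual_monom_self he P
    rw [h]
    simpa using hr
  add_left φ ψ θ := map_add _ _ _
  smul_left φ ψ r := by simp
  definite θ h0 := by
    obtain ⟨n, e, he, P, rfl⟩ := exists_monom θ
    obtain ⟨r, hr, h, h'⟩ := symToDual_monom_self he P
    rw [h] at h0
    rw [h' (by exact_mod_cast h0), map_zero]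

instance symNormed : NormedAddCommGroup (SymAlgC V) := (symCore V).toNormedAddCommGroup

instance symInner : InnerProductSpace ℂ (SymAlgC V) := InnerProductSpace.ofCore (symCore V).toCore

variable (V) in
/-- Bosonic Fock space `S[V]`: the Hilbert space completion of `SV`. -/
abbrev Fock : Type _ := UniformSpace.Completion (SymAlgC V)

/-- The inclusion `SV → S[V]`. -/
def toFock : SymAlgC V →ₗᵢ[ℂ] Fock V := UniformSpace.Completion.toComplₗᵢ

/-- The inclusion `S[V] → SV'`, `Φ ↦ ⟨· | Φ⟩`, by which Fock space is regarded as the space of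
bounded antifunctionals on `SV`. -/
def fockToDual : Fock V →ₗ[ℂ] AntiDual V :=
  LinearMap.mk₂'ₛₗ (RingHom.id ℂ) (starRingEnd ℂ) (fun Φ ψ => ⟪toFock ψ, Φ⟫_ℂ)
    (by intros; simp [inner_add_right]) (by intros; simp [inner_smul_right])
    (by intros; simp [inner_add_left]) (by intros; simp [inner_smul_left])

theorem fockToDual_toFock (φ : SymAlgC V) : fockToDual (toFock φ) = symToDual φ := by
  ext ψ
  exact toFock.inner_map_map ψ φ

/-- The Fock representation `π(v) = (c(v) + a(v)) / √2` on `SV`. -/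
def field (v : V) : Module.End ℂ (SymAlgC V) :=
  ((Real.sqrt 2 : ℂ)⁻¹) • (creator v + annihilator v)

/-- The Fock representation on `SV'`: `[π(v) Φ](ψ) = Φ(π(v) ψ)`. -/
def dualField (v : V) (Φ : AntiDual V) : AntiDual V := Φ.comp (field v)

/-- `Φ` belongs to the natural domain `{Φ ∈ S[V] : π(v) Φ ∈ S[V]}` and `π(v) Φ = Ψ`; that is,
`(Φ, Ψ)` belongs to the graph of the selfadjoint operator `π(v)` in Fock space. -/
def IsFieldValue (v : V) (Φ Ψ : Fock V) : Prop := fockToDual Ψ = dualField v (fockToDual Φ)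

end Fock

/-! ### The symplectic group -/

section Symplectic

variable {V : Type*} [NormedAddCommGroup V] [InnerProductSpace ℂ V]

variable (V) in
/-- The real symplectic form `Ω = Im ⟨· | ·⟩`. -/
def omega : LinearMap.BilinForm ℝ V :=
  LinearMap.mk₂ ℝ (fun x y => (⟪x, y⟫_ℂ).im) (by intros; simp)
    (by intro c x y; rw [← Complex.coe_smul, inner_smul_left]; simp)
    (by intros; simp)
    (by intro c x y; rw [← Complex.coe_smul, inner_smul_right]; simp)

variable (V) in
/-- The complex structure `J = i ·`, as a real-linear map. -/
def cplxJ : V →ₗ[ℝ] V := (Complex.I • (LinearMap.id : V →ₗ[ℂ] V)).restrictScalars ℝ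

variable (V) in
/-- The symplectic group: all real-linear automorphisms preserving `Ω`. -/
def SpGroup : Subgroup (V ≃ₗ[ℝ] V) where
  carrier := {g | ∀ x y, omega V (g x) (g y) = omega V x y}
  mul_mem' := fun {g h} hg hh x y => (hg (h x) (h y)).trans (hh x y)
  one_mem' _ _ := rfl
  inv_mem' := fun {g} hg x y => by
    have := hg (g⁻¹ x) (g⁻¹ y)
    have e : ∀ z, g (g⁻¹ z) = z := g.apply_symm_apply
    rw [e, e] at this
    exact this.symm

theorem smul_eq_re_im {E : Type*} [AddCommGroup E] [Module ℂ E] [Module ℝ E]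
    [IsScalarTower ℝ ℂ E] (r : ℂ) (w : E) : r • w = r.re • w + r.im • (Complex.I • w) := by
  rw [← smul_assoc, ← algebraMap_smul ℂ r.re w, ← add_smul]
  congr 1
  rw [Complex.real_smul]
  exact (Complex.re_add_im r).symm

/-- A real-linear map that commutes with `i` is complex-linear. -/
def toLin {E F : Type*} [AddCommGroup E] [Module ℂ E] [Module ℝ E] [IsScalarTower ℝ ℂ E]
    [AddCommGroup F] [Module ℂ F] [Module ℝ F] [IsScalarTower ℝ ℂ F] (f : E →ₗ[ℝ] F)
    (hf : ∀ v, f (Complex.I • v) = Complex.I • f v) : E →ₗ[ℂ] F where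
  toFun := f
  map_add' := map_add f
  map_smul' r v := by
    rw [smul_eq_re_im r v, map_add, map_smul, map_smul, hf, RingHom.id_apply, smul_eq_re_im r]

/-- A real-linear map that anticommutes with `i` is antilinear. -/
def toAntilin {E F : Type*} [AddCommGroup E] [Module ℂ E] [Module ℝ E] [IsScalarTower ℝ ℂ E]
    [AddCommGroup F] [Module ℂ F] [Module ℝ F] [IsScalarTower ℝ ℂ F] (f : E →ₗ[ℝ] F)
    (hf : ∀ v, f (Complex.I • v) = -(Complex.I • f v)) : E →ₗ⋆[ℂ] F where
  toFun := f
  map_add' := map_add f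
  map_smul' r v := by
    rw [smul_eq_re_im r v, map_add, map_smul, map_smul, hf, smul_eq_re_im (conj r)]
    simp

/-- `(g - JgJ) / 2`, the complex-linear part of a real-linear map. -/
def linPart (g : V →ₗ[ℝ] V) : V →ₗ[ℂ] V :=
  toLin ((2 : ℝ)⁻¹ • (g - cplxJ V ∘ₗ g ∘ₗ cplxJ V)) fun v => by
    simp [cplxJ, smul_smul, smul_sub, smul_comm Complex.I (2 : ℝ)⁻¹]
    abel

/-- `(g + JgJ) / 2`, the antilinear part of a real-linear map. -/
def antiPart (g : V →ₗ[ℝ] V) : V →ₗ⋆[ℂ] V :=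
  toAntilin ((2 : ℝ)⁻¹ • (g + cplxJ V ∘ₗ g ∘ₗ cplxJ V)) fun v => by
    simp [cplxJ, smul_smul, smul_comm Complex.I (2 : ℝ)⁻¹]

/-- `C_g` for `g ∈ Sp(V)`. -/
def Cg (g : SpGroup V) : V →ₗ[ℂ] V := linPart (g : V ≃ₗ[ℝ] V).toLinearMap

/-- `A_g` for `g ∈ Sp(V)`. -/
def Ag (g : SpGroup V) : V →ₗ⋆[ℂ] V := antiPart (g : V ≃ₗ[ℝ] V).toLinearMap

theorem Cg_add_Ag (g : SpGroup V) (v : V) : Cg g v + Ag g v = (g : V ≃ₗ[ℝ] V) v := by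
  change (2 : ℝ)⁻¹ • ((g : V ≃ₗ[ℝ] V) v - Complex.I • (g : V ≃ₗ[ℝ] V) (Complex.I • v)) +
    (2 : ℝ)⁻¹ • ((g : V ≃ₗ[ℝ] V) v + Complex.I • (g : V ≃ₗ[ℝ] V) (Complex.I • v)) = _
  rw [← smul_add, sub_add_add_cancel, ← two_smul ℝ, smul_smul]
  simp

theorem im_inner_inv (g : SpGroup V) (x y : V) :
    (⟪(g : V ≃ₗ[ℝ] V) x, y⟫_ℂ).im = (⟪x, (g⁻¹ : SpGroup V).1 y⟫_ℂ).im := by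
  have := g.2 x ((g⁻¹ : SpGroup V).1 y)
  have h2 : (g : V ≃ₗ[ℝ] V) ((g⁻¹ : SpGroup V).1 y) = y := g.1.apply_symm_apply y
  rw [h2] at this
  exact this

theorem inner_Cg (g : SpGroup V) (x y : V) : ⟪Cg g x, y⟫_ℂ = ⟪x, Cg g⁻¹ y⟫_ℂ := by
  have e1 := im_inner_inv g x y
  have e2 := im_inner_inv g x (Complex.I • y)
  have e3 := im_inner_inv g (Complex.I • x) y
  have e4 := im_inner_inv g (Complex.I • x) (Complex.I • y)
  change ⟪(2 : ℝ)⁻¹ • ((g : V ≃ₗ[ℝ] V) x - Complex.I • (g : V ≃ₗ[ℝ] V) (Complex.I • x)), y⟫_ℂ =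
    ⟪x, (2 : ℝ)⁻¹ • ((g⁻¹ : SpGroup V).1 y - Complex.I • (g⁻¹ : SpGroup V).1 (Complex.I • y))⟫_ℂ
  rw [← Complex.coe_smul, ← Complex.coe_smul, inner_smul_left, inner_smul_right, inner_sub_left,
    inner_sub_right]
  simp only [inner_smul_left, inner_smul_right] at *
  apply Complex.ext <;> simp at * <;> linarith

theorem inner_Ag (g : SpGroup V) (x y : V) : ⟪Ag g x, y⟫_ℂ = -⟪Ag g⁻¹ y, x⟫_ℂ := by
  have e1 := im_inner_inv g x y
  have e2 := im_inner_inv g x (Complex.I • y)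
  have e3 := im_inner_inv g (Complex.I • x) y
  have e4 := im_inner_inv g (Complex.I • x) (Complex.I • y)
  rw [← inner_conj_symm (Ag g⁻¹ y) x]
  change ⟪(2 : ℝ)⁻¹ • ((g : V ≃ₗ[ℝ] V) x + Complex.I • (g : V ≃ₗ[ℝ] V) (Complex.I • x)), y⟫_ℂ =
    -conj ⟪x, (2 : ℝ)⁻¹ • ((g⁻¹ : SpGroup V).1 y +
      Complex.I • (g⁻¹ : SpGroup V).1 (Complex.I • y))⟫_ℂ
  rw [← Complex.coe_smul, ← Complex.coe_smul, inner_smul_left, inner_smul_right, inner_add_left,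
    inner_add_right]
  simp only [inner_smul_left, inner_smul_right] at *
  apply Complex.ext <;> simp [-inner_conj_symm] at * <;> linarith

theorem lin_anti_unique {f f' : V →ₗ[ℂ] V} {k k' : V →ₗ⋆[ℂ] V}
    (h : ∀ v, f v + k v = f' v + k' v) (v : V) : f v = f' v ∧ k v = k' v := by
  have h1 := h v
  have h2 := h (Complex.I • v)
  simp only [map_smul, map_smulₛₗ, Complex.conj_I, neg_smul, ← sub_eq_add_neg, ← smul_sub] at h2
  have h3 := smul_right_injective V Complex.I_ne_zero h2
  have h4 : (2 : ℂ) • f v = (2 : ℂ) • f' v := by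
    rw [two_smul, two_smul]
    calc f v + f v = (f v + k v) + (f v - k v) := by abel
      _ = (f' v + k' v) + (f' v - k' v) := by rw [h1, h3]
      _ = _ := by abel
  have h5 : f v = f' v := smul_right_injective V two_ne_zero h4
  exact ⟨h5, by rw [h5] at h1; exact add_left_cancel h1⟩

theorem Cg_Ag_inv (g : SpGroup V) (v : V) :
    Cg g⁻¹ (Cg g v) + Ag g⁻¹ (Ag g v) = v ∧ Cg g⁻¹ (Ag g v) + Ag g⁻¹ (Cg g v) = 0 := by
  have := lin_anti_unique (f := (Cg g⁻¹).comp (Cg g) + (Ag g⁻¹).comp (Ag g)) (f' := LinearMap.id)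
    (k := (Cg g⁻¹).comp (Ag g) + (Ag g⁻¹).comp (Cg g)) (k' := 0) (fun v => ?_) v
  · simpa using this
  · have h1 : (g⁻¹ : SpGroup V).1 ((g : V ≃ₗ[ℝ] V) v) = v := g.1.symm_apply_apply v
    rw [← Cg_add_Ag g v, ← Cg_add_Ag g⁻¹] at h1
    simp only [map_add] at h1
    simp only [LinearMap.add_apply, LinearMap.comp_apply, LinearMap.id_apply, LinearMap.zero_apply,
      add_zero]
    conv_rhs => rw [← h1]
    abel

theorem norm_sq_Cg (g : SpGroup V) (v : V) : ‖Cg g v‖ ^ 2 = ‖v‖ ^ 2 + ‖Ag g v‖ ^ 2 := by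
  have h : ⟪Cg g v, Cg g v⟫_ℂ = ⟪v, v⟫_ℂ + ⟪Ag g v, Ag g v⟫_ℂ := by
    have h2 : ⟪v, Ag g⁻¹ (Ag g v)⟫_ℂ = -⟪Ag g v, Ag g v⟫_ℂ := by
      rw [← inner_conj_symm, ← neg_neg ⟪Ag g⁻¹ (Ag g v), v⟫_ℂ, ← inner_Ag, map_neg, inner_conj_symm]
    rw [inner_Cg, eq_sub_of_add_eq (Cg_Ag_inv g v).1, inner_sub_right, h2, sub_neg_eq_add]
  simp only [inner_self_eq_norm_sq_to_K] at h
  exact_mod_cast h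

theorem norm_le_norm_Cg (g : SpGroup V) (v : V) : ‖v‖ ≤ ‖Cg g v‖ := by
  have := norm_sq_Cg g v
  exact le_of_sq_le_sq (by nlinarith [sq_nonneg ‖Ag g v‖]) (norm_nonneg _)

variable [CompleteSpace V]

theorem continuous_Cg (g : SpGroup V) : Continuous (Cg g) := by
  refine LinearMap.continuous_of_seq_closed_graph (Cg g) fun u x y hu hCu => ?_
  refine ext_inner_right ℂ fun w => ?_
  rw [inner_Cg]
  refine tendsto_nhds_unique (hCu.inner tendsto_const_nhds) ?_
  simp only [Function.comp_apply, inner_Cg]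
  exact hu.inner tendsto_const_nhds

theorem bijective_Cg (g : SpGroup V) : Function.Bijective (Cg g) := by
  have hinj : ∀ g : SpGroup V, ∀ v, Cg g v = 0 → v = 0 := fun g v h => by
    have := norm_le_norm_Cg g v
    rw [h, norm_zero] at this
    exact norm_le_zero_iff.1 this
  refine ⟨(injective_iff_map_eq_zero _).2 (hinj g), LinearMap.range_eq_top.1 ?_⟩
  have hanti : AntilipschitzWith 1 (⟨Cg g, continuous_Cg g⟩ : V →L[ℂ] V) :=
    ContinuousLinearMap.antilipschitz_of_bound _ fun v => by simpa using norm_le_norm_Cg g v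
  have hclosed : IsClosed ((LinearMap.range (Cg g) : Submodule ℂ V) : Set V) := by
    have := hanti.isClosed_range (⟨Cg g, continuous_Cg g⟩ : V →L[ℂ] V).uniformContinuous
    exact this
  have : CompleteSpace (LinearMap.range (Cg g)) := hclosed.completeSpace_coe
  rw [← Submodule.orthogonal_eq_bot_iff, Submodule.eq_bot_iff]
  intro y hy
  refine hinj g⁻¹ y (ext_inner_left ℂ fun x => ?_)
  rw [← inner_Cg, inner_zero_right]
  exact hy _ ⟨x, rfl⟩

/-- `C_g`, which is invertible, as a linear equivalence. -/
def CgEquiv (g : SpGroup V) : V ≃ₗ[ℂ] V := LinearEquiv.ofBijective (Cg g) (bijective_Cg g)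

/-- `Z_g = C_g⁻¹ A_g`. -/
def Zg (g : SpGroup V) : V →ₗ⋆[ℂ] V := (CgEquiv g).symm.toLinearMap.comp (Ag g)

theorem Cg_CgEquiv_symm (g : SpGroup V) (v : V) : Cg g ((CgEquiv g).symm v) = v :=
  (CgEquiv g).apply_symm_apply v

theorem inner_CgEquiv_symm (g : SpGroup V) (v w : V) :
    ⟪(CgEquiv g).symm v, w⟫_ℂ = ⟪v, (CgEquiv g⁻¹).symm w⟫_ℂ := by
  conv_lhs => rw [← Cg_CgEquiv_symm g⁻¹ w]
  rw [← inner_Cg, Cg_CgEquiv_symm]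

theorem inner_Zg (g : SpGroup V) (x y : V) : ⟪y, Zg g x⟫_ℂ = ⟪x, Zg g y⟫_ℂ := by
  obtain ⟨w, rfl⟩ := (bijective_Cg g⁻¹).2 y
  have h1 : Zg g (Cg g⁻¹ w) = -Ag g⁻¹ w := by
    have h := (Cg_Ag_inv g⁻¹ w).2
    rw [inv_inv] at h
    apply (CgEquiv g).injective
    rw [map_neg]
    change Cg g ((CgEquiv g).symm (Ag g (Cg g⁻¹ w))) = -Cg g (Ag g⁻¹ w)
    rw [Cg_CgEquiv_symm]
    exact eq_neg_of_add_eq_zero_right h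
  rw [h1, inner_Cg, inv_inv, inner_neg_right, ← inner_conj_symm x, ← map_neg,
    ← inner_Ag, inner_conj_symm]
  exact congrArg _ (Cg_CgEquiv_symm g (Ag g x))

/-! ### Complexification and kernels -/

end Symplectic

section Kernel

variable {V : Type*} [NormedAddCommGroup V] [InnerProductSpace ℂ V]

/-- The complexification `V_ℂ = ℂ ⊗ V` of the real vector space underlying `V`. -/
abbrev Cplx (V : Type*) [NormedAddCommGroup V] [InnerProductSpace ℂ V] : Type _ := ℂ ⊗[ℝ] V

/-- The canonical conjugation of `V_ℂ`. -/
def cplxConj : Cplx V →ₗ⋆[ℂ] Cplx V where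
  toFun := TensorProduct.map Complex.conjAe.toLinearMap (LinearMap.id : V →ₗ[ℝ] V)
  map_add' := map_add _
  map_smul' r x := by
    induction x using TensorProduct.induction_on with
    | zero => simp
    | tmul z v => simp [TensorProduct.smul_tmul']
    | add x y hx hy => rw [smul_add, map_add, hx, hy, map_add, smul_add]

/-- The form `⟨x | y⟩ = Ω_ℂ(x̄, J_ℂ y)` on `V_ℂ`, antilinear in `x` and linear in `y`. -/
def cplxForm : Cplx V →ₗ⋆[ℂ] Cplx V →ₗ[ℂ] ℂ :=
  LinearMap.comp (((omega V).baseChange ℂ).compl₂ ((cplxJ V).baseChange ℂ)) cplxConj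

theorem cplxForm_tmul (a b : ℂ) (v w : V) :
    cplxForm (a ⊗ₜ[ℝ] v) (b ⊗ₜ[ℝ] w) = conj a * b * ((⟪v, w⟫_ℂ).re : ℂ) := by
  simp [cplxForm, cplxConj, cplxJ, omega]
  ring

/-- The isometry `V → V₊`, `v ↦ v₊ = (v - i J v) / √2`. -/
def plus : V →ₗ[ℂ] Cplx V :=
  toLin ((Real.sqrt 2)⁻¹ • (TensorProduct.mk ℝ ℂ V 1 - TensorProduct.mk ℝ ℂ V Complex.I ∘ₗ cplxJ V))
    fun v => by
      rw [LinearMap.smul_apply, LinearMap.smul_apply, smul_comm Complex.I]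
      congr 1
      simp [cplxJ, smul_smul, smul_sub, TensorProduct.smul_tmul', TensorProduct.tmul_neg,
        TensorProduct.neg_tmul]
      abel

/-- The antiisometry `V → V₋`, `v ↦ v₋ = (v + i J v) / √2`. -/
def minus : V →ₗ⋆[ℂ] Cplx V :=
  toAntilin
    ((Real.sqrt 2)⁻¹ • (TensorProduct.mk ℝ ℂ V 1 + TensorProduct.mk ℝ ℂ V Complex.I ∘ₗ cplxJ V))
    fun v => by
      rw [LinearMap.smul_apply, LinearMap.smul_apply, smul_comm Complex.I, ← smul_neg]
      congr 1
      simp [cplxJ, smul_smul, TensorProduct.smul_tmul', TensorProduct.tmul_neg,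
        TensorProduct.neg_tmul]

theorem plus_apply (v : V) : plus v =
    (Real.sqrt 2)⁻¹ • ((1 : ℂ) ⊗ₜ[ℝ] v - Complex.I ⊗ₜ[ℝ] (Complex.I • v)) := rfl

theorem minus_apply (v : V) : minus v =
    (Real.sqrt 2)⁻¹ • ((1 : ℂ) ⊗ₜ[ℝ] v + Complex.I ⊗ₜ[ℝ] (Complex.I • v)) := rfl

theorem cplxForm_tmul_plus (v w : V) :
    cplxForm ((1 : ℂ) ⊗ₜ[ℝ] w) (plus v) = ((Real.sqrt 2)⁻¹ : ℂ) * ⟪w, v⟫_ℂ := by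
  rw [plus_apply, ← algebraMap_smul ℂ, map_smul, map_sub, cplxForm_tmul, cplxForm_tmul]
  apply Complex.ext <;> simp

theorem cplxForm_tmul_minus (v w : V) :
    cplxForm ((1 : ℂ) ⊗ₜ[ℝ] w) (minus v) = ((Real.sqrt 2)⁻¹ : ℂ) * ⟪v, w⟫_ℂ := by
  rw [minus_apply, ← algebraMap_smul ℂ, map_smul, map_add, cplxForm_tmul, cplxForm_tmul,
    ← inner_conj_symm v w]
  apply Complex.ext <;> simp [-inner_conj_symm]

/-- The real-linear map underlying an antilinear map. -/
def antiReal (p : V →ₗ⋆[ℂ] Cplx V) : V →ₗ[ℝ] Cplx V where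
  toFun := p
  map_add' := map_add p
  map_smul' r v := by
    rw [← Complex.coe_smul, map_smulₛₗ, Complex.conj_ofReal, RingHom.id_apply]
    exact algebraMap_smul ℂ r (p v)

/-- The antilinear map `V_ℂ → V_ℂ` that is given on `V₊` by `v₊ ↦ p v` and on `V₋` by
`v₋ ↦ q v`. -/
def fromParts (p : V →ₗ⋆[ℂ] Cplx V) (q : V →ₗ[ℂ] Cplx V) : Cplx V →ₗ⋆[ℂ] Cplx V :=
  (LinearMap.liftBaseChange ℂ
    ((Real.sqrt 2)⁻¹ • (antiReal p + q.restrictScalars ℝ))).comp cplxConj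

theorem fromParts_tmul (p : V →ₗ⋆[ℂ] Cplx V) (q : V →ₗ[ℂ] Cplx V) (a : ℂ) (v : V) :
    fromParts p q (a ⊗ₜ[ℝ] v) = conj a • (Real.sqrt 2)⁻¹ • (p v + q v) := by
  simp [fromParts, cplxConj, antiReal]

theorem sqrt_two_smul_aux {E : Type*} [AddCommGroup E] [Module ℝ E] (x : E) :
    (Real.sqrt 2)⁻¹ • (Real.sqrt 2)⁻¹ • (x + x) = x := by
  rw [← two_smul ℝ, smul_smul, smul_smul, ← mul_inv, Real.mul_self_sqrt zero_le_two]
  simp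

theorem fromParts_plus (p : V →ₗ⋆[ℂ] Cplx V) (q : V →ₗ[ℂ] Cplx V) (v : V) :
    fromParts p q (plus v) = p v := by
  rw [plus_apply, ← algebraMap_smul ℂ, map_smulₛₗ, map_sub, fromParts_tmul, fromParts_tmul,
    Complex.coe_algebraMap, Complex.conj_ofReal, ← Complex.coe_algebraMap, algebraMap_smul,
    smul_comm (conj (1 : ℂ)), smul_comm (conj Complex.I), ← smul_sub]
  conv_rhs => rw [← sqrt_two_smul_aux (p v)]
  congr 2
  simp [smul_smul]

theorem fromParts_minus (p : V →ₗ⋆[ℂ] Cplx V) (q : V →ₗ[ℂ] Cplx V) (v : V) :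
    fromParts p q (minus v) = q v := by
  rw [minus_apply, ← algebraMap_smul ℂ, map_smulₛₗ, map_add, fromParts_tmul, fromParts_tmul,
    Complex.coe_algebraMap, Complex.conj_ofReal, ← Complex.coe_algebraMap, algebraMap_smul,
    smul_comm (conj (1 : ℂ)), smul_comm (conj Complex.I), ← smul_add]
  conv_rhs => rw [← sqrt_two_smul_aux (q v)]
  congr 2
  simp [smul_smul]
  abel

section Conj

/-- A complex algebra `A` with scalars acting through complex conjugation. -/
def ConjAlg (A : Type*) : Type _ := A

instance {A : Type*} [CommRing A] : CommRing (ConjAlg A) := inferInstanceAs (CommRing A)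

instance {A : Type*} [CommRing A] [Algebra ℂ A] : Algebra ℂ (ConjAlg A) :=
  RingHom.toAlgebra ((algebraMap ℂ A).comp (starRingEnd ℂ))

/-- Auxiliary homomorphism for `antiLift`. -/
def antiLiftAux {A : Type*} [CommRing A] [Algebra ℂ A] (f : V →ₗ⋆[ℂ] A) :
    SymAlgC V →ₐ[ℂ] ConjAlg A :=
  SymmetricAlgebra.lift
    { toFun := fun v => (f v : A)
      map_add' := fun v w => map_add f v w
      map_smul' := fun r v => (map_smulₛₗ f r v).trans (Algebra.smul_def (A := A) _ _) }

/-- The antilinear multiplicative extension to `SV` of an antilinear map from `V` to a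
commutative algebra. -/
def antiLift {A : Type*} [CommRing A] [Algebra ℂ A] (f : V →ₗ⋆[ℂ] A) : SymAlgC V →ₗ⋆[ℂ] A where
  toFun θ := (antiLiftAux f θ : A)
  map_add' θ η := map_add (antiLiftAux f) θ η
  map_smul' r θ := (map_smul (antiLiftAux f) r θ).trans (Algebra.smul_def (A := A) _ _).symm

theorem antiLift_gen {A : Type*} [CommRing A] [Algebra ℂ A] (f : V →ₗ⋆[ℂ] A) (v : V) :
    antiLift f (gen v) = f v :=
  SymmetricAlgebra.lift_ι_apply (A := ConjAlg A) _ v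

theorem antiLift_one {A : Type*} [CommRing A] [Algebra ℂ A] (f : V →ₗ⋆[ℂ] A) :
    antiLift f 1 = 1 :=
  map_one (antiLiftAux f)

theorem antiLift_mul {A : Type*} [CommRing A] [Algebra ℂ A] (f : V →ₗ⋆[ℂ] A) (θ η : SymAlgC V) :
    antiLift f (θ * η) = antiLift f θ * antiLift f η :=
  map_mul (antiLiftAux f) θ η

end Conj

/-- The algebra homomorphism `SV → SV_ℂ`, `φ ↦ φ₊`, extending `v ↦ v₊`. -/
def symPlus : SymAlgC V →ₐ[ℂ] SymAlgC (Cplx V) :=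
  SymmetricAlgebra.lift (SymmetricAlgebra.ι ℂ (Cplx V) ∘ₗ plus)

/-- The antilinear algebra homomorphism `SV → SV_ℂ`, `φ ↦ φ₋`, extending `v ↦ v₋`. -/
def symMinus : SymAlgC V →ₗ⋆[ℂ] SymAlgC (Cplx V) :=
  antiLift ((SymmetricAlgebra.ι ℂ (Cplx V)).comp minus)

/-- The linear map `U : SV → SV'` with kernel `u ∈ SV_ℂ'`: `[U φ](ψ) = u(ψ₊ φ₋)`. -/
def ofKernel (u : AntiDual (Cplx V)) : SymAlgC V →ₗ[ℂ] AntiDual V :=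
  LinearMap.mk₂'ₛₗ (RingHom.id ℂ) (starRingEnd ℂ) (fun φ ψ => u (symPlus ψ * symMinus φ))
    (by intros; simp [mul_add]) (by intros; simp)
    (by intros; simp [add_mul]) (by intros; simp)

end Kernel

/-! ### Metaplectic operators -/

section Metaplectic

variable {V : Type*} [NormedAddCommGroup V] [InnerProductSpace ℂ V]

/-- A weak metaplectic operator for `g`: a nonzero linear map `U : SV → SV'` with
`U π(v) = π(g v) U` for all `v`. -/
def IsWeakMetaplectic (g : SpGroup V) (U : SymAlgC V →ₗ[ℂ] AntiDual V) : Prop :=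
  U ≠ 0 ∧ ∀ (v : V) (φ : SymAlgC V), U (field v φ) = dualField ((g : V ≃ₗ[ℝ] V) v) (U φ)

/-- `T` is unitary on Fock space and its restriction to `SV` is a weak metaplectic operator
for `g`. -/
def IsUnitaryMetaplectic (g : SpGroup V) (T : Fock V →L[ℂ] Fock V) : Prop :=
  T ∈ unitary (Fock V →L[ℂ] Fock V) ∧
    IsWeakMetaplectic g (fockToDual ∘ₗ T.toLinearMap ∘ₗ toFock.toLinearMap)

/-- `T` is unitary on Fock space and `T π(v) T⁻¹ = π(g v)` for all `v`, as an equality of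
selfadjoint operators in Fock space with their natural domains. -/
def IsUnitaryImplementer (g : SpGroup V) (T : Fock V →L[ℂ] Fock V) : Prop :=
  T ∈ unitary (Fock V →L[ℂ] Fock V) ∧
    ∀ (v : V) (Φ Ψ : Fock V), IsFieldValue v Φ Ψ ↔ IsFieldValue ((g : V ≃ₗ[ℝ] V) v) (T Φ) (T Ψ)

/-- Hilbert-Schmidt antilinear operators. -/
def IsHilbertSchmidt (Z : V →ₗ⋆[ℂ] V) : Prop :=
  Continuous Z ∧ ∃ (s : Set V) (b : HilbertBasis s ℂ V), Summable fun i => ‖Z (b i)‖ ^ 2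

/-- The Fredholm determinant of an operator `T` differing from the identity by a trace-class
operator: the product of the eigenvalues of `T`, counted with algebraic multiplicity.
(Eigenvalues other than `1` have finite multiplicity; the eigenvalue `1` contributes `1`.) -/
def fredholmDet (T : Module.End ℂ V) : ℂ :=
  ∏' ν : ℂ, ν ^ Module.finrank ℂ (T.maxGenEigenspace ν)

variable [CompleteSpace V]

/-- The antilinear map `Z : V_ℂ → V_ℂ` with `Z(v₊) = (C_g⁻¹ v)₋ + (Z_{g⁻¹} v)₊` and
`Z(v₋) = (C_{g⁻¹}⁻¹ v)₊ + (Z_g v)₋`. -/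
def kernelMap (g : SpGroup V) : Cplx V →ₗ⋆[ℂ] Cplx V :=
  fromParts (minus.comp (CgEquiv g).symm.toLinearMap + plus.comp (Zg g⁻¹))
    (plus.comp (CgEquiv g⁻¹).symm.toLinearMap + minus.comp (Zg g))

/-- The map `V_ℂ → V_ℂ'` corresponding to `kernelMap g`, that is `(x, y) ↦ ⟨y | Z x⟩`. -/
def kernelForm (g : SpGroup V) : Cplx V →ₗ⋆[ℂ] Cplx V →ₗ⋆[ℂ] ℂ :=
  cplxForm.flip.comp (kernelMap g)

theorem kernelForm_symm (g : SpGroup V) : IsSymmForm (kernelForm g) := by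
  intro x y
  induction x using TensorProduct.induction_on with
  | zero => simp
  | add x x' h h' => simp [h, h']
  | tmul a v =>
    induction y using TensorProduct.induction_on with
    | zero => simp
    | add x x' h h' => simp [h, h']
    | tmul b w =>
      have key : ∀ v w : V, kernelForm g ((1 : ℂ) ⊗ₜ[ℝ] v) ((1 : ℂ) ⊗ₜ[ℝ] w) =
          ((Real.sqrt 2)⁻¹ : ℂ) * (((Real.sqrt 2)⁻¹ : ℂ) *
            (⟪(CgEquiv g).symm v, w⟫_ℂ + ⟪w, Zg g⁻¹ v⟫_ℂ + ⟪w, (CgEquiv g⁻¹).symm v⟫_ℂ +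
              ⟪Zg g v, w⟫_ℂ)) := by
        intro v w
        change cplxForm ((1 : ℂ) ⊗ₜ[ℝ] w) (kernelMap g ((1 : ℂ) ⊗ₜ[ℝ] v)) = _
        rw [kernelMap, fromParts_tmul, map_one, one_smul, ← algebraMap_smul ℂ, map_smul]
        simp only [LinearMap.add_apply, LinearMap.comp_apply, map_add, cplxForm_tmul_plus,
          cplxForm_tmul_minus, LinearEquiv.coe_coe]
        simp
        ring
      have h1 : ∀ (c : ℂ) (u : V), c ⊗ₜ[ℝ] u = c • ((1 : ℂ) ⊗ₜ[ℝ] u) := by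
        intro c u; simp [TensorProduct.smul_tmul']
      rw [h1 a, h1 b]
      simp only [map_smulₛₗ, LinearMap.smul_apply, key, smul_eq_mul]
      have e1 := inner_CgEquiv_symm g v w
      have e2 := inner_CgEquiv_symm g w v
      have e3 := inner_Zg g⁻¹ v w
      have e4 : ⟪Zg g v, w⟫_ℂ = ⟪Zg g w, v⟫_ℂ := by
        rw [← inner_conj_symm, inner_Zg, inner_conj_symm]
      rw [e1, e2, e3, e4]
      ring

/-- The weak metaplectic operator `U_g : SV → SV'` with Gaussian kernel `u_g = e^Z`. -/
def weakOp (g : SpGroup V) : SymAlgC V →ₗ[ℂ] AntiDual V :=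
  ofKernel (gaussian (kernelForm g) (kernelForm_symm g))

end Metaplectic

end BosonicFock

end

open scoped TensorProduct ComplexConjugate InnerProductSpace

noncomputable section

namespace BosonicFock

/-! ### The convolution product of antifunctionals and the differential equation of Gaussians -/

section Algebraic

variable {W : Type*} [AddCommGroup W] [Module ℂ W]

/-! A Gaussian `e^Z` is characterized by its value 1 at 1 and the equation `Φ(xθ) = Φ(∂θ)`, where
`∂` is the derivation given by contraction with `Zx` (`gaussian_gen_mul`,
`antiDual_eq_of_contract`). For the kernel of `U_g` this equation, split along V₊ and V₋, says how
`U_g` moves creators and annihilators. With the linear and antilinear parts of `g⁻¹g = 1` it becomes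
`U c(v) = (c(Cv) + a(Av)) U` and `U a(v) = (a(Cv) + c(Av)) U`, so `U_g` always intertwines in the
weak sense (`isWeakMetaplectic_weakOp`). What remains is to decide when an intertwiner lives in Fock
space.

The analytic core is that π(v) with its natural domain is symmetric (`IsFieldValue.inner_symm`):
truncating at degree M leaves a boundary term of size `√(M+1)` times a summable sequence, and such
terms cannot stay away from zero. Hence every intertwiner from SV to Fock space respects the
adjointness of c(v) and a(v), and is a multiple of an isometry (`Intertwines.inner_map_map`). The
same symmetry shows that a bounded intertwiner maps the graph of π(v) into that of π(gv), so the two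
notions of metaplectic operator agree (`isUnitaryImplementer_iff`).

Necessity: the image of the vacuum under an intertwiner solves the Gaussian equation for `Z_{g⁻¹}`.
Pairing it with the quadratic element `∑ e_i · Z e_i` and using Cauchy-Schwarz bounds `∑ ‖Z e_i‖²`
(`sum_norm_sq_le_of_gaussian`). Applied to the adjoint of a unitary, this gives `Z_g`.

Sufficiency: a symmetric antilinear Hilbert-Schmidt operator is diagonal with entries `l i ≥ 0` in
some Hilbert basis (`exists_takagi_basis`), and here `l i < 1`. The Gaussian then factors into
one-dimensional ones, of squared norm `∏ (1 - l i²)^(-1/2)`, which is `Det(1 - Z²)^(-1/2)`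
(`exists_gaussian_vector`, `fredholmDet_one_sub_sq`). Since `t² Z` is still admissible for some t >
1, the homogeneous parts of the Gaussian decay like `t⁻ⁿ`; this decay survives creators and
annihilators, which carries all of SV into Fock space. The operator is built for `g⁻¹`, whose vacuum
image is the Gaussian of `Z_g`, and then passed to the adjoint (`weakOp_inv`). -/

theorem antiShift_apply (a θ : SymAlgC W) (Φ : AntiDual W) : antiShift a Φ θ = Φ (a * θ) := rfl

theorem antiMul_gen_mul (w : W) (Φ Ψ : AntiDual W) (θ : SymAlgC W) :
    antiMul Φ Ψ (gen w * θ) =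
      antiMul (antiShift (gen w) Φ) Ψ θ + antiMul Φ (antiShift (gen w) Ψ) θ :=
  congrArg (fun Ξ : AntiDual W => Ξ θ) (antiShift_antiMul w Φ Ψ)

/-- Shifting by a generator is a derivation of the product. So the algebraic laws of the product
follow by induction on the test element, for all functionals at once, without computing with the
coproduct. -/
theorem antiMul_add_left (Φ Φ' Ψ : AntiDual W) :
    antiMul (Φ + Φ') Ψ = antiMul Φ Ψ + antiMul Φ' Ψ := by
  ext θ
  induction θ using sym_induction generalizing Φ Φ' Ψ with
  | one => simp [antiMul_one, add_mul]
  | gen_mul w θ ih =>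
    have h : antiShift (gen w) (Φ + Φ') = antiShift (gen w) Φ + antiShift (gen w) Φ' := rfl
    simp only [antiMul_gen_mul, LinearMap.add_apply, h, ih]
    ring
  | add θ η h h' => rw [map_add, h, h', map_add]
  | smul r θ h => rw [map_smulₛₗ, h, map_smulₛₗ]

theorem antiMul_smul_left (r : ℂ) (Φ Ψ : AntiDual W) :
    antiMul (r • Φ) Ψ = r • antiMul Φ Ψ := by
  ext θ
  induction θ using sym_induction generalizing Φ Ψ with
  | one => simp [antiMul_one, mul_assoc]
  | gen_mul w θ ih =>
    have h : antiShift (gen w) (r • Φ) = r • antiShift (gen w) Φ := rfl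
    simp only [antiMul_gen_mul, LinearMap.smul_apply, h, ih, smul_eq_mul]
    ring
  | add θ η h h' => rw [map_add, h, h', map_add]
  | smul r θ h => rw [map_smulₛₗ, h, map_smulₛₗ]

theorem antiMul_comm (Φ Ψ : AntiDual W) : antiMul Φ Ψ = antiMul Ψ Φ := by
  ext θ
  induction θ using sym_induction generalizing Φ Ψ with
  | one => simp only [antiMul_one]; ring
  | gen_mul w θ ih =>
    rw [antiMul_gen_mul, antiMul_gen_mul, ih, ih Φ]
    ring
  | add θ η h h' => rw [map_add, h, h', map_add]
  | smul r θ h => rw [map_smulₛₗ, h, map_smulₛₗ]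

theorem antiMul_assoc (Φ Ψ Ξ : AntiDual W) :
    antiMul (antiMul Φ Ψ) Ξ = antiMul Φ (antiMul Ψ Ξ) := by
  ext θ
  induction θ using sym_induction generalizing Φ Ψ Ξ with
  | one => simp only [antiMul_one]; ring
  | gen_mul w θ ih =>
    rw [antiMul_gen_mul, antiMul_gen_mul, antiShift_antiMul, antiShift_antiMul, antiMul_add_left,
      antiMul_comm Φ (_ + _), antiMul_add_left, LinearMap.add_apply, LinearMap.add_apply,
      ih, ih, ih, antiMul_comm _ Φ, antiMul_comm _ Φ]
    ring
  | add θ η h h' => rw [map_add, h, h', map_add]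
  | smul r θ h => rw [map_smulₛₗ, h, map_smulₛₗ]

theorem antiShift_gen_vac (w : W) : antiShift (gen w) (vac : AntiDual W) = 0 := by
  ext θ
  simp [antiShift, vac, SymmetricAlgebra.algebraMapInv_ι]

theorem vac_antiMul (Ψ : AntiDual W) : antiMul vac Ψ = Ψ := by
  ext θ
  induction θ using sym_induction generalizing Ψ with
  | one => simp [antiMul_one, vac]
  | gen_mul w θ ih =>
    have h0 : antiMul (0 : AntiDual W) Ψ = 0 := by simpa using antiMul_smul_left 0 (0 : AntiDual W) Ψ
    rw [antiMul_gen_mul, antiShift_gen_vac, h0, ih]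
    simp [antiShift]
  | add θ η h h' => rw [map_add, h, h', map_add]
  | smul r θ h => rw [map_smulₛₗ, h, map_smulₛₗ]

theorem contract_gen_mul (f : W →ₗ[ℂ] ℂ) (w : W) (θ : SymAlgC W) :
    contract f (gen w * θ) = f w • θ + gen w * contract f θ := by
  rw [Derivation.leibniz, contract_gen, smul_eq_mul, smul_eq_mul, Algebra.smul_def]
  ring

theorem contract_one (f : W →ₗ[ℂ] ℂ) : contract f 1 = 0 := Derivation.map_one_eq_zero _

theorem quadratic_shift_shift (Z : W →ₗ⋆[ℂ] W →ₗ⋆[ℂ] ℂ) (hZ : IsSymmForm Z) (x y : W) :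
    antiShift (gen y) (antiShift (gen x) (quadratic Z hZ)) = Z x y • vac := by
  ext θ
  induction θ using sym_induction with
  | one => simp [antiShift, quadratic_gen_mul_gen, vac]
  | gen_mul w θ ih =>
    rw [LinearMap.smul_apply, ← antiShift_apply (gen w) θ vac, antiShift_gen_vac, antiShift_apply,
      antiShift_apply, quadratic_of_three]
    simp
  | add θ η h h' => rw [map_add, h, h', map_add]
  | smul r θ h => rw [map_smulₛₗ, h, map_smulₛₗ]

/-- The shifted quadratic is concentrated in degree one, and multiplication by a degree-one
functional is dual to a derivation, because generators are primitive. -/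
theorem antiMul_shift_quadratic (Z : W →ₗ⋆[ℂ] W →ₗ⋆[ℂ] ℂ) (hZ : IsSymmForm Z) (x : W)
    (Ψ : AntiDual W) (θ : SymAlgC W) :
    antiMul (antiShift (gen x) (quadratic Z hZ)) Ψ θ = Ψ (contract (conjForm Z x) θ) := by
  induction θ using sym_induction generalizing Ψ with
  | one => simp [antiMul_one, antiShift, quadratic_gen]
  | gen_mul w θ ih =>
    rw [antiMul_gen_mul, quadratic_shift_shift, antiMul_smul_left, vac_antiMul, ih,
      contract_gen_mul]
    simp [conjForm, antiShift]
  | add θ η h h' => simp only [map_add, h, h']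
  | smul r θ h => simp only [map_smulₛₗ, h, Derivation.map_smul]

/-- The power rule for the derivation `antiShift (gen x)` of the commutative algebra SW'. The factor
`n + 1` turns the exponential series into itself. -/
theorem antiShift_antiPow (Z : W →ₗ⋆[ℂ] W →ₗ⋆[ℂ] ℂ) (hZ : IsSymmForm Z) (x : W) (n : ℕ) :
    antiShift (gen x) (antiPow (quadratic Z hZ) (n + 1)) =
      ((n + 1 : ℕ) : ℂ) •
        antiMul (antiShift (gen x) (quadratic Z hZ)) (antiPow (quadratic Z hZ) n) := by
  induction n with
  | zero =>
    have h0 (Φ : AntiDual W) : antiMul Φ 0 = 0 := by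
      rw [antiMul_comm]; simpa using antiMul_smul_left 0 (0 : AntiDual W) Φ
    have hp : antiPow (quadratic Z hZ) 0 = vac := rfl
    have hp' : antiPow (quadratic Z hZ) (0 + 1) = antiMul (quadratic Z hZ) vac := rfl
    rw [hp', antiShift_antiMul, hp, antiShift_gen_vac, h0]
    simp
  | succ n ih =>
    rw [antiPow, antiShift_antiMul, ih, antiMul_comm _ (_ • _), antiMul_smul_left, antiMul_assoc,
      antiMul_comm _ (quadratic Z hZ), ← antiPow]
    push_cast
    rw [Nat.succ_eq_add_one]
    module

theorem gaussian_one (Z : W →ₗ⋆[ℂ] W →ₗ⋆[ℂ] ℂ) (hZ : IsSymmForm Z) : gaussian Z hZ 1 = 1 := by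
  change ∑' n : ℕ, ((n.factorial : ℂ)⁻¹) * antiPow (quadratic Z hZ) n 1 = 1
  rw [tsum_eq_single 0]
  · simp [antiPow, vac]
  · rintro (_ | n) hn
    · exact absurd rfl hn
    · rw [antiPow, antiMul_one, quadratic_one]; simp

/-- The differential equation of the Gaussian `e^Z`. -/
theorem gaussian_gen_mul (Z : W →ₗ⋆[ℂ] W →ₗ⋆[ℂ] ℂ) (hZ : IsSymmForm Z) (x : W) (θ : SymAlgC W) :
    gaussian Z hZ (gen x * θ) = gaussian Z hZ (contract (conjForm Z x) θ) := by
  change ∑' n : ℕ, ((n.factorial : ℂ)⁻¹) * antiPow (quadratic Z hZ) n (gen x * θ) =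
    ∑' n : ℕ, ((n.factorial : ℂ)⁻¹) * antiPow (quadratic Z hZ) n (contract (conjForm Z x) θ)
  rw [(summable_antiPow (lowVanish_quadratic Z hZ) _).tsum_eq_zero_add]
  have h0 : antiPow (quadratic Z hZ) 0 (gen x * θ) = 0 :=
    congrArg (fun Ξ : AntiDual W => Ξ θ) (antiShift_gen_vac x)
  rw [h0, mul_zero, zero_add]
  refine tsum_congr fun n => ?_
  rw [← antiShift_apply, antiShift_antiPow, LinearMap.smul_apply, antiMul_shift_quadratic,
    Nat.factorial_succ]
  have : ((n + 1 : ℕ) : ℂ) ≠ 0 := by exact_mod_cast Nat.succ_ne_zero n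
  push_cast at this ⊢
  rw [smul_eq_mul, mul_inv]
  field_simp

/-- Contraction lowers degree, so the composite sees Φ only in smaller degrees. Keeping the same k
is enough for the bootstrap in `antiDual_eq_zero`. -/
theorem LowVanish.comp_contract {k : ℕ} {Φ : AntiDual W} (h : LowVanish k Φ) (f : W →ₗ[ℂ] ℂ) :
    LowVanish k (Φ.comp (contract f : SymAlgC W →ₗ[ℂ] SymAlgC W)) := by
  induction k generalizing Φ with
  | zero => trivial
  | succ k ih =>
    refine ⟨by simp, fun w => ?_⟩
    have : antiShift (gen w) (Φ.comp (contract f : SymAlgC W →ₗ[ℂ] SymAlgC W)) =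
        conj (f w) • Φ +
          (antiShift (gen w) Φ).comp (contract f : SymAlgC W →ₗ[ℂ] SymAlgC W) := by
      ext θ
      simp [antiShift, -Derivation.leibniz, contract_gen_mul]
    rw [this]
    exact (h.mono.smul _).add (ih (h.2 w))

/-- A solution of a Gaussian differential equation is determined by its value at `1`. -/
theorem antiDual_eq_zero {Φ : AntiDual W} {f : W → W →ₗ[ℂ] ℂ}
    (h : ∀ x θ, Φ (gen x * θ) = Φ (contract (f x) θ)) (h1 : Φ 1 = 0) : Φ = 0 := by
  -- Bootstrap: if Φ vanishes below degree k, the equation makes all its shifts vanish below k, so Φ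
  -- vanishes below k + 1.
  have key : ∀ k, LowVanish k Φ := fun k => by
    induction k with
    | zero => trivial
    | succ k ih =>
      refine ⟨h1, fun w => ?_⟩
      have : antiShift (gen w) Φ = Φ.comp (contract (f w) : SymAlgC W →ₗ[ℂ] SymAlgC W) :=
        LinearMap.ext fun θ => h w θ
      rw [this]
      exact ih.comp_contract _
  ext θ
  obtain ⟨k, hk⟩ := exists_lowVanish_apply θ
  exact hk Φ (key k)

theorem antiDual_eq_of_contract {Φ Ψ : AntiDual W} {f : W → W →ₗ[ℂ] ℂ}
    (h : ∀ x θ, Φ (gen x * θ) = Φ (contract (f x) θ))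
    (h' : ∀ x θ, Ψ (gen x * θ) = Ψ (contract (f x) θ)) (h1 : Φ 1 = Ψ 1) : Φ = Ψ :=
  sub_eq_zero.1 (antiDual_eq_zero (f := f) (fun x θ => by simp only [LinearMap.sub_apply, h, h'])
    (by simp [h1]))

end Algebraic

/-! ### The form on V_ℂ and contractions along V₊ and V₋ -/

section Kernel

variable {V : Type*} [NormedAddCommGroup V] [InnerProductSpace ℂ V]

theorem ofReal_sqrt_two_inv_mul_self (z : ℂ) :
    ((Real.sqrt 2 : ℂ)⁻¹) * (((Real.sqrt 2 : ℂ)⁻¹) * (z + z)) = z := by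
  have h : (Real.sqrt 2 : ℂ) * (Real.sqrt 2 : ℂ) = 2 := by
    rw [← Complex.ofReal_mul, Real.mul_self_sqrt zero_le_two]; simp
  rw [← mul_assoc, ← mul_inv, h]
  ring

theorem cplxForm_plus_left (w : V) (x : Cplx V) :
    cplxForm (plus w) x = ((Real.sqrt 2 : ℂ)⁻¹) * (cplxForm ((1 : ℂ) ⊗ₜ[ℝ] w) x +
      Complex.I * cplxForm ((1 : ℂ) ⊗ₜ[ℝ] (Complex.I • w)) x) := by
  have h1 : Complex.I ⊗ₜ[ℝ] (Complex.I • w) = Complex.I • ((1 : ℂ) ⊗ₜ[ℝ] (Complex.I • w)) := by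
    simp [TensorProduct.smul_tmul']
  rw [plus_apply, ← algebraMap_smul ℂ, h1, map_smulₛₗ, map_sub, map_smulₛₗ]
  simp [mul_add]

theorem cplxForm_minus_left (w : V) (x : Cplx V) :
    cplxForm (minus w) x = ((Real.sqrt 2 : ℂ)⁻¹) * (cplxForm ((1 : ℂ) ⊗ₜ[ℝ] w) x -
      Complex.I * cplxForm ((1 : ℂ) ⊗ₜ[ℝ] (Complex.I • w)) x) := by
  have h1 : Complex.I ⊗ₜ[ℝ] (Complex.I • w) = Complex.I • ((1 : ℂ) ⊗ₜ[ℝ] (Complex.I • w)) := by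
    simp [TensorProduct.smul_tmul']
  rw [minus_apply, ← algebraMap_smul ℂ, h1, map_smulₛₗ, map_add, map_smulₛₗ]
  simp [sub_eq_add_neg, mul_add]

theorem cplxForm_plus_plus (w v : V) : cplxForm (plus w) (plus v) = ⟪w, v⟫_ℂ := by
  rw [cplxForm_plus_left, cplxForm_tmul_plus, cplxForm_tmul_plus, inner_smul_left,
    Complex.conj_I]
  conv_rhs => rw [← ofReal_sqrt_two_inv_mul_self ⟪w, v⟫_ℂ]
  ring_nf
  simp only [Complex.I_sq]
  ring

theorem cplxForm_plus_minus (w v : V) : cplxForm (plus w) (minus v) = 0 := by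
  rw [cplxForm_plus_left, cplxForm_tmul_minus, cplxForm_tmul_minus, inner_smul_right]
  ring_nf
  simp only [Complex.I_sq]
  ring

theorem cplxForm_minus_plus (w v : V) : cplxForm (minus w) (plus v) = 0 := by
  rw [cplxForm_minus_left, cplxForm_tmul_plus, cplxForm_tmul_plus, inner_smul_left, Complex.conj_I]
  ring_nf
  simp only [Complex.I_sq]
  ring

theorem cplxForm_minus_minus (w v : V) : cplxForm (minus w) (minus v) = ⟪v, w⟫_ℂ := by
  rw [cplxForm_minus_left, cplxForm_tmul_minus, cplxForm_tmul_minus, inner_smul_right]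
  conv_rhs => rw [← ofReal_sqrt_two_inv_mul_self ⟪v, w⟫_ℂ]
  ring_nf
  simp only [Complex.I_sq]
  ring

theorem symPlus_gen_mul (v : V) (ψ : SymAlgC V) :
    symPlus (gen v * ψ) = gen (plus v) * symPlus ψ := by
  simp [symPlus]

theorem symMinus_gen_mul (v : V) (φ : SymAlgC V) :
    symMinus (gen v * φ) = gen (minus v) * symMinus φ := by
  rw [symMinus, antiLift_mul, antiLift_gen]
  rfl

theorem symMinus_one : symMinus (1 : SymAlgC V) = 1 := antiLift_one _

/-- Only the values of f on V₊ matter here, and they make the contraction agree with `annihilator u`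
on generators. With `contract_symMinus` this translates the Gaussian equation on V_ℂ into operators
on SV. -/
theorem contract_symPlus {f : Cplx V →ₗ[ℂ] ℂ} {u : V} (h : ∀ w, f (plus w) = ⟪u, w⟫_ℂ)
    (ψ : SymAlgC V) : contract f (symPlus ψ) = symPlus (annihilator u ψ) := by
  induction ψ using sym_induction with
  | one => rw [map_one, contract_one, annihilator_one, map_zero]
  | gen_mul w θ ih =>
    rw [symPlus_gen_mul, contract_gen_mul, annihilator_gen_mul, ih, map_add, map_smul,
      symPlus_gen_mul, h]
  | add θ η h h' => simp only [map_add, h, h']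
  | smul r θ h => simp only [map_smul, Derivation.map_smul, h]

theorem contract_symMinus {f : Cplx V →ₗ[ℂ] ℂ} {u : V} (h : ∀ w, f (minus w) = ⟪w, u⟫_ℂ)
    (φ : SymAlgC V) : contract f (symMinus φ) = symMinus (annihilator u φ) := by
  induction φ using sym_induction with
  | one => rw [symMinus_one, contract_one, annihilator_one, map_zero]
  | gen_mul w θ ih =>
    rw [symMinus_gen_mul, contract_gen_mul, annihilator_gen_mul, ih, map_add, map_smulₛₗ,
      symMinus_gen_mul, h, inner_conj_symm]
  | add θ η h h' => simp only [map_add, h, h']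
  | smul r θ h => simp only [map_smulₛₗ, Derivation.map_smul, h, RingHom.id_apply]

theorem gen_add (v w : V) : (gen (v + w) : SymAlgC V) = gen v + gen w := map_add _ _ _

theorem annihilator_neg (v : V) : annihilator (-v) = -annihilator v := by
  ext θ
  have h := congrArg (fun f : Module.End ℂ (SymAlgC V) => f θ) (annihilator_smul (-1) v)
  simpa using h

end Kernel

/-! ### Intertwining relations of the weak operator U_g -/

section Symplectic

variable {V : Type*} [NormedAddCommGroup V] [InnerProductSpace ℂ V] [CompleteSpace V]

/-- The antilinear part of `g⁻¹g = 1`, multiplied by the inverse of `C_{g⁻¹}`. -/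
theorem Zg_inv_Cg (g : SpGroup V) (v : V) : Zg g⁻¹ (Cg g v) = -Ag g v := by
  apply (CgEquiv g⁻¹).injective
  rw [map_neg]
  change Cg g⁻¹ ((CgEquiv g⁻¹).symm (Ag g⁻¹ (Cg g v))) = -Cg g⁻¹ (Ag g v)
  rw [Cg_CgEquiv_symm]
  exact eq_neg_of_add_eq_zero_right (Cg_Ag_inv g v).2

theorem Cg_Zg (g : SpGroup V) (v : V) : Cg g (Zg g v) = Ag g v := Cg_CgEquiv_symm g (Ag g v)

theorem CgEquiv_symm_Cg (g : SpGroup V) (v : V) : (CgEquiv g).symm (Cg g v) = v :=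
  (CgEquiv g).symm_apply_apply v

/-- After applying `C_{g⁻¹}`, the antilinear part of `g⁻¹g = 1` moves `A_g` to `A_{g⁻¹}`, and the
linear part finishes. -/
theorem CgEquiv_inv_symm_add (g : SpGroup V) (v : V) :
    (CgEquiv g⁻¹).symm v + Ag g (Zg g v) = Cg g v := by
  apply (CgEquiv g⁻¹).injective
  change Cg g⁻¹ ((CgEquiv g⁻¹).symm v + Ag g (Zg g v)) = Cg g⁻¹ (Cg g v)
  rw [map_add, Cg_CgEquiv_symm, eq_neg_of_add_eq_zero_left (Cg_Ag_inv g (Zg g v)).2, Cg_Zg,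
    eq_sub_of_add_eq (Cg_Ag_inv g v).1]
  abel

theorem conjForm_kernel_plus_plus (g : SpGroup V) (v w : V) :
    conjForm (kernelForm g) (plus v) (plus w) = ⟪Zg g⁻¹ v, w⟫_ℂ := by
  change conj (cplxForm (plus w) (kernelMap g (plus v))) = _
  rw [kernelMap, fromParts_plus]
  simp [cplxForm_plus_plus, cplxForm_plus_minus]

theorem conjForm_kernel_plus_minus (g : SpGroup V) (v w : V) :
    conjForm (kernelForm g) (plus v) (minus w) = ⟪w, (CgEquiv g).symm v⟫_ℂ := by
  change conj (cplxForm (minus w) (kernelMap g (plus v))) = _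
  rw [kernelMap, fromParts_plus]
  simp [cplxForm_minus_plus, cplxForm_minus_minus]

theorem conjForm_kernel_minus_plus (g : SpGroup V) (v w : V) :
    conjForm (kernelForm g) (minus v) (plus w) = ⟪(CgEquiv g⁻¹).symm v, w⟫_ℂ := by
  change conj (cplxForm (plus w) (kernelMap g (minus v))) = _
  rw [kernelMap, fromParts_minus]
  simp [cplxForm_plus_plus, cplxForm_plus_minus]

theorem conjForm_kernel_minus_minus (g : SpGroup V) (v w : V) :
    conjForm (kernelForm g) (minus v) (minus w) = ⟪w, Zg g v⟫_ℂ := by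
  change conj (cplxForm (minus w) (kernelMap g (minus v))) = _
  rw [kernelMap, fromParts_minus]
  simp [cplxForm_minus_plus, cplxForm_minus_minus]

theorem weakOp_apply (g : SpGroup V) (φ ψ : SymAlgC V) : weakOp g φ ψ =
    gaussian (kernelForm g) (kernelForm_symm g) (symPlus ψ * symMinus φ) := rfl

theorem weakOp_one_one (g : SpGroup V) : weakOp g 1 1 = 1 := by
  rw [weakOp_apply, map_one, symMinus_one, one_mul, gaussian_one]

/-- The Gaussian equation in the direction v₋. The Leibniz rule splits the contraction over the
factors ψ₊ and φ₋, and the two terms come from the V₊ and V₋ components of the kernel map at v₋. -/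
theorem weakOp_gen_mul (g : SpGroup V) (v : V) (φ ψ : SymAlgC V) :
    weakOp g (gen v * φ) ψ =
      weakOp g φ (annihilator ((CgEquiv g⁻¹).symm v) ψ) + weakOp g (annihilator (Zg g v) φ) ψ := by
  rw [weakOp_apply, symMinus_gen_mul, mul_left_comm, gaussian_gen_mul, Derivation.leibniz,
    contract_symPlus (conjForm_kernel_minus_plus g v),
    contract_symMinus (conjForm_kernel_minus_minus g v), map_add, weakOp_apply, weakOp_apply,
    smul_eq_mul, smul_eq_mul, mul_comm (symMinus φ), add_comm]

theorem weakOp_apply_gen_mul (g : SpGroup V) (v : V) (φ ψ : SymAlgC V) :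
    weakOp g φ (gen v * ψ) =
      weakOp g φ (annihilator (Zg g⁻¹ v) ψ) + weakOp g (annihilator ((CgEquiv g).symm v) φ) ψ := by
  rw [weakOp_apply, symPlus_gen_mul, mul_assoc, gaussian_gen_mul, Derivation.leibniz,
    contract_symPlus (conjForm_kernel_plus_plus g v),
    contract_symMinus (conjForm_kernel_plus_minus g v), map_add, weakOp_apply, weakOp_apply,
    smul_eq_mul, smul_eq_mul, mul_comm (symMinus φ), add_comm]

/-- `U a(v) = (a(C v) + c(A v)) U`. -/
theorem weakOp_annihilator (g : SpGroup V) (v : V) (φ ψ : SymAlgC V) :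
    weakOp g (annihilator v φ) ψ =
      weakOp g φ (gen (Cg g v) * ψ) + weakOp g φ (annihilator (Ag g v) ψ) := by
  rw [weakOp_apply_gen_mul, Zg_inv_Cg, CgEquiv_symm_Cg, annihilator_neg]
  simp

/-- `U c(v) = (c(C v) + a(A v)) U`. -/
theorem weakOp_creator (g : SpGroup V) (v : V) (φ ψ : SymAlgC V) :
    weakOp g (gen v * φ) ψ =
      weakOp g φ (annihilator (Cg g v) ψ) + weakOp g φ (gen (Ag g v) * ψ) := by
  rw [weakOp_gen_mul, weakOp_annihilator, Cg_Zg, ← CgEquiv_inv_symm_add, annihilator_add,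
    LinearMap.add_apply, map_add]
  ring

theorem weakOp_ne_zero (g : SpGroup V) : weakOp g ≠ 0 := fun h => by
  have := weakOp_one_one g
  rw [h] at this
  simp at this

theorem isWeakMetaplectic_weakOp (g : SpGroup V) : IsWeakMetaplectic g (weakOp g) := by
  refine ⟨weakOp_ne_zero g, fun v φ => ?_⟩
  ext ψ
  change weakOp g (((Real.sqrt 2 : ℂ)⁻¹) • (gen v * φ + annihilator v φ)) ψ =
    weakOp g φ (((Real.sqrt 2 : ℂ)⁻¹) • (gen ((g : V ≃ₗ[ℝ] V) v) * ψ +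
      annihilator ((g : V ≃ₗ[ℝ] V) v) ψ))
  rw [← Cg_add_Ag, annihilator_add, gen_add, map_smul, map_smulₛₗ, LinearMap.smul_apply, map_add,
    LinearMap.add_apply, weakOp_creator, weakOp_annihilator, add_mul, LinearMap.add_apply]
  simp only [map_add, map_inv₀, Complex.conj_ofReal, smul_eq_mul]
  ring

theorem weakOp_one_gen_mul (g : SpGroup V) (v : V) (ψ : SymAlgC V) :
    weakOp g 1 (gen v * ψ) = weakOp g 1 (annihilator (Zg g⁻¹ v) ψ) := by
  rw [weakOp_apply_gen_mul, annihilator_one]; simp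

/-- The kernels of `U_g` and `U_{g⁻¹}` are adjoint. -/
theorem weakOp_inv (g : SpGroup V) (φ ψ : SymAlgC V) :
    conj (weakOp g⁻¹ ψ φ) = weakOp g φ ψ := by
  -- Both sides, as functionals of ψ, solve the Gaussian equation for `Z_{g⁻¹}` and equal 1 at 1.
  have h0 : ∀ ψ : SymAlgC V, conj (weakOp g⁻¹ ψ 1) = weakOp g 1 ψ := by
    let Ψ : AntiDual V :=
      { toFun := fun ψ => conj (weakOp g⁻¹ ψ 1)
        map_add' := fun ψ ψ' => by simp
        map_smul' := fun r ψ => by simp }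
    have : Ψ = weakOp g 1 := by
      refine antiDual_eq_of_contract (f := fun v => (innerSL ℂ (Zg g⁻¹ v)).toLinearMap)
        (fun v ψ => ?_) (fun v ψ => weakOp_one_gen_mul g v ψ) ?_
      · change conj (weakOp g⁻¹ (gen v * ψ) 1) = conj (weakOp g⁻¹ (annihilator (Zg g⁻¹ v) ψ) 1)
        rw [weakOp_gen_mul, annihilator_one]
        simp
      · change conj (weakOp g⁻¹ 1 1) = _
        rw [weakOp_one_one, weakOp_one_one, map_one]
    exact fun ψ => congrArg (fun Φ : AntiDual V => Φ ψ) this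
  induction φ using sym_induction generalizing ψ with
  | one => exact h0 ψ
  | gen_mul v φ ih =>
    have h1 := Cg_Ag_inv g v
    rw [weakOp_creator, ← ih, ← ih, weakOp_annihilator, weakOp_creator]
    simp only [← map_add]
    congr 1
    conv_lhs => rw [← h1.1, gen_add, add_mul, map_add]
    -- Moving `gen v` through the relations for g and then for g⁻¹ produces creators along `(CC +
    -- AA)v = v` and annihilators along `(CA + AC)v = 0`.
    have h2 : weakOp g⁻¹ ψ (annihilator (Cg g⁻¹ (Ag g v) + Ag g⁻¹ (Cg g v)) φ) = 0 := by
      rw [h1.2, ← zero_smul ℂ (0 : V), annihilator_smul]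
      simp
    rw [annihilator_add, LinearMap.add_apply, map_add] at h2
    simp only [map_add]
    linear_combination -h2
  | add θ η h h' => simp [← h, ← h']
  | smul r θ h => simp [← h]

end Symplectic

/-! ### The grading of Fock space and norm bounds in fixed degree -/

section Degree

variable {V : Type*} [NormedAddCommGroup V] [InnerProductSpace ℂ V]

/-- The algebra homomorphism `SV → SV[X]` that multiplies the part of degree `n` by `Xⁿ`. -/
def degHom : SymAlgC V →ₐ[ℂ] Polynomial (SymAlgC V) :=
  SymmetricAlgebra.lift
    (((Polynomial.monomial 1 : SymAlgC V →ₗ[SymAlgC V] _).restrictScalars ℂ) ∘ₗ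
      SymmetricAlgebra.ι ℂ V)

/-- The projection of `SV` onto its homogeneous summand of degree `n`. -/
def degPart (n : ℕ) : SymAlgC V →ₗ[ℂ] SymAlgC V :=
  ((Polynomial.lcoeff (SymAlgC V) n).restrictScalars ℂ) ∘ₗ degHom.toLinearMap

theorem degPart_apply (n : ℕ) (θ : SymAlgC V) : degPart n θ = (degHom θ).coeff n := rfl

theorem degHom_gen (v : V) : degHom (gen v) = Polynomial.monomial 1 (gen v) := by
  simp [degHom]

theorem degPart_one (n : ℕ) : degPart n (1 : SymAlgC V) = if n = 0 then 1 else 0 := by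
  rw [degPart_apply, map_one, Polynomial.coeff_one]

theorem degPart_zero_gen_mul (v : V) (θ : SymAlgC V) : degPart 0 (gen v * θ) = 0 := by
  rw [degPart_apply, map_mul, degHom_gen, ← Polynomial.C_mul_X_eq_monomial, mul_assoc,
    Polynomial.coeff_C_mul, Polynomial.coeff_X_mul_zero, mul_zero]

theorem degPart_succ_gen_mul (n : ℕ) (v : V) (θ : SymAlgC V) :
    degPart (n + 1) (gen v * θ) = gen v * degPart n θ := by
  rw [degPart_apply, map_mul, degHom_gen, ← Polynomial.C_mul_X_eq_monomial, mul_assoc,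
    Polynomial.coeff_C_mul, Polynomial.coeff_X_mul, degPart_apply]

/-- The two claims are proved together, because the inductive step of the first at `n = 0` needs the
second. -/
theorem annihilator_degPart (n : ℕ) (v : V) (θ : SymAlgC V) :
    annihilator v (degPart (n + 1) θ) = degPart n (annihilator v θ) ∧
      annihilator v (degPart 0 θ) = 0 := by
  induction θ using sym_induction generalizing n with
  | one => simp [degPart_one, annihilator_one]
  | gen_mul w θ ih =>
    refine ⟨?_, by rw [degPart_zero_gen_mul, map_zero]⟩
    rw [degPart_succ_gen_mul, annihilator_gen_mul, annihilator_gen_mul, map_add, map_smul]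
    rcases n with _ | n
    · rw [(ih 0).2, degPart_zero_gen_mul, mul_zero]
    · rw [(ih n).1, degPart_succ_gen_mul]
  | add θ η h h' => simp [(h n).1, (h' n).1, (h n).2, (h' n).2]
  | smul r θ h => simp [(h n).1, (h n).2]

theorem annihilator_degPart_succ (n : ℕ) (v : V) (θ : SymAlgC V) :
    annihilator v (degPart (n + 1) θ) = degPart n (annihilator v θ) :=
  (annihilator_degPart n v θ).1

theorem annihilator_degPart_zero (v : V) (θ : SymAlgC V) : annihilator v (degPart 0 θ) = 0 :=
  (annihilator_degPart 0 v θ).2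

theorem degPart_degPart (m n : ℕ) (θ : SymAlgC V) :
    degPart m (degPart n θ) = if m = n then degPart n θ else 0 := by
  induction θ using sym_induction generalizing m n with
  | one =>
    rw [degPart_one]
    split_ifs with h1 h2 h2
    · rw [degPart_one, if_pos (h2.trans h1)]
    · rw [degPart_one, if_neg (by omega)]
    · simp
    · simp
  | gen_mul w θ ih =>
    rcases n with _ | n
    · simp [degPart_zero_gen_mul]
    · rw [degPart_succ_gen_mul]
      rcases m with _ | m
      · rw [degPart_zero_gen_mul]; simp
      · rw [degPart_succ_gen_mul, ih]
        simp
  | add θ η h h' => simp only [map_add, h, h']; split_ifs <;> simp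
  | smul r θ h => simp only [map_smul, h]; split_ifs <;> simp

theorem exists_sum_degPart (θ : SymAlgC V) :
    ∃ N, ∀ M, N ≤ M → ∑ n ∈ Finset.range M, degPart n θ = θ := by
  induction θ using sym_induction with
  | one =>
    refine ⟨1, fun M hM => ?_⟩
    rw [Finset.sum_eq_single 0 (fun n _ hn => by rw [degPart_one, if_neg hn])
      (fun h => absurd (Finset.mem_range.2 hM) h), degPart_one, if_pos rfl]
  | gen_mul w θ ih =>
    obtain ⟨N, hN⟩ := ih
    refine ⟨N + 1, fun M hM => ?_⟩
    obtain ⟨M, rfl⟩ := Nat.exists_eq_succ_of_ne_zero (by omega : M ≠ 0)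
    rw [Nat.succ_eq_add_one, Finset.sum_range_succ', degPart_zero_gen_mul, add_zero]
    simp only [degPart_succ_gen_mul]
    rw [← Finset.mul_sum, hN M (by omega)]
  | add θ η h h' =>
    obtain ⟨N, hN⟩ := h
    obtain ⟨N', hN'⟩ := h'
    refine ⟨max N N', fun M hM => ?_⟩
    simp only [map_add, Finset.sum_add_distrib]
    rw [hN M (by omega), hN' M (by omega)]
  | smul r θ h =>
    obtain ⟨N, hN⟩ := h
    exact ⟨N, fun M hM => by simp only [map_smul, ← Finset.smul_sum, hN M hM]⟩

theorem vac_degPart (n : ℕ) (θ : SymAlgC V) :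
    vac (degPart n θ) = if n = 0 then vac θ else 0 := by
  induction θ using sym_induction generalizing n with
  | one => rw [degPart_one]; split_ifs <;> simp
  | gen_mul w θ ih =>
    rcases n with _ | n
    · rw [degPart_zero_gen_mul, vac_gen_mul]; simp
    · rw [degPart_succ_gen_mul, vac_gen_mul]; simp
  | add θ η h h' => simp only [map_add, h, h']; split_ifs <;> simp
  | smul r θ h => simp only [map_smul, map_smulₛₗ, h]; split_ifs <;> simp

theorem symToDual_degPart (n : ℕ) (φ ψ : SymAlgC V) :
    symToDual (degPart n φ) ψ = symToDual φ (degPart n ψ) := by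
  induction φ using sym_induction generalizing n ψ with
  | one =>
    rw [degPart_one, symToDual_one, vac_degPart]
    split_ifs
    · rw [symToDual_one]
    · simp
  | gen_mul w φ ih =>
    rcases n with _ | n
    · rw [degPart_zero_gen_mul, symToDual_gen_mul, annihilator_degPart_zero]; simp
    · rw [degPart_succ_gen_mul, symToDual_gen_mul, symToDual_gen_mul, ih, annihilator_degPart_succ]
  | add θ η h h' => simp only [map_add, LinearMap.add_apply, h, h']
  | smul r θ h => simp only [map_smul, LinearMap.smul_apply, h]

theorem sym_inner_def (ψ φ : SymAlgC V) : ⟪ψ, φ⟫_ℂ = symToDual φ ψ := rfl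

theorem inner_degPart_left (n : ℕ) (ψ φ : SymAlgC V) :
    ⟪degPart n ψ, φ⟫_ℂ = ⟪ψ, degPart n φ⟫_ℂ := (symToDual_degPart n φ ψ).symm

theorem inner_gen_mul_left (v : V) (ψ φ : SymAlgC V) :
    ⟪gen v * ψ, φ⟫_ℂ = ⟪ψ, annihilator v φ⟫_ℂ := symToDual_apply_gen_mul v φ ψ

theorem inner_gen_mul_right (v : V) (ψ φ : SymAlgC V) :
    ⟪ψ, gen v * φ⟫_ℂ = ⟪annihilator v ψ, φ⟫_ℂ := symToDual_gen_mul v φ ψ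

theorem inner_degPart_self (n : ℕ) (θ : SymAlgC V) :
    ⟪θ, degPart n θ⟫_ℂ = (‖degPart n θ‖ ^ 2 : ℝ) := by
  have h : degPart n θ = degPart n (degPart n θ) := by rw [degPart_degPart, if_pos rfl]
  rw [h, ← inner_degPart_left, ← h, inner_self_eq_norm_sq_to_K]
  push_cast
  rfl

theorem sum_norm_degPart_sq_le (M : ℕ) (θ : SymAlgC V) :
    ∑ n ∈ Finset.range M, ‖degPart n θ‖ ^ 2 ≤ ‖θ‖ ^ 2 := by
  obtain ⟨N, hN⟩ := exists_sum_degPart θ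
  have h : ‖θ‖ ^ 2 = ∑ n ∈ Finset.range (max M N), ‖degPart n θ‖ ^ 2 := by
    have h1 : ⟪θ, ∑ n ∈ Finset.range (max M N), degPart n θ⟫_ℂ =
        ((∑ n ∈ Finset.range (max M N), ‖degPart n θ‖ ^ 2 : ℝ) : ℂ) := by
      rw [inner_sum]
      push_cast
      exact Finset.sum_congr rfl fun n _ => by rw [inner_degPart_self]; push_cast; rfl
    rw [hN _ (le_max_right _ _), inner_self_eq_norm_sq_to_K] at h1
    exact Complex.ofReal_injective (by rw [← h1]; push_cast; rfl)
  rw [h]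
  exact Finset.sum_le_sum_of_subset_of_nonneg (Finset.range_mono (le_max_left _ _))
    fun _ _ _ => sq_nonneg _

theorem norm_degPart_le (n : ℕ) (θ : SymAlgC V) : ‖degPart n θ‖ ≤ ‖θ‖ := by
  have h := sum_norm_degPart_sq_le (n + 1) θ
  rw [Finset.sum_range_succ] at h
  have h' : 0 ≤ ∑ k ∈ Finset.range n, ‖degPart k θ‖ ^ 2 :=
    Finset.sum_nonneg fun _ _ => sq_nonneg _
  exact le_of_sq_le_sq (by linarith) (norm_nonneg _)

/-- The commutation relation `a(v)c(v) = c(v)a(v) + ‖v‖²`, evaluated in the state θ. -/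
theorem norm_gen_mul_sq (v : V) (θ : SymAlgC V) :
    ‖gen v * θ‖ ^ 2 = ‖annihilator v θ‖ ^ 2 + ‖v‖ ^ 2 * ‖θ‖ ^ 2 := by
  have h : ⟪gen v * θ, gen v * θ⟫_ℂ =
      ⟪annihilator v θ, annihilator v θ⟫_ℂ + ⟪v, v⟫_ℂ * ⟪θ, θ⟫_ℂ := by
    rw [inner_gen_mul_left, annihilator_gen_mul, inner_add_right, inner_smul_right,
      inner_gen_mul_right, add_comm]
  simp only [inner_self_eq_norm_sq_to_K] at h
  exact_mod_cast h

/-- Induction on the degree. For `η = a(v)θ` with θ of degree n + 1, adjointness gives `‖η‖² ≤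
‖c(v)η‖ ‖θ‖`, while the commutation relation and the bound for η, of degree n, give `‖c(v)η‖² ≤
(n+1)‖v‖²‖η‖²`. -/
theorem norm_annihilator_degPart_sq_le (n : ℕ) (v : V) (θ : SymAlgC V) :
    ‖annihilator v (degPart n θ)‖ ^ 2 ≤ n * ‖v‖ ^ 2 * ‖degPart n θ‖ ^ 2 := by
  induction n generalizing θ with
  | zero => rw [annihilator_degPart_zero]; simp
  | succ n ih =>
    obtain ⟨η, hη⟩ : ∃ η, η = annihilator v (degPart (n + 1) θ) := ⟨_, rfl⟩
    have h1 : ‖η‖ ^ 2 ≤ ‖gen v * η‖ * ‖degPart (n + 1) θ‖ := by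
      have h : ⟪gen v * η, degPart (n + 1) θ⟫_ℂ = ((‖η‖ ^ 2 : ℝ) : ℂ) := by
        rw [inner_gen_mul_left, ← hη, inner_self_eq_norm_sq_to_K]
        push_cast
        rfl
      have h' := norm_inner_le_norm (𝕜 := ℂ) (gen v * η) (degPart (n + 1) θ)
      rwa [h, Complex.norm_real, Real.norm_of_nonneg (sq_nonneg _)] at h'
    have h2 : ‖gen v * η‖ ^ 2 ≤ (n + 1) * ‖v‖ ^ 2 * ‖η‖ ^ 2 := by
      rw [norm_gen_mul_sq]
      have h3 : η = degPart n (annihilator v θ) := by rw [hη, annihilator_degPart_succ]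
      have := ih (annihilator v θ)
      rw [← h3] at this
      linarith
    rw [← hη]
    push_cast
    rcases (norm_nonneg η).eq_or_lt with h0 | h0
    · rw [← h0, zero_pow two_ne_zero]; positivity
    · refine le_of_mul_le_mul_left ?_ (by positivity : 0 < ‖η‖ ^ 2)
      calc ‖η‖ ^ 2 * ‖η‖ ^ 2 ≤ (‖gen v * η‖ * ‖degPart (n + 1) θ‖) *
            (‖gen v * η‖ * ‖degPart (n + 1) θ‖) := by gcongr
        _ = ‖gen v * η‖ ^ 2 * ‖degPart (n + 1) θ‖ ^ 2 := by ring
        _ ≤ ((n + 1) * ‖v‖ ^ 2 * ‖η‖ ^ 2) * ‖degPart (n + 1) θ‖ ^ 2 := by gcongr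
        _ = _ := by ring

theorem norm_annihilator_degPart_le (n : ℕ) (v : V) (θ : SymAlgC V) :
    ‖annihilator v (degPart n θ)‖ ≤ Real.sqrt n * ‖v‖ * ‖degPart n θ‖ := by
  refine le_of_sq_le_sq ?_ (by positivity)
  rw [mul_pow, mul_pow, Real.sq_sqrt (Nat.cast_nonneg n)]
  exact norm_annihilator_degPart_sq_le n v θ

theorem norm_gen_mul_degPart_le (n : ℕ) (v : V) (θ : SymAlgC V) :
    ‖gen v * degPart n θ‖ ≤ Real.sqrt (n + 1) * ‖v‖ * ‖degPart n θ‖ := by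
  refine le_of_sq_le_sq ?_ (by positivity)
  rw [mul_pow, mul_pow, Real.sq_sqrt (by positivity), norm_gen_mul_sq]
  have := norm_annihilator_degPart_sq_le n v θ
  linarith

/-- The operator on Fock space that extends a bounded operator on `SV`. -/
def extOp (f : SymAlgC V →ₗ[ℂ] SymAlgC V) (C : ℝ) (h : ∀ θ, ‖f θ‖ ≤ C * ‖θ‖) :
    Fock V →L[ℂ] Fock V :=
  (toFock.toContinuousLinearMap.comp (f.mkContinuous C h)).extend toFock.toContinuousLinearMap

theorem denseRange_toFock : DenseRange (toFock : SymAlgC V → Fock V) :=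
  UniformSpace.Completion.denseRange_coe

theorem extOp_toFock (f : SymAlgC V →ₗ[ℂ] SymAlgC V) (C : ℝ) (h : ∀ θ, ‖f θ‖ ≤ C * ‖θ‖)
    (θ : SymAlgC V) : extOp f C h (toFock θ) = toFock (f θ) := by
  have h1 : DenseRange (toFock.toContinuousLinearMap : SymAlgC V →L[ℂ] Fock V) := denseRange_toFock
  have h2 : IsUniformInducing (toFock.toContinuousLinearMap : SymAlgC V →L[ℂ] Fock V) :=
    toFock.isometry.isUniformInducing
  exact ContinuousLinearMap.extend_eq (toFock.toContinuousLinearMap.comp (f.mkContinuous C h)) h1 h2 θ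

/-- The projection of Fock space onto its homogeneous summand of degree `n`. -/
def fockPart (n : ℕ) : Fock V →L[ℂ] Fock V :=
  extOp (degPart n) 1 fun θ => by rw [one_mul]; exact norm_degPart_le n θ

theorem fockPart_toFock (n : ℕ) (θ : SymAlgC V) : fockPart n (toFock θ) = toFock (degPart n θ) :=
  extOp_toFock _ _ _ θ

theorem fock_induction {P : Fock V → Prop} (hP : IsClosed {Φ | P Φ}) (h : ∀ θ, P (toFock θ))
    (Φ : Fock V) : P Φ :=
  denseRange_toFock.induction_on Φ hP h

theorem sum_norm_fockPart_sq_le (M : ℕ) (Φ : Fock V) :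
    ∑ n ∈ Finset.range M, ‖fockPart n Φ‖ ^ 2 ≤ ‖Φ‖ ^ 2 := by
  induction Φ using fock_induction with
  | hP => exact isClosed_le (by fun_prop) (by fun_prop)
  | h θ =>
    simp only [fockPart_toFock, LinearIsometry.norm_map]
    exact sum_norm_degPart_sq_le M θ

theorem summable_norm_fockPart_sq (Φ : Fock V) : Summable fun n => ‖fockPart n Φ‖ ^ 2 :=
  summable_of_sum_range_le (fun _ => sq_nonneg _) fun M => sum_norm_fockPart_sq_le M Φ

end Degree

/-! ### Symmetry of π(v) on its natural domain, and rigidity of intertwiners -/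

section FieldSymm

variable {V : Type*} [NormedAddCommGroup V] [InnerProductSpace ℂ V]

/-- The projection of `SV` onto the sum of its homogeneous summands of degree below `M`. -/
def degCut (M : ℕ) : SymAlgC V →ₗ[ℂ] SymAlgC V := ∑ n ∈ Finset.range M, degPart n

theorem degCut_apply (M : ℕ) (θ : SymAlgC V) :
    degCut M θ = ∑ n ∈ Finset.range M, degPart n θ := by
  simp [degCut]

theorem inner_degCut_left (M : ℕ) (ψ φ : SymAlgC V) :
    ⟪degCut M ψ, φ⟫_ℂ = ⟪ψ, degCut M φ⟫_ℂ := by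
  simp only [degCut_apply, sum_inner, inner_sum, inner_degPart_left]

theorem degCut_degCut (M : ℕ) (θ : SymAlgC V) : degCut M (degCut M θ) = degCut M θ := by
  simp only [degCut_apply, map_sum, degPart_degPart]
  rw [Finset.sum_comm]
  refine Finset.sum_congr rfl fun n hn => ?_
  rw [Finset.sum_ite_eq (Finset.range M) n, if_pos hn]

theorem norm_degCut_le (M : ℕ) (θ : SymAlgC V) : ‖degCut M θ‖ ≤ ‖θ‖ := by
  have h : ⟪degCut M θ, θ⟫_ℂ = ((‖degCut M θ‖ ^ 2 : ℝ) : ℂ) := by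
    rw [← degCut_degCut, inner_degCut_left, degCut_degCut, inner_self_eq_norm_sq_to_K]
    push_cast
    rfl
  have h' := norm_inner_le_norm (𝕜 := ℂ) (degCut M θ) θ
  rw [h, Complex.norm_real, Real.norm_of_nonneg (sq_nonneg _)] at h'
  rcases (norm_nonneg (degCut M θ)).eq_or_lt with h0 | h0
  · rw [← h0]; exact norm_nonneg θ
  · exact le_of_mul_le_mul_left (by rwa [← sq]) h0

/-- The projection of Fock space onto the sum of its homogeneous summands of degree below `M`. -/
def fockCut (M : ℕ) : Fock V →L[ℂ] Fock V :=
  extOp (degCut M) 1 fun θ => by rw [one_mul]; exact norm_degCut_le M θ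

theorem fockCut_toFock (M : ℕ) (θ : SymAlgC V) : fockCut M (toFock θ) = toFock (degCut M θ) :=
  extOp_toFock _ _ _ θ

theorem norm_fockCut_le (M : ℕ) (Φ : Fock V) : ‖fockCut M Φ‖ ≤ ‖Φ‖ := by
  induction Φ using fock_induction with
  | hP => exact isClosed_le (by fun_prop) (by fun_prop)
  | h θ =>
    rw [fockCut_toFock, LinearIsometry.norm_map, LinearIsometry.norm_map]
    exact norm_degCut_le M θ

/-- The cutoffs are contractions, and on the dense subspace SV they are eventually the identity. -/
theorem tendsto_fockCut (Φ : Fock V) :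
    Filter.Tendsto (fun M => fockCut M Φ) Filter.atTop (nhds Φ) := by
  rw [Metric.tendsto_atTop]
  intro ε hε
  obtain ⟨θ, hθ⟩ := denseRange_toFock.exists_dist_lt Φ (half_pos hε)
  obtain ⟨N, hN⟩ := exists_sum_degPart θ
  refine ⟨N, fun M hM => ?_⟩
  have h1 : fockCut M (toFock θ) = toFock θ := by
    rw [fockCut_toFock, degCut_apply, hN M hM]
  have h2 : fockCut M Φ - Φ = fockCut M (Φ - toFock θ) - (Φ - toFock θ) := by
    rw [map_sub, h1]; abel
  rw [dist_eq_norm] at hθ ⊢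
  rw [h2]
  calc _ ≤ ‖fockCut M (Φ - toFock θ)‖ + ‖Φ - toFock θ‖ := norm_sub_le _ _
    _ ≤ ‖Φ - toFock θ‖ + ‖Φ - toFock θ‖ := by gcongr; exact norm_fockCut_le _ _
    _ < ε := by linarith

theorem field_apply (v : V) (θ : SymAlgC V) :
    field v θ = ((Real.sqrt 2 : ℂ)⁻¹) • (gen v * θ + annihilator v θ) := rfl

theorem inner_field_left (v : V) (ψ φ : SymAlgC V) : ⟪field v ψ, φ⟫_ℂ = ⟪ψ, field v φ⟫_ℂ := by
  rw [field_apply, field_apply, inner_smul_left, inner_smul_right, inner_add_left, inner_add_right,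
    inner_gen_mul_left, inner_gen_mul_right, map_inv₀, Complex.conj_ofReal, add_comm]

theorem isFieldValue_iff (v : V) (Φ Ψ : Fock V) :
    IsFieldValue v Φ Ψ ↔ ∀ θ, ⟪toFock θ, Ψ⟫_ℂ = ⟪toFock (field v θ), Φ⟫_ℂ :=
  LinearMap.ext_iff

theorem isFieldValue_toFock (v : V) (φ : SymAlgC V) :
    IsFieldValue v (toFock φ) (toFock (field v φ)) := by
  rw [isFieldValue_iff]
  intro θ
  rw [LinearIsometry.inner_map_map, LinearIsometry.inner_map_map, inner_field_left]

/-- Since π(v) changes degree by one, its commutator with the cutoff at degree M only sees the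
transitions between the degrees M and M + 1. -/
theorem degCut_field_sub (M : ℕ) (v : V) (θ : SymAlgC V) :
    degCut (M + 1) (field v θ) - field v (degCut (M + 1) θ) =
      ((Real.sqrt 2 : ℂ)⁻¹) • (annihilator v (degPart (M + 1) θ) - gen v * degPart M θ) := by
  have h1 : degCut (M + 1) (gen v * θ) = gen v * degCut (M + 1) θ - gen v * degPart M θ := by
    rw [degCut_apply, Finset.sum_range_succ', degPart_zero_gen_mul, degCut_apply,
      Finset.sum_range_succ]
    simp only [degPart_succ_gen_mul, mul_add, Finset.mul_sum]
    abel
  have h2 : degCut (M + 1) (annihilator v θ) =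
      annihilator v (degCut (M + 1) θ) + annihilator v (degPart (M + 1) θ) := by
    rw [← map_add, degCut_apply (M + 1) θ, ← Finset.sum_range_succ, Finset.sum_range_succ', map_add,
      annihilator_degPart_zero, add_zero, map_sum, degCut_apply]
    simp only [annihilator_degPart_succ]
  rw [field_apply, field_apply, map_smul, map_add, h1, h2, ← smul_sub]
  congr 1
  abel

theorem exists_bound_field_degCut (M : ℕ) (v : V) :
    ∃ C : ℝ, ∀ θ, ‖(field v ∘ₗ degCut M : SymAlgC V →ₗ[ℂ] SymAlgC V) θ‖ ≤ C * ‖θ‖ := by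
  have h : ∀ n, ∃ C : ℝ, ∀ θ : SymAlgC V, ‖field v (degPart n θ)‖ ≤ C * ‖θ‖ := fun n => by
    refine ⟨‖(Real.sqrt 2 : ℂ)⁻¹‖ * (Real.sqrt (n + 1) * ‖v‖ + Real.sqrt n * ‖v‖), fun θ => ?_⟩
    rw [field_apply, norm_smul, mul_assoc]
    gcongr
    rw [add_mul]
    refine (norm_add_le _ _).trans (add_le_add ?_ ?_)
    · refine (norm_gen_mul_degPart_le n v θ).trans ?_
      gcongr
      exact norm_degPart_le n θ
    · refine (norm_annihilator_degPart_le n v θ).trans ?_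
      gcongr
      exact norm_degPart_le n θ
  choose C hC using h
  refine ⟨∑ n ∈ Finset.range M, C n, fun θ => ?_⟩
  rw [LinearMap.comp_apply, degCut_apply, map_sum, Finset.sum_mul]
  exact norm_sum_le_of_le _ fun n _ => hC n θ

/-- The bounded operator `π(v)` restricted to degrees below `M`. -/
def fieldCut (M : ℕ) (v : V) : Fock V →L[ℂ] Fock V :=
  extOp (field v ∘ₗ degCut M) _ (exists_bound_field_degCut M v).choose_spec

theorem fieldCut_toFock (M : ℕ) (v : V) (θ : SymAlgC V) :
    fieldCut M v (toFock θ) = toFock (field v (degCut M θ)) :=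
  extOp_toFock _ _ _ θ

/-- Measures how far the truncated field is from being symmetric. Both sides are continuous in the
two vectors, so the commutator formula on SV suffices. -/
theorem norm_inner_fieldCut_sub_le (M : ℕ) (v : V) (Φ' Φ : Fock V) :
    ‖⟪fieldCut (M + 1) v Φ', Φ⟫_ℂ - ⟪Φ', fieldCut (M + 1) v Φ⟫_ℂ‖ ≤
      ‖v‖ * (Real.sqrt (M + 1) * (‖fockPart M Φ'‖ * ‖fockPart (M + 1) Φ‖ +
        ‖fockPart (M + 1) Φ'‖ * ‖fockPart M Φ‖)) := by
  induction Φ using fock_induction with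
  | hP => exact isClosed_le (by fun_prop) (by fun_prop)
  | h φ =>
  induction Φ' using fock_induction with
  | hP => exact isClosed_le (by fun_prop) (by fun_prop)
  | h ψ =>
  simp only [fieldCut_toFock, fockPart_toFock, LinearIsometry.inner_map_map,
    LinearIsometry.norm_map]
  have hs : ‖(Real.sqrt 2 : ℂ)⁻¹‖ ≤ 1 := by
    rw [norm_inv, Complex.norm_real, Real.norm_of_nonneg (Real.sqrt_nonneg _)]
    exact inv_le_one_of_one_le₀ (Real.one_le_sqrt.2 one_le_two)
  -- Localizing ψ in the degrees M and M + 1 as well is what makes the bound summable in M up to the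
  -- factor `√(M+1)`.
  have e1 : ⟪ψ, annihilator v (degPart (M + 1) φ)⟫_ℂ =
      ⟪degPart M ψ, annihilator v (degPart (M + 1) φ)⟫_ℂ := by
    rw [inner_degPart_left, annihilator_degPart_succ, degPart_degPart, if_pos rfl]
  have e2 : ⟪ψ, gen v * degPart M φ⟫_ℂ = ⟪degPart (M + 1) ψ, gen v * degPart M φ⟫_ℂ := by
    rw [inner_degPart_left, degPart_succ_gen_mul, degPart_degPart, if_pos rfl]
  rw [inner_field_left, inner_degCut_left, ← inner_sub_right, degCut_field_sub, inner_smul_right,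
    inner_sub_right, e1, e2, norm_mul]
  refine (mul_le_of_le_one_left (norm_nonneg _) hs).trans ((norm_sub_le _ _).trans ?_)
  have b1 := (norm_inner_le_norm (𝕜 := ℂ) (degPart M ψ) (annihilator v (degPart (M + 1) φ))).trans
    (mul_le_mul_of_nonneg_left (norm_annihilator_degPart_le (M + 1) v φ) (norm_nonneg _))
  have b2 := (norm_inner_le_norm (𝕜 := ℂ) (degPart (M + 1) ψ) (gen v * degPart M φ)).trans
    (mul_le_mul_of_nonneg_left (norm_gen_mul_degPart_le M v φ) (norm_nonneg _))
  push_cast at b1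
  linarith

/-- If D were nonzero, then eventually `t n` would dominate a multiple of `1/√(n+1)`, hence of
`1/(n+1)`, and the harmonic series would converge. -/
theorem eq_zero_of_tendsto_of_le {S : ℕ → ℂ} {D : ℂ} (hS : Filter.Tendsto S Filter.atTop (nhds D))
    {K : ℝ} {t : ℕ → ℝ} (ht : Summable t) (h : ∀ n, ‖S n‖ ≤ K * (Real.sqrt (n + 1) * t n)) :
    D = 0 := by
  by_contra hD
  have hD' : 0 < ‖D‖ / 2 := half_pos (norm_pos_iff.2 hD)
  have hev : ∀ᶠ n in Filter.atTop, ‖D‖ / 2 < ‖S n‖ :=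
    hS.norm.eventually_const_lt (half_lt_self (norm_pos_iff.2 hD))
  have hsum : Summable fun n : ℕ => 1 / ((n + 1 : ℕ) : ℝ) := by
    refine Summable.of_norm_bounded_eventually_nat (ht.mul_left (K / (‖D‖ / 2))) ?_
    filter_upwards [hev] with n hn
    have h0 : (0 : ℝ) < n + 1 := by positivity
    have h1 : (1 : ℝ) ≤ Real.sqrt (n + 1) := Real.one_le_sqrt.2 (by linarith [n.cast_nonneg (α := ℝ)])
    have h2 : Real.sqrt (n + 1) * Real.sqrt (n + 1) = n + 1 := Real.mul_self_sqrt h0.le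
    rw [Real.norm_of_nonneg (by positivity), div_mul_eq_mul_div, div_le_div_iff₀ (by positivity) hD']
    push_cast
    have h3 : ‖D‖ / 2 ≤ K * t n * Real.sqrt (n + 1) := by linarith [h n]
    have h4 : 0 ≤ K * t n := nonneg_of_mul_nonneg_left (hD'.le.trans h3) (by linarith)
    nlinarith [mul_le_mul_of_nonneg_left h1 (mul_nonneg h4 (Real.sqrt_nonneg ((n : ℝ) + 1)))]
  exact Real.not_summable_one_div_natCast ((summable_nat_add_iff 1).1 hsum)

/-- The operator `π(v)` with its natural domain in Fock space is symmetric. -/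
theorem IsFieldValue.inner_symm {v : V} {Φ Ψ Φ' Ψ' : Fock V} (h : IsFieldValue v Φ Ψ)
    (h' : IsFieldValue v Φ' Ψ') : ⟪Φ', Ψ⟫_ℂ = ⟪Ψ', Φ⟫_ℂ := by
  -- Membership in the graph is tested on SV only. Since the truncated operators are bounded, the
  -- test extends to truncations of arbitrary Fock vectors, in particular of Φ and Φ'.
  have key : ∀ {Φ Ψ : Fock V} (_ : IsFieldValue v Φ Ψ) (M : ℕ) (Ξ : Fock V),
      ⟪fockCut M Ξ, Ψ⟫_ℂ = ⟪fieldCut M v Ξ, Φ⟫_ℂ := by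
    intro Φ Ψ h M Ξ
    induction Ξ using fock_induction with
    | hP => exact isClosed_eq (by fun_prop) (by fun_prop)
    | h θ =>
      rw [fockCut_toFock, fieldCut_toFock]
      exact (isFieldValue_iff v Φ Ψ).1 h _
  have hlim : Filter.Tendsto (fun M => ⟪fockCut (M + 1) Φ', Ψ⟫_ℂ - ⟪Ψ', fockCut (M + 1) Φ⟫_ℂ)
      Filter.atTop (nhds (⟪Φ', Ψ⟫_ℂ - ⟪Ψ', Φ⟫_ℂ)) := by
    refine Filter.Tendsto.sub ?_ ?_
    · exact (((tendsto_fockCut Φ').comp (Filter.tendsto_add_atTop_nat 1)).inner tendsto_const_nhds)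
    · exact (tendsto_const_nhds.inner ((tendsto_fockCut Φ).comp (Filter.tendsto_add_atTop_nat 1)))
  -- Products of norms of adjacent homogeneous parts are dominated by sums of their squares.
  have hsum : Summable fun M => ‖fockPart M Φ'‖ * ‖fockPart (M + 1) Φ‖ +
        ‖fockPart (M + 1) Φ'‖ * ‖fockPart M Φ‖ := by
    have s1 := summable_norm_fockPart_sq Φ
    have s2 := summable_norm_fockPart_sq Φ'
    have s3 := (summable_nat_add_iff 1).2 s1
    have s4 := (summable_nat_add_iff 1).2 s2
    refine Summable.of_nonneg_of_le (fun n => by positivity) (fun n => ?_)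
      (((s1.add s2).add s3).add s4)
    nlinarith [sq_nonneg (‖fockPart n Φ'‖ - ‖fockPart (n + 1) Φ‖),
      sq_nonneg (‖fockPart (n + 1) Φ'‖ - ‖fockPart n Φ‖), sq_nonneg ‖fockPart n Φ'‖,
      sq_nonneg ‖fockPart (n + 1) Φ‖, sq_nonneg ‖fockPart (n + 1) Φ'‖, sq_nonneg ‖fockPart n Φ‖]
  refine sub_eq_zero.1 (eq_zero_of_tendsto_of_le (K := ‖v‖) hlim hsum fun M => ?_)
  rw [key h, ← inner_conj_symm Ψ', key h', inner_conj_symm]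
  exact norm_inner_fieldCut_sub_le M v Φ' Φ

/-- A linear map from `SV` to Fock space that intertwines `π(v)` and `π(g v)` for all `v`. -/
def Intertwines (g : SpGroup V) (U : SymAlgC V →ₗ[ℂ] Fock V) : Prop :=
  ∀ v φ, IsFieldValue ((g : V ≃ₗ[ℝ] V) v) (U φ) (U (field v φ))

theorem I_smul_add_aux {E : Type*} [AddCommGroup E] [Module ℂ E] (x y : E) :
    Complex.I • (Complex.I • x + -Complex.I • y) = y - x := by
  rw [smul_add, smul_smul, smul_smul, mul_neg, Complex.I_mul_I]
  module

/-- As c is complex-linear and a antilinear in v, the values π(v) and π(iv) determine both. -/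
theorem gen_mul_eq_field (v : V) (φ : SymAlgC V) : gen v * φ =
    ((Real.sqrt 2 : ℂ)⁻¹) • (field v φ - Complex.I • field (Complex.I • v) φ) := by
  have h : ((Real.sqrt 2 : ℂ)⁻¹) * ((Real.sqrt 2 : ℂ)⁻¹) = 2⁻¹ := by
    rw [← mul_inv, ← Complex.ofReal_mul, Real.mul_self_sqrt zero_le_two]; simp
  have hg : (gen (Complex.I • v) : SymAlgC V) = Complex.I • gen v := map_smul _ _ _
  rw [field_apply, field_apply, smul_comm Complex.I, ← smul_sub, smul_smul, h, annihilator_smul, hg,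
    LinearMap.smul_apply, Complex.conj_I, smul_mul_assoc, I_smul_add_aux]
  module

theorem annihilator_eq_field (v : V) (φ : SymAlgC V) : annihilator v φ =
    ((Real.sqrt 2 : ℂ)⁻¹) • (field v φ + Complex.I • field (Complex.I • v) φ) := by
  have h : ((Real.sqrt 2 : ℂ)⁻¹) * ((Real.sqrt 2 : ℂ)⁻¹) = 2⁻¹ := by
    rw [← mul_inv, ← Complex.ofReal_mul, Real.mul_self_sqrt zero_le_two]; simp
  have hg : (gen (Complex.I • v) : SymAlgC V) = Complex.I • gen v := map_smul _ _ _
  rw [field_apply, field_apply, smul_comm Complex.I, ← smul_add, smul_smul, h, annihilator_smul, hg,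
    LinearMap.smul_apply, Complex.conj_I, smul_mul_assoc, I_smul_add_aux]
  module

/-- The vectors `U φ` and `U ψ` lie in the natural domain of π(gw) for every w, where this operator
is symmetric. Hence c(v) and a(v) stay adjoint after transport by U. -/
theorem Intertwines.inner_gen_mul {g : SpGroup V} {U : SymAlgC V →ₗ[ℂ] Fock V}
    (hU : Intertwines g U) (v : V) (φ ψ : SymAlgC V) :
    ⟪U φ, U (gen v * ψ)⟫_ℂ = ⟪U (annihilator v φ), U ψ⟫_ℂ := by
  have h : ∀ w, ⟪U φ, U (field w ψ)⟫_ℂ = ⟪U (field w φ), U ψ⟫_ℂ :=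
    fun w => (hU w ψ).inner_symm (hU w φ)
  rw [gen_mul_eq_field, annihilator_eq_field]
  simp only [map_smul, map_sub, map_add, inner_smul_left, inner_smul_right, inner_sub_right,
    inner_add_left, h, map_inv₀, Complex.conj_ofReal, Complex.conj_I]
  ring

/-- Adjointness of c(v) and a(v) together with `a(v)1 = 0` determines a Hermitian form on SV up to
its value at (1, 1). -/
theorem Intertwines.inner_map_map {g : SpGroup V} {U : SymAlgC V →ₗ[ℂ] Fock V}
    (hU : Intertwines g U) (φ ψ : SymAlgC V) :
    ⟪U φ, U ψ⟫_ℂ = (‖U 1‖ ^ 2 : ℝ) * ⟪φ, ψ⟫_ℂ := by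
  induction ψ using sym_induction generalizing φ with
  | one =>
    induction φ using sym_induction with
    | one =>
      have h : ⟪(1 : SymAlgC V), 1⟫_ℂ = 1 := by rw [sym_inner_def, symToDual_one, vac_one]
      rw [inner_self_eq_norm_sq_to_K, h]
      push_cast
      rw [mul_one]
      rfl
    | gen_mul w φ _ =>
      rw [← inner_conj_symm, hU.inner_gen_mul, annihilator_one, inner_gen_mul_left, annihilator_one]
      simp
    | add θ η h h' => rw [map_add, inner_add_left, inner_add_left, h, h', mul_add]
    | smul r θ h => rw [map_smul, inner_smul_left, inner_smul_left, h]; ring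
  | gen_mul w ψ ih => rw [hU.inner_gen_mul, ih, inner_gen_mul_right]
  | add θ η h h' => rw [map_add, inner_add_right, inner_add_right, h, h', mul_add]
  | smul r θ h => rw [map_smul, inner_smul_right, inner_smul_right, h]; ring

theorem Intertwines.norm_map {g : SpGroup V} {U : SymAlgC V →ₗ[ℂ] Fock V}
    (hU : Intertwines g U) (φ : SymAlgC V) : ‖U φ‖ = ‖U 1‖ * ‖φ‖ := by
  have h := hU.inner_map_map φ φ
  simp only [inner_self_eq_norm_sq_to_K] at h
  have h' : ‖U φ‖ ^ 2 = (‖U 1‖ * ‖φ‖) ^ 2 := by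
    rw [mul_pow]
    exact Complex.ofReal_injective (by push_cast at h ⊢; exact h)
  exact (sq_eq_sq₀ (norm_nonneg _) (by positivity)).1 h'

/-- The restriction to `SV` of a bounded operator on Fock space. -/
def restr (T : Fock V →L[ℂ] Fock V) : SymAlgC V →ₗ[ℂ] Fock V := T.toLinearMap ∘ₗ toFock.toLinearMap

theorem restr_apply (T : Fock V →L[ℂ] Fock V) (φ : SymAlgC V) : restr T φ = T (toFock φ) := rfl

/-- The intertwining condition is an identity between matrix elements of T at vectors of SV;
conjugating it exchanges the roles of g and g⁻¹. -/
theorem Intertwines.adjoint {g : SpGroup V} {T : Fock V →L[ℂ] Fock V}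
    (hT : Intertwines g (restr T)) : Intertwines g⁻¹ (restr (ContinuousLinearMap.adjoint T)) := by
  intro w φ
  rw [isFieldValue_iff]
  intro θ
  have h2 : (g : V ≃ₗ[ℝ] V) ((g⁻¹ : SpGroup V).1 w) = w := g.1.apply_symm_apply w
  have h := (isFieldValue_iff _ _ _).1 (hT ((g⁻¹ : SpGroup V).1 w) θ) φ
  rw [h2] at h
  rw [restr_apply, restr_apply, ContinuousLinearMap.adjoint_inner_right,
    ContinuousLinearMap.adjoint_inner_right, ← inner_conj_symm, ← inner_conj_symm (T _) (toFock φ)]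
  exact congrArg conj h.symm

/-- For θ in SV the vector `T* θ` lies in the natural domain of π(v), because `T*` intertwines for
g⁻¹. Symmetry of π(v) there transfers the relation from Φ to `T Φ`. -/
theorem Intertwines.map_isFieldValue {g : SpGroup V} {T : Fock V →L[ℂ] Fock V}
    (hT : Intertwines g (restr T)) {v : V} {Φ Ψ : Fock V} (h : IsFieldValue v Φ Ψ) :
    IsFieldValue ((g : V ≃ₗ[ℝ] V) v) (T Φ) (T Ψ) := by
  rw [isFieldValue_iff]
  intro θ
  have h2 : (g⁻¹ : SpGroup V).1 ((g : V ≃ₗ[ℝ] V) v) = v := g.1.symm_apply_apply v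
  have h' := hT.adjoint ((g : V ≃ₗ[ℝ] V) v) θ
  rw [h2] at h'
  have h3 := h.inner_symm h'
  rwa [restr_apply, restr_apply, ContinuousLinearMap.adjoint_inner_left,
    ContinuousLinearMap.adjoint_inner_left] at h3

/-- A unitary operator cannot kill the vacuum, so the requirement of being nonzero is automatic. -/
theorem isUnitaryMetaplectic_iff (g : SpGroup V) (T : Fock V →L[ℂ] Fock V) :
    IsUnitaryMetaplectic g T ↔ T ∈ unitary (Fock V →L[ℂ] Fock V) ∧ Intertwines g (restr T) := by
  refine and_congr_right fun hT => ⟨fun h => h.2, fun h => ⟨fun h0 => ?_, h⟩⟩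
  have h1 : fockToDual (T (toFock 1)) = (0 : AntiDual V) := congrArg (fun f => f 1) h0
  have h2 : T (toFock 1) = 0 := by
    have h3 : ∀ θ, ⟪toFock θ, T (toFock 1)⟫_ℂ = 0 := fun θ => congrArg (fun Φ : AntiDual V => Φ θ) h1
    rw [← inner_self_eq_zero (𝕜 := ℂ)]
    exact fock_induction (P := fun Ξ => ⟪Ξ, T (toFock 1)⟫_ℂ = 0)
      (isClosed_eq (by fun_prop) (by fun_prop)) h3 _
  have h4 : toFock (1 : SymAlgC V) = 0 := by
    have : (star T * T) (toFock 1) = 0 := by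
      rw [mul_apply_eq_comp, h2, map_zero]
    rwa [Unitary.star_mul_self_of_mem hT] at this
  have h5 : (1 : SymAlgC V) = 0 := toFock.injective (by rw [h4, map_zero])
  have h6 : symToDual (1 : SymAlgC V) 1 = 1 := by rw [symToDual_one, vac_one]
  rw [h5] at h6
  simp at h6

/-- From SV to the natural domains: T maps graphs into graphs, and so does its inverse `T*`. -/
theorem isUnitaryImplementer_iff (g : SpGroup V) (T : Fock V →L[ℂ] Fock V) :
    IsUnitaryImplementer g T ↔ IsUnitaryMetaplectic g T := by
  rw [isUnitaryMetaplectic_iff]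
  refine and_congr_right fun hT => ⟨fun h v φ => (h v _ _).1 (isFieldValue_toFock v φ), fun h v Φ Ψ =>
    ⟨fun hΦ => h.map_isFieldValue hΦ, fun hΦ => ?_⟩⟩
  have h1 := h.adjoint.map_isFieldValue hΦ
  have h2 : (g⁻¹ : SpGroup V).1 ((g : V ≃ₗ[ℝ] V) v) = v := g.1.symm_apply_apply v
  have h3 : ∀ Ξ, ContinuousLinearMap.adjoint T (T Ξ) = Ξ := fun Ξ =>
    congrArg (fun S : Fock V →L[ℂ] Fock V => S Ξ) (Unitary.star_mul_self_of_mem hT)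
  rwa [h2, h3, h3] at h1

end FieldSymm

/-! ### Intertwiners force the Hilbert-Schmidt condition -/

section Necessity

variable {V : Type*} [NormedAddCommGroup V] [InnerProductSpace ℂ V]

theorem field_add (v w : V) (θ : SymAlgC V) : field (v + w) θ = field v θ + field w θ := by
  rw [field_apply, field_apply, field_apply, gen_add, annihilator_add, LinearMap.add_apply, add_mul]
  module

theorem field_neg (v : V) (θ : SymAlgC V) : field (-v) θ = -field v θ := by
  rw [field_apply, field_apply, annihilator_neg, LinearMap.neg_apply,
    show (gen (-v) : SymAlgC V) = -gen v from map_neg _ _, neg_mul]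
  module

theorem Cg_sub_Ag (g : SpGroup V) (v : V) :
    (g : V ≃ₗ[ℝ] V) (Complex.I • v) = Complex.I • Cg g v + -(Complex.I • Ag g v) := by
  rw [← Cg_add_Ag, map_smul, map_smulₛₗ, Complex.conj_I, neg_smul]

/-- The functional `T 1` for an intertwiner `T` is annihilated by `a(C v) + c(A v)`. -/
theorem Intertwines.inner_gen_mul_one {g : SpGroup V} {U : SymAlgC V →ₗ[ℂ] Fock V}
    (hU : Intertwines g U) (v : V) (θ : SymAlgC V) :
    ⟪toFock (gen (Cg g v) * θ + annihilator (Ag g v) θ), U 1⟫_ℂ = 0 := by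
  have h1 := (isFieldValue_iff _ _ _).1 (hU v 1) θ
  have h2 := (isFieldValue_iff _ _ _).1 (hU (Complex.I • v) 1) θ
  have h3 : U (field v 1) = -(Complex.I • U (field (Complex.I • v) 1)) := by
    have h := annihilator_eq_field v (1 : SymAlgC V)
    rw [annihilator_one] at h
    have h' := congrArg U ((smul_eq_zero.1 h.symm).resolve_left (by simp))
    rw [map_add, map_zero, map_smul] at h'
    exact eq_neg_of_add_eq_zero_left h'
  have h4 : gen (Cg g v) * θ + annihilator (Ag g v) θ = ((Real.sqrt 2 : ℂ)⁻¹) •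
      (field ((g : V ≃ₗ[ℝ] V) v) θ - Complex.I • field ((g : V ≃ₗ[ℝ] V) (Complex.I • v)) θ) := by
    rw [gen_mul_eq_field, annihilator_eq_field, Cg_sub_Ag, ← Cg_add_Ag, field_add, field_add,
      field_neg]
    module
  rw [h4, map_smul, inner_smul_left, map_sub, map_smul, inner_sub_left, inner_smul_left, ← h1, ← h2,
    h3, inner_neg_right, inner_smul_right, Complex.conj_I]
  ring

variable [CompleteSpace V]

/-- Writing x as `C_{g⁻¹} v` gives `Z_g x = -A_{g⁻¹} v`, and `‖Cv‖² = ‖v‖² + ‖Av‖²` leaves a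
positive gap. -/
theorem norm_Zg_lt (g : SpGroup V) {x : V} (hx : x ≠ 0) : ‖Zg g x‖ < ‖x‖ := by
  obtain ⟨v, rfl⟩ := (bijective_Cg g⁻¹).2 x
  have h := Zg_inv_Cg g⁻¹ v
  rw [inv_inv] at h
  have hv : 0 < ‖v‖ := norm_pos_iff.2 fun h0 => hx (by rw [h0, map_zero])
  have h2 := norm_sq_Cg g⁻¹ v
  rw [h, norm_neg]
  refine lt_of_pow_lt_pow_left₀ 2 (norm_nonneg _) ?_
  rw [h2]
  have := pow_pos hv 2
  linarith

theorem norm_Zg_le (g : SpGroup V) (x : V) : ‖Zg g x‖ ≤ ‖x‖ := by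
  rcases eq_or_ne x 0 with rfl | hx
  · simp
  · exact (norm_Zg_lt g hx).le

theorem continuous_Zg (g : SpGroup V) : Continuous (Zg g) :=
  AddMonoidHomClass.continuous_of_bound (Zg g) 1 fun x => by
    rw [one_mul]; exact norm_Zg_le g x

theorem inner_gen_gen {V : Type*} [NormedAddCommGroup V] [InnerProductSpace ℂ V] (x y : V) :
    ⟪(gen x : SymAlgC V), gen y⟫_ℂ = ⟪x, y⟫_ℂ := by
  have h1 := inner_gen_mul_left x (1 : SymAlgC V) (gen y)
  have h2 := annihilator_gen_mul x y (1 : SymAlgC V)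
  have h3 : ⟪(1 : SymAlgC V), 1⟫_ℂ = 1 := by rw [sym_inner_def, symToDual_one, vac_one]
  rw [mul_one] at h1 h2
  rw [h1, h2, annihilator_one, mul_zero, add_zero, inner_smul_right, h3, mul_one]

/-- A bounded solution of the Gaussian differential equation forces `Z` to be Hilbert-Schmidt. -/
theorem sum_norm_sq_le_of_gaussian {V : Type*} [NormedAddCommGroup V] [InnerProductSpace ℂ V]
    {Z : V →ₗ⋆[ℂ] V} (hZ : ∀ x y, ⟪y, Z x⟫_ℂ = ⟪x, Z y⟫_ℂ) {Φ : Fock V}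
    (hΦ : ∀ v θ, ⟪toFock (gen v * θ), Φ⟫_ℂ = ⟪toFock (annihilator (Z v) θ), Φ⟫_ℂ)
    {ι : Type*} {e : ι → V} (he : Orthonormal ℂ e) (s : Finset ι) :
    ‖⟪toFock 1, Φ⟫_ℂ‖ ^ 2 * ∑ i ∈ s, ‖Z (e i)‖ ^ 2 ≤ 2 * ‖Φ‖ ^ 2 := by
  classical
  obtain ⟨S, hS⟩ : ∃ S, S = ∑ i ∈ s, ‖Z (e i)‖ ^ 2 := ⟨_, rfl⟩
  have hS0 : 0 ≤ S := hS ▸ Finset.sum_nonneg fun _ _ => sq_nonneg _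
  -- The test vector: Φ pairs with it to S times the vacuum component of Φ, while its squared norm
  -- is at most 2S, one S from the diagonal terms and one from Bessel's inequality. Cauchy-Schwarz
  -- then bounds S.
  obtain ⟨ψ, hψ⟩ : ∃ ψ : SymAlgC V, ψ = ∑ i ∈ s, gen (e i) * gen (Z (e i)) := ⟨_, rfl⟩
  have h1 : ⟪toFock ψ, Φ⟫_ℂ = S * ⟪toFock 1, Φ⟫_ℂ := by
    rw [hψ, map_sum, sum_inner, hS]
    push_cast
    rw [Finset.sum_mul]
    refine Finset.sum_congr rfl fun i _ => ?_
    have h := annihilator_gen_mul (Z (e i)) (Z (e i)) (1 : SymAlgC V)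
    rw [mul_one, annihilator_one, mul_zero, add_zero] at h
    rw [hΦ, h, map_smul, inner_smul_left, inner_conj_symm, inner_self_eq_norm_sq_to_K]
    rfl
  have hin : ∀ i j, ⟪(gen (e i) * gen (Z (e i)) : SymAlgC V), gen (e j) * gen (Z (e j))⟫_ℂ =
      (((if i = j then ‖Z (e i)‖ ^ 2 else 0) + ‖⟪e i, Z (e j)⟫_ℂ‖ ^ 2 : ℝ) : ℂ) := fun i j => by
    have h := annihilator_gen_mul (e i) (Z (e j)) (1 : SymAlgC V)
    rw [mul_one, annihilator_one, mul_zero, add_zero] at h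
    rw [inner_gen_mul_left, annihilator_gen_mul, h, mul_smul_comm, mul_one, inner_add_right,
      inner_smul_right, inner_smul_right, inner_gen_gen, inner_gen_gen, orthonormal_iff_ite.1 he i j,
      ← inner_conj_symm (Z (e i)) (e j), hZ (e i) (e j), Complex.mul_conj']
    split_ifs with hij
    · rw [← hij, inner_self_eq_norm_sq_to_K]; push_cast; simp
    · push_cast; simp
  have h2 : ‖ψ‖ ^ 2 ≤ 2 * S := by
    have h3 : ⟪ψ, ψ⟫_ℂ = ((∑ i ∈ s, ∑ j ∈ s,
        ((if i = j then ‖Z (e i)‖ ^ 2 else 0) + ‖⟪e i, Z (e j)⟫_ℂ‖ ^ 2) : ℝ) : ℂ) := by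
      rw [hψ, sum_inner]
      simp only [inner_sum, hin]
      push_cast
      rfl
    have h4 : ‖ψ‖ ^ 2 = ∑ i ∈ s, ∑ j ∈ s,
        ((if i = j then ‖Z (e i)‖ ^ 2 else 0) + ‖⟪e i, Z (e j)⟫_ℂ‖ ^ 2) :=
      Complex.ofReal_injective (by rw [← h3, inner_self_eq_norm_sq_to_K]; push_cast; rfl)
    rw [h4]
    simp only [Finset.sum_add_distrib]
    have h5 : ∑ i ∈ s, ∑ j ∈ s, (if i = j then ‖Z (e i)‖ ^ 2 else 0) = S := by
      rw [hS]
      exact Finset.sum_congr rfl fun i hi => by rw [Finset.sum_ite_eq, if_pos hi]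
    have h6 : ∑ i ∈ s, ∑ j ∈ s, ‖⟪e i, Z (e j)⟫_ℂ‖ ^ 2 ≤ S := by
      rw [Finset.sum_comm, hS]
      exact Finset.sum_le_sum fun j _ => he.sum_inner_products_le _
    linarith
  rw [← hS]
  have h7 := norm_inner_le_norm (𝕜 := ℂ) (toFock ψ) Φ
  rw [h1, norm_mul, Complex.norm_real, Real.norm_of_nonneg hS0, LinearIsometry.norm_map] at h7
  rcases hS0.eq_or_lt with h0 | h0
  · rw [← h0, mul_zero]; positivity
  · refine le_of_mul_le_mul_left ?_ h0
    calc S * (‖⟪toFock 1, Φ⟫_ℂ‖ ^ 2 * S) = (S * ‖⟪toFock 1, Φ⟫_ℂ‖) ^ 2 := by ring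
      _ ≤ (‖ψ‖ * ‖Φ‖) ^ 2 := by gcongr
      _ = ‖ψ‖ ^ 2 * ‖Φ‖ ^ 2 := by ring
      _ ≤ 2 * S * ‖Φ‖ ^ 2 := by gcongr
      _ = _ := by ring

theorem fockToDual_injective {V : Type*} [NormedAddCommGroup V] [InnerProductSpace ℂ V] {Φ : Fock V}
    (h : ∀ θ, ⟪toFock θ, Φ⟫_ℂ = 0) : Φ = 0 := by
  rw [← inner_self_eq_zero (𝕜 := ℂ)]
  exact fock_induction (P := fun Ξ => ⟪Ξ, Φ⟫_ℂ = 0) (isClosed_eq (by fun_prop) (by fun_prop)) h _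

/-- Since `a(v)1 = 0`, the vector `U 1` is killed by `a(Cv) + c(Av)`. As `C_g` is onto, this is the
Gaussian equation for `Z_{g⁻¹}`, and by uniqueness a nonzero solution has a nonzero vacuum
component. -/
theorem Intertwines.isHilbertSchmidt {g : SpGroup V} {U : SymAlgC V →ₗ[ℂ] Fock V}
    (hU : Intertwines g U) (h1 : U 1 ≠ 0) : IsHilbertSchmidt (Zg g⁻¹) := by
  have hΦ : ∀ v θ, ⟪toFock (gen v * θ), U 1⟫_ℂ = ⟪toFock (annihilator (Zg g⁻¹ v) θ), U 1⟫_ℂ := by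
    intro w θ
    obtain ⟨v, rfl⟩ := (bijective_Cg g).2 w
    have h := hU.inner_gen_mul_one v θ
    rw [map_add, inner_add_left] at h
    rw [Zg_inv_Cg, annihilator_neg, LinearMap.neg_apply, map_neg, inner_neg_left]
    exact eq_neg_of_add_eq_zero_left h
  have h0 : ⟪toFock 1, U 1⟫_ℂ ≠ 0 := fun h0 => by
    have h2 : fockToDual (U 1) = 0 :=
      antiDual_eq_zero (f := fun v => (innerSL ℂ (Zg g⁻¹ v)).toLinearMap) (fun v θ => hΦ v θ) h0
    exact h1 (fockToDual_injective fun θ => congrArg (fun Φ : AntiDual V => Φ θ) h2)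
  refine ⟨continuous_Zg g⁻¹, ?_⟩
  obtain ⟨w, b, hb⟩ := exists_hilbertBasis ℂ V
  refine ⟨w, b, summable_of_sum_le (c := 2 * ‖U 1‖ ^ 2 / ‖⟪toFock 1, U 1⟫_ℂ‖ ^ 2)
    (fun _ => sq_nonneg _) fun s => ?_⟩
  rw [le_div_iff₀ (by positivity), mul_comm]
  exact sum_norm_sq_le_of_gaussian (inner_Zg g⁻¹) hΦ b.orthonormal s

theorem IsUnitaryMetaplectic.isHilbertSchmidt {g : SpGroup V} {T : Fock V →L[ℂ] Fock V}
    (hT : IsUnitaryMetaplectic g T) : IsHilbertSchmidt (Zg g) := by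
  obtain ⟨hu, hI⟩ := (isUnitaryMetaplectic_iff g T).1 hT
  -- An intertwiner for g controls `Z_{g⁻¹}`; the adjoint, which intertwines for g⁻¹, controls
  -- `Z_g`.
  have h := hI.adjoint.isHilbertSchmidt (fun h0 => ?_)
  · rwa [inv_inv] at h
  · have h1 : T (ContinuousLinearMap.adjoint T (toFock 1)) = toFock 1 :=
      congrArg (fun S : Fock V →L[ℂ] Fock V => S (toFock 1)) (Unitary.mul_star_self_of_mem hu)
    rw [restr_apply] at h0
    rw [h0, map_zero] at h1
    have h5 : (1 : SymAlgC V) = 0 := toFock.injective (by rw [← h1, map_zero])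
    have h6 : symToDual (1 : SymAlgC V) 1 = 1 := by rw [symToDual_one, vac_one]
    rw [h5] at h6
    simp at h6

end Necessity

/-! ### Functionals of geometric decay -/

section Decay

variable {V : Type*} [NormedAddCommGroup V] [InnerProductSpace ℂ V]

/-- Functionals on `SV` whose homogeneous parts decay geometrically. -/
def GeomDecay (Φ : AntiDual V) : Prop :=
  ∃ M r : ℝ, 0 ≤ M ∧ 0 < r ∧ r < 1 ∧ ∀ n θ, ‖Φ (degPart n θ)‖ ≤ M * r ^ n * ‖θ‖

theorem GeomDecay.add {Φ Ψ : AntiDual V} (h : GeomDecay Φ) (h' : GeomDecay Ψ) :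
    GeomDecay (Φ + Ψ) := by
  obtain ⟨M, r, hM, hr, hr1, h⟩ := h
  obtain ⟨M', r', hM', hr', hr1', h'⟩ := h'
  refine ⟨M + M', max r r', by positivity, lt_max_of_lt_left hr, max_lt hr1 hr1', fun n θ => ?_⟩
  rw [LinearMap.add_apply, add_mul, add_mul]
  refine (norm_add_le _ _).trans (add_le_add ((h n θ).trans ?_) ((h' n θ).trans ?_))
  · gcongr; exact le_max_left _ _
  · gcongr; exact le_max_right _ _

theorem GeomDecay.smul {Φ : AntiDual V} (c : ℂ) (h : GeomDecay Φ) : GeomDecay (c • Φ) := by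
  obtain ⟨M, r, hM, hr, hr1, h⟩ := h
  refine ⟨‖c‖ * M, r, by positivity, hr, hr1, fun n θ => ?_⟩
  rw [LinearMap.smul_apply, norm_smul, mul_assoc, mul_assoc, ← mul_assoc M]
  gcongr
  exact h n θ

/-- A slightly larger ratio absorbs the factor `√(n+1)` by which creators and annihilators grow.
Thus geometric decay survives these operators, whereas mere boundedness need not. -/
theorem exists_succ_mul_pow_le {r : ℝ} (hr : 0 < r) (hr1 : r < 1) :
    ∃ K r' : ℝ, 0 ≤ K ∧ 0 < r' ∧ r' < 1 ∧ ∀ n : ℕ, Real.sqrt (n + 1) * r ^ n ≤ K * r' ^ (n + 1) := by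
  obtain ⟨r', h1, h2⟩ := exists_between hr1
  have hr' : 0 < r' := hr.trans h1
  have hq : |r / r'| < 1 := by
    rw [abs_of_pos (by positivity), div_lt_one hr']
    exact h1
  -- The constant K bounds the sequence `(n + 1)(r/r')ⁿ`, which tends to zero.
  have ht := (tendsto_self_mul_const_pow_of_abs_lt_one hq).add
    (tendsto_pow_atTop_nhds_zero_of_abs_lt_one hq)
  obtain ⟨K, hK⟩ := ht.bddAbove_range
  have hK' : ∀ n : ℕ, (n + 1) * (r / r') ^ n ≤ K := fun n => by
    have := hK ⟨n, rfl⟩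
    simp only at this
    linarith
  have hK0 : 0 ≤ K := le_trans (by positivity) (hK' 0)
  refine ⟨K / r', r', by positivity, hr', h2, fun n => ?_⟩
  have e1 : K / r' * r' ^ (n + 1) = K * r' ^ n := by field_simp; ring
  have e2 : r ^ n = (r / r') ^ n * r' ^ n := by rw [← mul_pow, div_mul_cancel₀ _ hr'.ne']
  rw [e1, e2, ← mul_assoc]
  gcongr
  refine le_trans ?_ (hK' n)
  gcongr
  have h0 : (1 : ℝ) ≤ n + 1 := by linarith [n.cast_nonneg (α := ℝ)]
  exact Real.sqrt_le_iff.2 ⟨by linarith, by nlinarith⟩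

theorem GeomDecay.comp_annihilator {Φ : AntiDual V} (h : GeomDecay Φ) (v : V) :
    GeomDecay (Φ.comp (annihilator v)) := by
  obtain ⟨M, r, hM, hr, hr1, h⟩ := h
  obtain ⟨K, r', hK, hr', hr1', hb⟩ := exists_succ_mul_pow_le hr hr1
  refine ⟨M * K * ‖v‖, r', by positivity, hr', hr1', fun n θ => ?_⟩
  rw [LinearMap.comp_apply]
  rcases n with _ | n
  · rw [annihilator_degPart_zero, map_zero, norm_zero]; positivity
  · have h1 : annihilator v (degPart (n + 1) θ) =
        degPart n (annihilator v (degPart (n + 1) θ)) := by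
      rw [annihilator_degPart_succ, degPart_degPart, if_pos rfl]
    rw [h1]
    refine (h n _).trans ?_
    have h2 : ‖annihilator v (degPart (n + 1) θ)‖ ≤ Real.sqrt (n + 1) * ‖v‖ * ‖θ‖ := by
      have := norm_annihilator_degPart_le (n + 1) v θ
      push_cast at this
      exact this.trans (by gcongr; exact norm_degPart_le _ _)
    calc M * r ^ n * ‖annihilator v (degPart (n + 1) θ)‖
        ≤ M * r ^ n * (Real.sqrt (n + 1) * ‖v‖ * ‖θ‖) := by gcongr
      _ = M * (Real.sqrt (n + 1) * r ^ n) * ‖v‖ * ‖θ‖ := by ring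
      _ ≤ M * (K * r' ^ (n + 1)) * ‖v‖ * ‖θ‖ := by gcongr ?_ * ‖v‖ * ‖θ‖; exact mul_le_mul_of_nonneg_left (hb n) hM
      _ = _ := by ring

theorem GeomDecay.comp_gen_mul {Φ : AntiDual V} (h : GeomDecay Φ) (v : V) :
    GeomDecay (antiShift (gen v) Φ) := by
  obtain ⟨M, r, hM, hr, hr1, h⟩ := h
  obtain ⟨K, r', hK, hr', hr1', hb⟩ := exists_succ_mul_pow_le hr hr1
  refine ⟨M * K * ‖v‖, r', by positivity, hr', hr1', fun n θ => ?_⟩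
  rw [antiShift_apply]
  have h1 : gen v * degPart n θ = degPart (n + 1) (gen v * degPart n θ) := by
    rw [degPart_succ_gen_mul, degPart_degPart, if_pos rfl]
  rw [h1]
  refine (h (n + 1) _).trans ?_
  have h2 : ‖gen v * degPart n θ‖ ≤ Real.sqrt (n + 1) * ‖v‖ * ‖θ‖ :=
    (norm_gen_mul_degPart_le n v θ).trans (by gcongr; exact norm_degPart_le _ _)
  calc M * r ^ (n + 1) * ‖gen v * degPart n θ‖
      ≤ M * r ^ (n + 1) * (Real.sqrt (n + 1) * ‖v‖ * ‖θ‖) := by gcongr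
    _ = r * (M * (Real.sqrt (n + 1) * r ^ n) * ‖v‖ * ‖θ‖) := by ring
    _ ≤ 1 * (M * (K * r' ^ (n + 1)) * ‖v‖ * ‖θ‖) := by
      gcongr ?_ * (?_ * ‖v‖ * ‖θ‖)
      exact mul_le_mul_of_nonneg_left (hb n) hM
    _ = r' * (M * K * ‖v‖ * r' ^ n * ‖θ‖) := by ring
    _ ≤ 1 * (M * K * ‖v‖ * r' ^ n * ‖θ‖) := by gcongr
    _ = _ := by ring

/-- A bounded functional on `SV` is given by a vector in Fock space. -/
theorem exists_fock_of_bound {Φ : AntiDual V} {C : ℝ} (h : ∀ θ, ‖Φ θ‖ ≤ C * ‖θ‖) :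
    ∃ Ξ : Fock V, fockToDual Ξ = Φ := by
  let f : SymAlgC V →L[ℂ] ℂ := LinearMap.mkContinuous
    ((starLinearEquiv ℂ (A := ℂ)).toLinearMap.comp Φ) C fun θ => by
      simpa using h θ
  refine ⟨(InnerProductSpace.toDual ℂ (Fock V)).symm (f.extend toFock.toContinuousLinearMap), ?_⟩
  ext θ
  have h1 : DenseRange (toFock.toContinuousLinearMap : SymAlgC V →L[ℂ] Fock V) := denseRange_toFock
  have h2 : IsUniformInducing (toFock.toContinuousLinearMap : SymAlgC V →L[ℂ] Fock V) :=
    toFock.isometry.isUniformInducing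
  have h3 : f.extend toFock.toContinuousLinearMap (toFock θ) = f θ :=
    ContinuousLinearMap.extend_eq f h1 h2 θ
  change ⟪toFock θ, _⟫_ℂ = _
  rw [← inner_conj_symm, InnerProductSpace.toDual_symm_apply, h3]
  change conj (conj (Φ θ)) = Φ θ
  rw [Complex.conj_conj]

theorem GeomDecay.exists_fock {Φ : AntiDual V} (h : GeomDecay Φ) :
    ∃ Ξ : Fock V, fockToDual Ξ = Φ := by
  obtain ⟨M, r, hM, hr, hr1, h⟩ := h
  refine exists_fock_of_bound (C := M * (1 - r)⁻¹) fun θ => ?_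
  obtain ⟨N, hN⟩ := exists_sum_degPart θ
  have h1 : ‖Φ θ‖ ≤ ∑ n ∈ Finset.range N, M * r ^ n * ‖θ‖ := by
    conv_lhs => rw [← hN N le_rfl, map_sum]
    exact norm_sum_le_of_le _ fun n _ => h n θ
  refine h1.trans ?_
  rw [← Finset.sum_mul, ← Finset.mul_sum]
  gcongr
  rw [← tsum_geometric_of_lt_one hr.le hr1]
  exact (summable_geometric_of_lt_one hr.le hr1).sum_le_tsum _ fun _ _ => by positivity

end Decay

/-! ### Takagi factorization of symmetric antilinear Hilbert-Schmidt operators -/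

section Takagi

variable {V : Type*} [NormedAddCommGroup V] [InnerProductSpace ℂ V]

theorem hasSum_norm_inner_sq {ι : Type*} (b : HilbertBasis ι ℂ V) (x : V) :
    HasSum (fun i => ‖⟪b i, x⟫_ℂ‖ ^ 2) (‖x‖ ^ 2) := by
  have h := b.hasSum_inner_mul_inner x x
  rw [inner_self_eq_norm_sq_to_K] at h
  have h' : HasSum (fun i => ((‖⟪b i, x⟫_ℂ‖ ^ 2 : ℝ) : ℂ)) ((‖x‖ ^ 2 : ℝ) : ℂ) := by
    have e : (fun i => ((‖⟪b i, x⟫_ℂ‖ ^ 2 : ℝ) : ℂ)) = fun i => ⟪x, b i⟫_ℂ * ⟪b i, x⟫_ℂ :=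
      funext fun i => by
        rw [← inner_conj_symm x (b i), Complex.conj_mul']
        push_cast
        rfl
    rw [e]
    push_cast
    exact h
  exact_mod_cast h'

/-- The Hilbert-Schmidt norm of a symmetric antilinear map does not depend on the basis. -/
theorem summable_norm_sq_of_basis {Z : V →ₗ⋆[ℂ] V} (hZ : ∀ x y, ⟪y, Z x⟫_ℂ = ⟪x, Z y⟫_ℂ)
    {ι κ : Type*} (b : HilbertBasis ι ℂ V) (e : HilbertBasis κ ℂ V)
    (hb : Summable fun i => ‖Z (b i)‖ ^ 2) : Summable fun k => ‖Z (e k)‖ ^ 2 := by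
  have h1 : Summable fun p : ι × κ => ‖⟪e p.2, Z (b p.1)⟫_ℂ‖ ^ 2 := by
    rw [summable_prod_of_nonneg fun _ => sq_nonneg _]
    refine ⟨fun i => (hasSum_norm_inner_sq e (Z (b i))).summable, ?_⟩
    simpa only [(hasSum_norm_inner_sq e (Z (b _))).tsum_eq] using hb
  have h2 := (summable_prod_of_nonneg fun _ => sq_nonneg _).1 h1.prod_symm
  refine h2.2.congr fun k => ?_
  simp only [Prod.fst_swap, Prod.snd_swap, hZ _ (e k)]
  exact (hasSum_norm_inner_sq b (Z (e k))).tsum_eq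

/-- A vector on which a symmetric antilinear map acts by a nonnegative real number. -/
def IsTakagi (Z : V →ₗ⋆[ℂ] V) (x : V) : Prop := ∃ l : ℝ, 0 ≤ l ∧ Z x = (l : ℂ) • x

/-- For real l, `Z² - l² = (Z - l)(Z + l)`, so `Zx + lx` is a solution unless it vanishes. In that
case `Zx = -lx`, and antilinearity makes `ix` a solution. -/
theorem exists_isTakagi_of_sq {Z : V →ₗ⋆[ℂ] V} {K : Submodule ℂ V} (hK : ∀ x ∈ K, Z x ∈ K)
    {x : V} (hx : x ∈ K) (hx0 : x ≠ 0) {l : ℝ} (hl : 0 ≤ l) (h : Z (Z x) = (l : ℂ) • (l : ℂ) • x) :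
    ∃ y ∈ K, y ≠ 0 ∧ IsTakagi Z y := by
  by_cases h0 : Z x + (l : ℂ) • x = 0
  · refine ⟨Complex.I • x, K.smul_mem _ hx, smul_ne_zero Complex.I_ne_zero hx0, l, hl, ?_⟩
    rw [map_smulₛₗ, eq_neg_of_add_eq_zero_left h0, Complex.conj_I, neg_smul_neg, smul_comm]
  · refine ⟨_, K.add_mem (hK x hx) (K.smul_mem _ hx), h0, l, hl, ?_⟩
    rw [map_add, map_smulₛₗ, Complex.conj_ofReal, h, smul_add, add_comm]

variable [CompleteSpace V]

/-- Cutting off the coordinates of Zx gives finite-rank operators. By symmetry the missing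
coordinates are `⟪x, Z (b i)⟫`, so the error is at most the tail of the Hilbert-Schmidt sum, and Z
is a norm limit. -/
theorem isCompactOperator_of_hilbertSchmidt {Z : V →ₗ⋆[ℂ] V}
    (hZ : ∀ x y, ⟪y, Z x⟫_ℂ = ⟪x, Z y⟫_ℂ) (hHS : IsHilbertSchmidt Z) : IsCompactOperator Z := by
  classical
  obtain ⟨hcont, s, b, hb⟩ := hHS
  let Zc : V →L⋆[ℂ] V := ⟨Z, hcont⟩
  let R : s → V →L⋆[ℂ] V := fun i =>
    (ContinuousLinearMap.toSpanSingleton ℂ (b i)).comp ((innerSL ℂ (b i)).comp Zc)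
  have hR : ∀ i, R i ∈ compactOperator (starRingEnd ℂ) V V := fun i =>
    (isCompactOperator_of_locallyCompactSpace_rng
      (ContinuousLinearMap.toSpanSingleton ℂ (b i))).comp_clm ((innerSL ℂ (b i)).comp Zc)
  have hF : ∀ t : Finset s, IsCompactOperator (∑ i ∈ t, R i : V →L⋆[ℂ] V) := fun t =>
    (sum_mem fun i _ => hR i : ∑ i ∈ t, R i ∈ compactOperator (starRingEnd ℂ) V V)
  obtain ⟨S, hS⟩ := hb
  have hbound : ∀ t : Finset s, ‖(∑ i ∈ t, R i) - Zc‖ ≤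
      Real.sqrt (S - ∑ i ∈ t, ‖Z (b i)‖ ^ 2) := fun t => by
    refine ContinuousLinearMap.opNorm_le_bound _ (Real.sqrt_nonneg _) fun x => ?_
    have htail : 0 ≤ S - ∑ i ∈ t, ‖Z (b i)‖ ^ 2 :=
      sub_nonneg.2 (sum_le_hasSum t (fun _ _ => sq_nonneg _) hS)
    refine le_of_sq_le_sq ?_ (by positivity)
    rw [mul_pow, Real.sq_sqrt htail]
    have h1 : ∀ i, ⟪b i, ((∑ i ∈ t, R i) - Zc) x⟫_ℂ =
        if i ∈ t then 0 else -⟪b i, Z x⟫_ℂ := fun i => by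
      have h2 : ((∑ i ∈ t, R i) - Zc) x = (∑ j ∈ t, ⟪b j, Z x⟫_ℂ • b j) - Z x := by
        rw [sub_apply, sum_apply]
        rfl
      rw [h2, inner_sub_right]
      split_ifs with hi
      · rw [b.orthonormal.inner_right_sum _ hi, sub_self]
      · rw [inner_sum, Finset.sum_eq_zero, zero_sub]
        intro j hj
        rw [inner_smul_right, b.orthonormal.2 (fun h : i = j => hi (by rwa [h])), mul_zero]
    have h3 := hasSum_norm_inner_sq b (((∑ i ∈ t, R i) - Zc) x)
    have h4 : HasSum (fun i => (‖Z (b i)‖ ^ 2 - if i ∈ t then ‖Z (b i)‖ ^ 2 else 0) * ‖x‖ ^ 2)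
        ((S - ∑ i ∈ t, ‖Z (b i)‖ ^ 2) * ‖x‖ ^ 2) := by
      refine (hS.sub ?_).mul_right _
      have h5 : HasSum (fun i => if i ∈ t then ‖Z (b i)‖ ^ 2 else 0)
          (∑ i ∈ t, if i ∈ t then ‖Z (b i)‖ ^ 2 else 0) :=
        hasSum_sum_of_ne_finset_zero fun i hi => if_neg hi
      rwa [Finset.sum_congr rfl fun i hi => if_pos hi] at h5
    refine hasSum_le (fun i => ?_) h3 h4
    rw [h1]
    split_ifs with hi
    · simp
    · rw [norm_neg, hZ, sub_zero, ← mul_pow]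
      have := norm_inner_le_norm (𝕜 := ℂ) x (Z (b i))
      gcongr
      linarith
  have hlim : Filter.Tendsto (fun t => ∑ i ∈ t, R i) Filter.atTop (nhds Zc) := by
    rw [tendsto_iff_norm_sub_tendsto_zero]
    refine squeeze_zero (fun _ => norm_nonneg _) hbound ?_
    have h1 : Filter.Tendsto (fun t => S - ∑ i ∈ t, ‖Z (b i)‖ ^ 2) Filter.atTop (nhds 0) := by
      simpa using (tendsto_const_nhds (x := S)).sub hS
    simpa [Function.comp_def] using (Real.continuous_sqrt.tendsto 0).comp h1
  exact isCompactOperator_of_tendsto hlim (Filter.Eventually.of_forall hF)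

/-- Takagi factorization: a symmetric antilinear Hilbert-Schmidt operator is diagonal with
nonnegative entries in some Hilbert basis. -/
theorem exists_takagi_basis {Z : V →ₗ⋆[ℂ] V} (hZ : ∀ x y, ⟪y, Z x⟫_ℂ = ⟪x, Z y⟫_ℂ)
    (hHS : IsHilbertSchmidt Z) : ∃ (s : Set V) (e : HilbertBasis s ℂ V) (l : s → ℝ),
      (∀ i, 0 ≤ l i) ∧ (∀ i, Z (e i) = (l i : ℂ) • e i) ∧ Summable fun i => l i ^ 2 := by
  classical
  have hcomp := isCompactOperator_of_hilbertSchmidt hZ hHS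
  let Zc : V →L⋆[ℂ] V := ⟨Z, hHS.1⟩
  let T : V →L[ℂ] V := Zc.comp Zc
  have hTapp : ∀ x, T x = Z (Z x) := fun _ => rfl
  have hT : IsCompactOperator T := hcomp.clm_comp Zc
  have hZZ : ∀ x y, ⟪x, T y⟫_ℂ = ⟪Z y, Z x⟫_ℂ := fun x y => hZ (Z y) x
  have hTs : T.IsSymmetric := fun x y => by
    change ⟪T x, y⟫_ℂ = ⟪x, T y⟫_ℂ
    rw [hZZ, ← inner_conj_symm, hZZ, inner_conj_symm]
  -- Take a maximal orthonormal set of Takagi vectors. Its orthogonal complement is invariant under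
  -- Z, and the compact symmetric operator `Z²` would supply a further Takagi vector if the
  -- complement were nonzero.
  obtain ⟨s, hs⟩ := zorn_subset
    {s : Set V | Orthonormal ℂ (Subtype.val : s → V) ∧ ∀ x ∈ s, IsTakagi Z x} (by
      intro c hc hchain
      refine ⟨⋃₀ c, ⟨orthonormal_sUnion_of_directed hchain.directedOn fun a ha => (hc ha).1, ?_⟩,
        fun a ha => Set.subset_sUnion_of_mem ha⟩
      rintro x ⟨a, ha, hx⟩
      exact (hc ha).2 x hx)
  have hon := hs.prop.1
  have hperp : (Submodule.span ℂ (Set.range (Subtype.val : s → V)))ᗮ = ⊥ := by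
    rw [Submodule.eq_bot_iff]
    intro x hx
    by_contra hx0
    rw [Subtype.range_coe_subtype] at hx
    obtain ⟨K, hK⟩ : ∃ K, K = (Submodule.span ℂ {x | x ∈ s})ᗮ := ⟨_, rfl⟩
    have hmem : ∀ y, y ∈ K ↔ ∀ u ∈ s, ⟪u, y⟫_ℂ = 0 := fun y => by
      rw [hK, Submodule.mem_orthogonal]
      refine ⟨fun h u hu => h u (Submodule.subset_span hu), fun h u hu => ?_⟩
      induction hu using Submodule.span_induction with
      | mem u hu => exact h u hu
      | zero => simp
      | add u w _ _ hu hw => rw [inner_add_left, hu, hw, add_zero]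
      | smul r u _ hu => rw [inner_smul_left, hu, mul_zero]
    have hKZ : ∀ y ∈ K, Z y ∈ K := fun y hy => by
      rw [hmem] at hy ⊢
      intro u hu
      obtain ⟨l, -, hl⟩ := hs.prop.2 u hu
      rw [hZ, hl, inner_smul_right, ← inner_conj_symm, hy u hu]
      simp
    -- The spectral theorem is used on all of V. The projection of `x ∈ K` to an eigenspace stays in
    -- K, since every u in s is an eigenvector of T: it either lies in that eigenspace or is
    -- orthogonal to it. Without eigenvectors in K all projections vanish, and so does x.
    obtain ⟨μ, y, hyK, hy0, hy⟩ : ∃ μ : ℂ, ∃ y ∈ K, y ≠ 0 ∧ T y = μ • y := by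
      by_contra! hno
      have hbot := ContinuousLinearMap.orthogonalComplement_iSup_eigenspaces_eq_bot hT hTs
      refine hx0 ((Submodule.eq_bot_iff _).1 hbot x ?_)
      rw [← Submodule.iInf_orthogonal, Submodule.mem_iInf]
      intro μ
      let E := Module.End.eigenspace (T : Module.End ℂ V) μ
      have hE : ∀ y, y ∈ E ↔ T y = μ • y := fun y => Module.End.mem_eigenspace_iff
      have hEc : IsClosed (E : Set V) := by
        have : (E : Set V) = {y | T y = μ • y} := Set.ext hE
        rw [this]
        exact isClosed_eq T.continuous (continuous_const_smul μ)
      have : CompleteSpace E := hEc.completeSpace_coe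
      have hp : E.starProjection x = 0 := by
        by_contra hp0
        refine hno μ _ ?_ hp0 ((hE _).1 (E.starProjection_apply_mem x))
        rw [hmem]
        intro u hu
        obtain ⟨l, -, hl⟩ := hs.prop.2 u hu
        have hTu : T u = ((l * l : ℝ) : ℂ) • u := by
          rw [hTapp, hl, map_smulₛₗ, hl, Complex.conj_ofReal, smul_smul, Complex.ofReal_mul]
        by_cases hμ : μ = ((l * l : ℝ) : ℂ)
        · have huE : u ∈ E := by rw [hE, hTu, hμ]
          rw [← E.inner_starProjection_left_eq_right, E.starProjection_eq_self_iff.2 huE]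
          exact (hmem x).1 (hK ▸ hx) u hu
        · have h1 := (hE _).1 (E.starProjection_apply_mem x)
          have h2 : ⟪T u, E.starProjection x⟫_ℂ = ⟪u, T (E.starProjection x)⟫_ℂ := hTs _ _
          rw [hTu, h1, inner_smul_left, inner_smul_right, Complex.conj_ofReal] at h2
          have h3 := sub_eq_zero.2 h2
          rw [← sub_mul] at h3
          exact (mul_eq_zero.1 h3).resolve_left fun h => hμ (sub_eq_zero.1 h).symm
      exact (E.starProjection_apply_eq_zero_iff).1 hp
    have hμ : μ = (((‖Z y‖ / ‖y‖) * (‖Z y‖ / ‖y‖) : ℝ) : ℂ) := by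
      have h1 := hZZ y y
      rw [hy, inner_smul_right, inner_self_eq_norm_sq_to_K, inner_self_eq_norm_sq_to_K] at h1
      have h2 : ((‖y‖ : ℝ) : ℂ) ≠ 0 := by simpa using hy0
      have h3 : μ * (‖y‖ : ℂ) ^ 2 = (‖Z y‖ : ℂ) ^ 2 := h1
      push_cast
      field_simp
      exact h3
    obtain ⟨z, hzK, hz0, l, hl, hz⟩ := exists_isTakagi_of_sq hKZ hyK hy0
      (div_nonneg (norm_nonneg (Z y)) (norm_nonneg y))
      (by rw [← hTapp, hy, hμ, smul_smul, Complex.ofReal_mul])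
    obtain ⟨w, hw⟩ : ∃ w, w = ((‖z‖⁻¹ : ℝ) : ℂ) • z := ⟨_, rfl⟩
    have hwK : w ∈ K := hw ▸ K.smul_mem _ hzK
    have hw1 : ⟪w, w⟫_ℂ = 1 := by
      rw [hw, inner_smul_left, inner_smul_right, Complex.conj_ofReal, inner_self_eq_norm_sq_to_K]
      have h2 : ((‖z‖ : ℝ) : ℂ) ≠ 0 := by simpa using hz0
      change _ * (_ * (‖z‖ : ℂ) ^ 2) = 1
      push_cast
      field_simp
    have hwT : IsTakagi Z w := ⟨l, hl, by
      rw [hw, map_smulₛₗ, hz, Complex.conj_ofReal, smul_comm]⟩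
    have hws : w ∉ s := fun hws => by
      have := (hmem w).1 hwK w hws
      rw [hw1] at this
      exact one_ne_zero this
    refine hws (hs.le_of_ge (y := insert w s) ⟨?_, ?_⟩ (Set.subset_insert w s) (Set.mem_insert w s))
    · rw [orthonormal_subtype_iff_ite] at hon ⊢
      rintro a (rfl | ha) c (rfl | hc)
      · rw [if_pos rfl, hw1]
      · rw [if_neg (fun h : a = c => hws (h ▸ hc)), ← inner_conj_symm, (hmem a).1 hwK c hc, map_zero]
      · rw [if_neg (fun h : a = c => hws (h ▸ ha)), (hmem c).1 hwK a ha]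
      · exact hon a ha c hc
    · rintro a (rfl | ha)
      · exact hwT
      · exact hs.prop.2 a ha
  let e := HilbertBasis.mkOfOrthogonalEqBot hon hperp
  have he : ∀ i, e i = i := fun i => by
    rw [HilbertBasis.coe_mkOfOrthogonalEqBot]
  choose l hl hl' using fun i : s => hs.prop.2 i i.2
  refine ⟨s, e, l, hl, fun i => by rw [he, hl'], ?_⟩
  obtain ⟨-, t, b, hb⟩ := hHS
  refine (summable_norm_sq_of_basis hZ b e hb).congr fun i => ?_
  rw [he, hl', norm_smul, ← he, e.orthonormal.1 i, mul_one, Complex.norm_real,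
    Real.norm_of_nonneg (hl i)]

end Takagi

/-! ### The one-dimensional Gaussian and the binomial series -/

section Series

/-- The coefficients `n! [xⁿ] exp(l x² / 2)`. -/
def gaussCoeff (l : ℝ) : ℕ → ℝ
  | 0 => 1
  | 1 => 0
  | n + 2 => (n + 1) * l * gaussCoeff l n

theorem gaussCoeff_odd (l : ℝ) (k : ℕ) : gaussCoeff l (2 * k + 1) = 0 := by
  induction k with
  | zero => rfl
  | succ k ih =>
    have h : gaussCoeff l (2 * (k + 1) + 1) =
      (((2 * k + 1 : ℕ) : ℝ) + 1) * l * gaussCoeff l (2 * k + 1) := rfl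
    rw [h, ih, mul_zero]

theorem ring_choose_succ (r : ℝ) (k : ℕ) :
    (k + 1) * Ring.choose r (k + 1) = (r - k) * Ring.choose r k := by
  have h : ((k : Polynomial ℤ)).smeval r = (k : ℝ) := by
    rw [Polynomial.smeval_natCast, pow_zero, nsmul_eq_mul, mul_one]
  rw [Ring.choose_eq_smul, Ring.choose_eq_smul, descPochhammer_succ_right, Polynomial.smeval_mul,
    Polynomial.smeval_sub, Polynomial.smeval_X, h, Nat.factorial_succ, pow_one]
  push_cast
  have h1 : (k : ℝ) + 1 ≠ 0 := by positivity
  have h2 : (k.factorial : ℝ) ≠ 0 := by positivity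
  simp only [smul_eq_mul]
  field_simp

/-- Both sides start at 1 and have successive ratio `(2k+1)/(2k+2) · l²`. The sum over k is thus the
binomial series of `(1 - l²)^(-1/2)`. -/
theorem gaussCoeff_even_sq (l : ℝ) (k : ℕ) : gaussCoeff l (2 * k) ^ 2 / ((2 * k).factorial : ℝ) =
    Ring.choose (-1 / 2 : ℝ) k * (-l ^ 2) ^ k := by
  induction k with
  | zero => simp [gaussCoeff]
  | succ k ih =>
    have h : gaussCoeff l (2 * (k + 1)) =
      (((2 * k : ℕ) : ℝ) + 1) * l * gaussCoeff l (2 * k) := rfl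
    have hf : ((2 * (k + 1)).factorial : ℝ) = (2 * k + 2) * (2 * k + 1) * (2 * k).factorial := by
      rw [show 2 * (k + 1) = 2 * k + 1 + 1 by ring, Nat.factorial_succ, Nat.factorial_succ]
      push_cast
      ring
    have hc := ring_choose_succ (-1 / 2) k
    have h1 : (k : ℝ) + 1 ≠ 0 := by positivity
    have h2 : (2 * k : ℝ) + 1 ≠ 0 := by positivity
    have h3 : ((2 * k).factorial : ℝ) ≠ 0 := by positivity
    have hc' : Ring.choose (-1 / 2 : ℝ) (k + 1) =
        (-1 / 2 - k) / (k + 1) * Ring.choose (-1 / 2 : ℝ) k := by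
      rw [div_mul_eq_mul_div, eq_div_iff h1]
      linear_combination hc
    have e : gaussCoeff l (2 * (k + 1)) ^ 2 / ((2 * (k + 1)).factorial : ℝ) =
        (2 * k + 1) / (2 * k + 2) * l ^ 2 *
          (gaussCoeff l (2 * k) ^ 2 / ((2 * k).factorial : ℝ)) := by
      rw [h, hf]
      push_cast
      have h4 : (2 * k : ℝ) + 2 ≠ 0 := by positivity
      field_simp
    rw [e, ih, hc', pow_succ]
    have h4 : (2 * k : ℝ) + 2 ≠ 0 := by positivity
    field_simp
    ring

theorem hasSum_gaussCoeff {l : ℝ} (h0 : 0 ≤ l) (h1 : l < 1) :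
    HasSum (fun n => gaussCoeff l n ^ 2 / (n.factorial : ℝ)) ((1 - l ^ 2) ^ (-1 / 2 : ℝ)) := by
  have h2 := (Real.one_add_rpow_hasFPowerSeriesOnBall_zero (a := -1 / 2)).hasSum (y := -l ^ 2) (by
    simpa [Metric.mem_eball, edist_dist, abs_of_nonneg h0] using h1)
  have h3 : HasSum (fun k => gaussCoeff l (2 * k) ^ 2 / ((2 * k).factorial : ℝ))
      ((1 - l ^ 2) ^ (-1 / 2 : ℝ)) := by
    rw [zero_add, ← sub_eq_add_neg] at h2
    have e : (fun k => gaussCoeff l (2 * k) ^ 2 / ((2 * k).factorial : ℝ)) =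
        fun k => binomialSeries ℝ (-1 / 2 : ℝ) k fun _ => -l ^ 2 := funext fun k => by
      rw [gaussCoeff_even_sq, binomialSeries_apply, List.ofFn_const, List.prod_replicate,
        smul_eq_mul]
    rw [e]
    exact h2
  have h4 : HasSum (fun k => gaussCoeff l (2 * k + 1) ^ 2 / ((2 * k + 1).factorial : ℝ)) 0 := by
    simp [gaussCoeff_odd, hasSum_zero]
  have h5 := HasSum.even_add_odd (f := fun n => gaussCoeff l n ^ 2 / (n.factorial : ℝ)) h3 h4
  rwa [add_zero] at h5

end Series

/-! ### Infinite products of series as sums over multi-indices -/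

section FinsuppProd

variable {ι : Type*}

theorem sum_finsupp_prod (s : Finset ι) (t : ι → Finset ℕ) {f : ι → ℕ → ℝ} (h0 : ∀ i, f i 0 = 1) :
    ∑ α ∈ s.finsupp t, α.prod f = ∏ i ∈ s, ∑ n ∈ t i, f i n := by
  classical
  have h1 : ∀ α ∈ s.finsupp t, α.prod f = ∏ i ∈ s, f i (α i) := fun α hα =>
    Finsupp.prod_of_support_subset α (Finset.mem_finsupp_iff.1 hα).1 f fun i _ => h0 i
  rw [Finset.sum_congr rfl h1, Finset.prod_sum, Finset.finsupp, Finset.sum_map]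
  refine Finset.sum_congr rfl fun p _ => ?_
  rw [← Finset.prod_attach]
  refine Finset.prod_congr rfl fun i _ => ?_
  simp [Finsupp.indicator_apply]

theorem prod_le_of_hasProd {x : ι → ℝ} {P : ℝ} (hx : ∀ i, 1 ≤ x i) (hP : HasProd x P)
    (s : Finset ι) : ∏ i ∈ s, x i ≤ P := by
  classical
  refine ge_of_tendsto hP (Filter.eventually_atTop.2 ⟨s, fun t ht => ?_⟩)
  rw [← Finset.prod_sdiff ht]
  have h1 : (1 : ℝ) ≤ ∏ i ∈ t \ s, x i := by
    have := Finset.prod_le_prod (s := t \ s) (f := fun _ => (1 : ℝ)) (g := x)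
      (fun _ _ => zero_le_one) fun i _ => hx i
    simpa using this
  have h2 : (0 : ℝ) ≤ ∏ i ∈ s, x i := Finset.prod_nonneg fun i _ => zero_le_one.trans (hx i)
  nlinarith

/-- Expansion of an infinite product of series. -/
theorem hasSum_finsupp_prod {f : ι → ℕ → ℝ} (hf : ∀ i n, 0 ≤ f i n) (h0 : ∀ i, f i 0 = 1)
    {x : ι → ℝ} (hx : ∀ i, HasSum (f i) (x i)) {P : ℝ} (hP : HasProd x P) :
    HasSum (fun α : ι →₀ ℕ => α.prod f) P := by
  classical
  have hx1 : ∀ i, 1 ≤ x i := fun i => by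
    have := le_hasSum (hx i) 0 fun n _ => hf i n
    rwa [h0] at this
  have hnn : ∀ α : ι →₀ ℕ, 0 ≤ α.prod f := fun α => Finset.prod_nonneg fun i _ => hf i _
  refine hasSum_of_isLUB_of_nonneg P hnn ⟨?_, fun b hb => ?_⟩
  -- A finite set of multi-indices lies in a box, where the sum factors into partial sums; each is
  -- at most `x i`, and partial products are at most P because all `x i ≥ 1`.
  · rintro _ ⟨A, rfl⟩
    let s : Finset ι := A.biUnion Finsupp.support
    let N : ℕ := A.sup fun α => s.sup α
    have hA : A ⊆ s.finsupp fun _ => Finset.range (N + 1) := fun α hα => by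
      refine Finset.mem_finsupp_iff.2 ⟨Finset.subset_biUnion_of_mem Finsupp.support hα, fun i hi => ?_⟩
      rw [Finset.mem_range, Nat.lt_succ_iff]
      exact (Finset.le_sup (f := α) hi).trans (Finset.le_sup (f := fun α : ι →₀ ℕ => s.sup α) hα)
    refine (Finset.sum_le_sum_of_subset_of_nonneg hA fun α _ _ => hnn α).trans ?_
    rw [sum_finsupp_prod s _ h0]
    refine le_trans ?_ (prod_le_of_hasProd hx1 hP s)
    exact Finset.prod_le_prod (fun i _ => Finset.sum_nonneg fun n _ => hf i n)
      fun i _ => sum_le_hasSum _ (fun n _ => hf i n) (hx i)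
  -- Conversely, the sums over boxes approach every finite partial product.
  · refine le_of_tendsto hP (Filter.Eventually.of_forall fun s => ?_)
    have hlim : Filter.Tendsto (fun N => ∏ i ∈ s, ∑ n ∈ Finset.range N, f i n) Filter.atTop
        (nhds (∏ i ∈ s, x i)) := tendsto_finsetProd _ fun i _ => (hx i).tendsto_sum_nat
    refine le_of_tendsto hlim (Filter.Eventually.of_forall fun N => ?_)
    rw [← sum_finsupp_prod s _ h0]
    exact hb ⟨_, rfl⟩

theorem prod_add_single {h : ι → ℕ → ℝ} (h0 : ∀ i, h i 0 = 1) (α : ι →₀ ℕ) (i : ι) :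
    (α + Finsupp.single i 1).prod h = h i (α i + 1) * (α.erase i).prod h := by
  classical
  rw [← Finsupp.mul_prod_erase' _ i h h0]
  congr 2
  · simp
  · ext j
    by_cases hj : j = i
    · subst hj; simp
    · simp [hj]

/-- Both products are exponentials of one convergent series of logarithms. D gives the Fredholm
determinant and its power `-1/2` the squared norm of the Gaussian. -/
theorem hasProd_rpow_of_summable {l : ι → ℝ} (h1 : ∀ i, l i ^ 2 < 1)
    (hs : Summable fun i => l i ^ 2) : ∃ D : ℝ, 0 < D ∧ HasProd (fun i => 1 - l i ^ 2) D ∧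
      HasProd (fun i => (1 - l i ^ 2) ^ (-1 / 2 : ℝ)) (D ^ (-1 / 2 : ℝ)) := by
  have hpos : ∀ i, 0 < 1 - l i ^ 2 := fun i => sub_pos.2 (h1 i)
  have hlog : Summable fun i => Real.log (1 - l i ^ 2) := by
    simpa [sub_eq_add_neg] using Real.summable_log_one_add_of_summable hs.neg
  refine ⟨Real.exp (∑' i, Real.log (1 - l i ^ 2)), Real.exp_pos _,
    Real.hasProd_of_hasSum_log hpos hlog.hasSum, ?_⟩
  rw [← Real.exp_mul]
  refine Real.hasProd_of_hasSum_log (fun i => Real.rpow_pos_of_pos (hpos i) _) ?_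
  simpa only [Real.log_rpow (hpos _), mul_comm] using hlog.hasSum.mul_right (-1 / 2 : ℝ)

end FinsuppProd

/-! ### Monomial bases of Fock space and Gaussians as Fock vectors -/

section GaussianVector

variable {V : Type*} [NormedAddCommGroup V] [InnerProductSpace ℂ V] {ι : Type*}

/-- The monomial `e^α`. -/
def mono (e : ι → V) (α : ι →₀ ℕ) : SymAlgC V := monom e (MvPolynomial.monomial α 1)

theorem mono_zero (e : ι → V) : mono e 0 = 1 := map_one (monom e)

theorem mono_add_single (e : ι → V) (α : ι →₀ ℕ) (i : ι) :
    mono e (α + Finsupp.single i 1) = gen (e i) * mono e α := monom_monomial_add e i α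

theorem annihilator_mono {e : ι → V} (he : Orthonormal ℂ e) (α : ι →₀ ℕ) (i : ι) :
    annihilator (e i) (mono e α) = (α i : ℂ) • mono e (α - Finsupp.single i 1) := by
  classical
  rw [mono, annihilator_monom he, MvPolynomial.pderiv_monomial, mono, ← map_smul,
    MvPolynomial.smul_monomial, one_mul, smul_eq_mul, mul_one]

theorem monom_mem_span (e : ι → V) (P : MvPolynomial ι ℂ) :
    monom e P ∈ Submodule.span ℂ (Set.range (mono e)) := by
  rw [P.as_sum, map_sum]
  refine sum_mem fun α _ => ?_
  have : monom e (MvPolynomial.monomial α (P.coeff α)) = P.coeff α • mono e α := by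
    rw [mono, ← map_smul, MvPolynomial.smul_monomial, smul_eq_mul, mul_one]
  rw [this]
  exact Submodule.smul_mem _ _ (Submodule.subset_span ⟨α, rfl⟩)

theorem degPart_mono_mem_span (e : ι → V) (n : ℕ) (P : MvPolynomial ι ℂ) :
    degPart n (monom e P) ∈ Submodule.span ℂ (Set.range (mono e)) := by
  suffices h : ∃ Q, degPart n (monom e P) = monom e Q by
    obtain ⟨Q, hQ⟩ := h
    rw [hQ]
    exact monom_mem_span e Q
  induction P using MvPolynomial.induction_on generalizing n with
  | C a =>
    refine ⟨if n = 0 then MvPolynomial.C a else 0, ?_⟩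
    have h : monom e (MvPolynomial.C a) = a • 1 := by simp [monom, Algebra.algebraMap_eq_smul_one]
    rw [h, map_smul, degPart_one]
    split_ifs
    · rw [h]
    · simp
  | add p q hp hq =>
    obtain ⟨p', hp'⟩ := hp n
    obtain ⟨q', hq'⟩ := hq n
    exact ⟨p' + q', by rw [map_add, map_add, map_add, hp', hq']⟩
  | mul_X p i hp =>
    have h : monom e (p * MvPolynomial.X i) = gen (e i) * monom e p := by
      simp [monom, mul_comm]
    rw [h]
    rcases n with _ | n
    · exact ⟨0, by rw [degPart_zero_gen_mul, map_zero]⟩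
    · obtain ⟨p', hp'⟩ := hp n
      refine ⟨p' * MvPolynomial.X i, ?_⟩
      rw [degPart_succ_gen_mul, hp']
      simp [monom, mul_comm]

/-- The product of the factorials of a multi-index. -/
def multiFact (α : ι →₀ ℕ) : ℝ := α.prod fun _ n => (n.factorial : ℝ)

theorem multiFact_pos (α : ι →₀ ℕ) : 0 < multiFact α :=
  Finset.prod_pos fun _ _ => by positivity

theorem multiFact_add_single (α : ι →₀ ℕ) (i : ι) :
    multiFact (α + Finsupp.single i 1) = (α i + 1) * multiFact α := by
  rw [multiFact, prod_add_single (by simp), multiFact,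
    ← Finsupp.mul_prod_erase' α i (fun _ n => (n.factorial : ℝ)) (by simp), Nat.factorial_succ]
  push_cast
  ring

theorem inner_mono_mono {e : ι → V} (he : Orthonormal ℂ e) (α β : ι →₀ ℕ) [Decidable (α = β)] :
    ⟪mono e α, mono e β⟫_ℂ = if α = β then (multiFact α : ℂ) else 0 := by
  classical
  obtain ⟨n, hn⟩ : ∃ n, n = α.degree := ⟨_, rfl⟩
  have hne : ∀ α : ι →₀ ℕ, α ≠ 0 → ∃ i, α i ≠ 0 := fun α h => by
    by_contra! h'
    exact h (Finsupp.ext h')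
  induction n generalizing α β with
  | zero =>
    have hα : α = 0 := (Finsupp.degree_eq_zero_iff α).1 hn.symm
    subst hα
    split_ifs with h
    · subst h
      rw [mono_zero, sym_inner_def, symToDual_one, vac_one]
      simp [multiFact]
    · obtain ⟨i, hi⟩ := hne β (Ne.symm h)
      rw [← sub_single_add hi, mono_add_single, inner_gen_mul_right, mono_zero, annihilator_one,
        inner_zero_left]
  | succ n ih =>
    obtain ⟨i, hi⟩ := hne α (fun h => by simp [h] at hn)
    obtain ⟨γ, hγ⟩ : ∃ γ, α = γ + Finsupp.single i 1 := ⟨_, (sub_single_add hi).symm⟩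
    subst hγ
    have hd : n = γ.degree := by
      rw [map_add, Finsupp.degree_single] at hn
      omega
    rw [mono_add_single, inner_gen_mul_left, annihilator_mono he, inner_smul_right, ih γ _ hd]
    by_cases hβ : β i = 0
    · have hne' : γ + Finsupp.single i 1 ≠ β := fun h => by rw [← h] at hβ; simp at hβ
      rw [if_neg hne', hβ]
      simp
    · obtain ⟨δ, rfl⟩ : ∃ δ, β = δ + Finsupp.single i 1 := ⟨_, (sub_single_add hβ).symm⟩
      rw [add_tsub_cancel_right]
      by_cases hγδ : γ = δ
      · subst hγδ
        rw [if_pos rfl, if_pos rfl, multiFact_add_single]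
        simp
      · rw [if_neg hγδ, if_neg fun h => hγδ (add_right_cancel h), mul_zero]

/-- Creators and annihilators are controlled only in a fixed degree; hence density arguments below
are run degree by degree. This lemma and the next three give continuity separately in the vector and
in the element of SV. -/
theorem continuous_gen_mul_degPart (w : V) (n : ℕ) :
    Continuous fun θ : SymAlgC V => gen w * degPart n θ :=
  AddMonoidHomClass.continuous_of_bound
    ((LinearMap.mulLeft ℂ (gen w)) ∘ₗ degPart n : SymAlgC V →ₗ[ℂ] SymAlgC V)
    (Real.sqrt (n + 1) * ‖w‖) fun θ =>
      (norm_gen_mul_degPart_le n w θ).trans (by gcongr; exact norm_degPart_le n θ)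

theorem continuous_annihilator_degPart (w : V) (n : ℕ) :
    Continuous fun θ : SymAlgC V => annihilator w (degPart n θ) :=
  AddMonoidHomClass.continuous_of_bound
    (annihilator w ∘ₗ degPart n : SymAlgC V →ₗ[ℂ] SymAlgC V)
    (Real.sqrt n * ‖w‖) fun θ =>
      (norm_annihilator_degPart_le n w θ).trans (by gcongr; exact norm_degPart_le n θ)

theorem continuous_gen_mul_left (n : ℕ) (θ : SymAlgC V) :
    Continuous fun w : V => gen w * degPart n θ :=
  AddMonoidHomClass.continuous_of_bound
    ((LinearMap.mulRight ℂ (degPart n θ)) ∘ₗ SymmetricAlgebra.ι ℂ V : V →ₗ[ℂ] SymAlgC V)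
    (Real.sqrt (n + 1) * ‖degPart n θ‖) fun w =>
      (norm_gen_mul_degPart_le n w θ).trans_eq (by ring)

/-- The annihilators as an antilinear function of the vector. -/
def annihilatorMap (θ : SymAlgC V) : V →ₗ⋆[ℂ] SymAlgC V where
  toFun v := annihilator v θ
  map_add' v w := by rw [annihilator_add]; rfl
  map_smul' r v := by rw [annihilator_smul]; rfl

theorem continuous_annihilator_left (n : ℕ) (θ : SymAlgC V) :
    Continuous fun w : V => annihilator w (degPart n θ) :=
  AddMonoidHomClass.continuous_of_bound (annihilatorMap (degPart n θ))
    (Real.sqrt n * ‖degPart n θ‖) fun w =>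
      (norm_annihilator_degPart_le n w θ).trans_eq (by ring)

/-- A closed condition on vectors that is stable under linear combinations holds if it holds on a
Hilbert basis. -/
theorem hilbertBasis_induction (e : HilbertBasis ι ℂ V) {P : V → Prop} (hc : IsClosed {w | P w})
    (h0 : P 0) (hadd : ∀ v w, P v → P w → P (v + w)) (hsmul : ∀ (r : ℂ) v, P v → P (r • v))
    (he : ∀ i, P (e i)) (w : V) : P w := by
  have h : w ∈ (Submodule.span ℂ (Set.range e)).topologicalClosure := by
    rw [e.dense_span]; trivial
  have h1 : ((Submodule.span ℂ (Set.range e) : Submodule ℂ V) : Set V) ⊆ {w | P w} := fun v hv => by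
    induction hv using Submodule.span_induction with
    | mem v hv => obtain ⟨i, rfl⟩ := hv; exact he i
    | zero => exact h0
    | add u v _ _ hu hv => exact hadd u v hu hv
    | smul r u _ hu => exact hsmul r u hu
  exact closure_minimal h1 hc h

theorem gen_mul_degPart_mem (e : ι → V) (i : ι) (n : ℕ) (P : MvPolynomial ι ℂ) :
    gen (e i) * degPart n (monom e P) ∈ Submodule.span ℂ (Set.range (mono e)) := by
  have h : gen (e i) * degPart n (monom e P) = degPart (n + 1) (monom e (MvPolynomial.X i * P)) := by
    rw [map_mul, show monom e (MvPolynomial.X i) = gen (e i) by simp [monom], degPart_succ_gen_mul]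
  rw [h]
  exact degPart_mono_mem_span e _ _

theorem exists_monom_of_mem_span {e : ι → V} {θ : SymAlgC V}
    (h : θ ∈ Submodule.span ℂ (Set.range (mono e))) : ∃ P, monom e P = θ := by
  have : Submodule.span ℂ (Set.range (mono e)) ≤ LinearMap.range (monom e).toLinearMap := by
    rw [Submodule.span_le]
    rintro _ ⟨α, rfl⟩
    exact ⟨_, rfl⟩
  exact this h

/-- The monomials in a Hilbert basis are total in `SV`. -/
theorem span_mono_dense (e : HilbertBasis ι ℂ V) (θ : SymAlgC V) :
    θ ∈ (Submodule.span ℂ (Set.range (mono e))).topologicalClosure := by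
  obtain ⟨K, hK⟩ : ∃ K, K = (Submodule.span ℂ (Set.range (mono e))).topologicalClosure := ⟨_, rfl⟩
  have hKc : IsClosed (K : Set (SymAlgC V)) := hK ▸ Submodule.isClosed_topologicalClosure _
  have hle : Submodule.span ℂ (Set.range (mono e)) ≤ K := hK ▸ Submodule.le_topologicalClosure _
  rw [← hK]
  induction θ using sym_induction with
  | one => exact hle (Submodule.subset_span ⟨0, mono_zero _⟩)
  | gen_mul w θ ih =>
    obtain ⟨N, hN⟩ := exists_sum_degPart θ
    rw [← hN N le_rfl, Finset.mul_sum]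
    refine sum_mem fun n _ => ?_
    -- Two successive limits: first w is approximated by basis vectors with η a fixed combination of
    -- monomials, then η is allowed to approach θ.
    have h1 : ∀ η ∈ Submodule.span ℂ (Set.range (mono e)), gen w * degPart n η ∈ K := fun η hη => by
      obtain ⟨P, rfl⟩ := exists_monom_of_mem_span hη
      refine hilbertBasis_induction e (P := fun w => gen w * degPart n (monom e P) ∈ K)
        (hKc.preimage (continuous_gen_mul_left n _)) ?_ ?_ ?_ (fun i => ?_) w
      · rw [show (gen (0 : V) : SymAlgC V) = 0 from map_zero _, zero_mul]; exact K.zero_mem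
      · intro v w hv hw
        rw [gen_add, add_mul]
        exact K.add_mem hv hw
      · intro r v hv
        rw [show (gen (r • v) : SymAlgC V) = r • gen v from map_smul _ _ _, smul_mul_assoc]
        exact K.smul_mem r hv
      · exact hle (gen_mul_degPart_mem e i n P)
    have h2 : closure ((Submodule.span ℂ (Set.range (mono e)) : Submodule ℂ (SymAlgC V)) :
        Set (SymAlgC V)) ⊆ {η | gen w * degPart n η ∈ K} :=
      closure_minimal h1 (hKc.preimage (continuous_gen_mul_degPart w n))
    rw [hK] at ih
    exact h2 ih
  | add θ η h h' => exact K.add_mem h h'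
  | smul r θ h => exact K.smul_mem r h

theorem orthonormal_mono {e : ι → V} (he : Orthonormal ℂ e) :
    Orthonormal ℂ fun α => (((Real.sqrt (multiFact α))⁻¹ : ℝ) : ℂ) • toFock (mono e α) := by
  classical
  rw [orthonormal_iff_ite]
  intro α β
  rw [inner_smul_left, inner_smul_right, LinearIsometry.inner_map_map, inner_mono_mono he]
  split_ifs with h
  · subst h
    have h1 : (Real.sqrt (multiFact α) : ℂ) * (Real.sqrt (multiFact α) : ℂ) = multiFact α := by
      rw [← Complex.ofReal_mul, Real.mul_self_sqrt (multiFact_pos α).le]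
    have h2 : (Real.sqrt (multiFact α) : ℂ) ≠ 0 := by
      exact_mod_cast (Real.sqrt_pos.2 (multiFact_pos α)).ne'
    rw [Complex.conj_ofReal, ← h1]
    push_cast
    field_simp
  · simp

/-- The Hilbert basis of Fock space formed by the normalized monomials in a Hilbert basis. -/
theorem exists_monoBasis (e : HilbertBasis ι ℂ V) : ∃ B : HilbertBasis (ι →₀ ℕ) ℂ (Fock V),
    ∀ α, B α = (((Real.sqrt (multiFact α))⁻¹ : ℝ) : ℂ) • toFock (mono e α) := by
  refine ⟨HilbertBasis.mkOfOrthogonalEqBot (orthonormal_mono e.orthonormal) ?_, fun α => by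
    rw [HilbertBasis.coe_mkOfOrthogonalEqBot]⟩
  rw [Submodule.eq_bot_iff]
  intro Ξ hΞ
  refine fockToDual_injective fun θ => ?_
  have h1 : ∀ α, ⟪toFock (mono e α), Ξ⟫_ℂ = 0 := fun α => by
    have h := (Submodule.mem_orthogonal _ _).1 hΞ _ (Submodule.subset_span ⟨α, rfl⟩)
    rw [inner_smul_left] at h
    refine (mul_eq_zero.1 h).resolve_left ?_
    rw [Complex.conj_ofReal]
    exact_mod_cast (inv_pos.2 (Real.sqrt_pos.2 (multiFact_pos α))).ne'
  have h2 : ((Submodule.span ℂ (Set.range (mono e)) : Submodule ℂ (SymAlgC V)) :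
      Set (SymAlgC V)) ⊆ {θ | ⟪toFock θ, Ξ⟫_ℂ = 0} := fun η hη => by
    induction hη using Submodule.span_induction with
    | mem v hv => obtain ⟨α, rfl⟩ := hv; exact h1 α
    | zero => simp
    | add u v _ _ hu hv =>
      rw [Set.mem_ofPred_eq] at hu hv ⊢
      rw [map_add, inner_add_left, hu, hv, add_zero]
    | smul r u _ hu =>
      rw [Set.mem_ofPred_eq] at hu ⊢
      rw [map_smul, inner_smul_left, hu, mul_zero]
  exact closure_minimal h2 (isClosed_eq (toFock.continuous.inner continuous_const) continuous_const)
    (span_mono_dense e θ)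

/-- The Gaussian equation for a diagonal Z, read on monomials. If `α i = 0` the truncated
subtraction is harmless, since both sides vanish. -/
theorem gaussCoeff_prod_add_single (l : ι → ℝ) (α : ι →₀ ℕ) (i : ι) :
    (α + Finsupp.single i 1).prod (fun i n => gaussCoeff (l i) n) =
      l i * (α i * (α - Finsupp.single i 1).prod (fun i n => gaussCoeff (l i) n)) := by
  classical
  rw [prod_add_single fun i => rfl]
  rcases hα : α i with _ | k
  · have : gaussCoeff (l i) (0 + 1) = 0 := rfl
    rw [this]
    simp
  · have hi : α i ≠ 0 := by omega
    obtain ⟨β, rfl⟩ : ∃ β, α = β + Finsupp.single i 1 := ⟨_, (sub_single_add hi).symm⟩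
    have hk : β i = k := by simpa using hα
    have he : (β + Finsupp.single i 1).erase i = β.erase i := by
      ext j
      by_cases hj : j = i
      · subst hj; simp
      · simp [hj]
    rw [add_tsub_cancel_right, he,
      ← Finsupp.mul_prod_erase' β i (fun i n => gaussCoeff (l i) n) fun i => rfl, hk]
    have : gaussCoeff (l i) (k + 1 + 1) = (k + 1) * l i * gaussCoeff (l i) k := rfl
    rw [this]
    push_cast
    ring

/-- The Gaussian of a diagonal symmetric operator belongs to Fock space; its norm is given by an
infinite product. -/
theorem exists_gaussian_vector {Z : V →ₗ⋆[ℂ] V} (hZ : Continuous Z) (e : HilbertBasis ι ℂ V)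
    {l : ι → ℝ} (h0 : ∀ i, 0 ≤ l i) (h1 : ∀ i, l i < 1) (hl : ∀ i, Z (e i) = (l i : ℂ) • e i)
    {P : ℝ} (hP : HasProd (fun i => (1 - l i ^ 2) ^ (-1 / 2 : ℝ)) P) :
    ∃ Φ : Fock V, ⟪toFock 1, Φ⟫_ℂ = 1 ∧ ‖Φ‖ ^ 2 = P ∧
      ∀ v θ, ⟪toFock (gen v * θ), Φ⟫_ℂ = ⟪toFock (annihilator (Z v) θ), Φ⟫_ℂ := by
  obtain ⟨B, hB⟩ := exists_monoBasis e
  -- The values of the Gaussian on the monomials. Divided by the norms of the monomials they are the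
  -- coordinates of Φ, square-summable by the expansion of the product P.
  obtain ⟨m, hm⟩ : ∃ m : (ι →₀ ℕ) → ℝ, m = fun α => α.prod fun i n => gaussCoeff (l i) n :=
    ⟨_, rfl⟩
  have hsum : HasSum (fun α => m α ^ 2 / multiFact α) P := by
    have h := hasSum_finsupp_prod (f := fun i n => gaussCoeff (l i) n ^ 2 / (n.factorial : ℝ))
      (fun i n => by positivity) (fun i => by simp [gaussCoeff])
      (fun i => hasSum_gaussCoeff (h0 i) (h1 i)) hP
    have e1 : (fun α => m α ^ 2 / multiFact α) = fun α : ι →₀ ℕ =>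
        α.prod (fun i n => gaussCoeff (l i) n ^ 2 / (n.factorial : ℝ)) := funext fun α => by
      rw [hm, multiFact]
      simp only [Finsupp.prod, Finset.prod_div_distrib, Finset.prod_pow]
    rwa [e1]
  have hsq : ∀ α, ‖(((Real.sqrt (multiFact α))⁻¹ * m α : ℝ) : ℂ)‖ ^ 2 = m α ^ 2 / multiFact α := by
    intro α
    rw [Complex.norm_real, Real.norm_eq_abs, sq_abs, mul_pow, inv_pow,
      Real.sq_sqrt (multiFact_pos α).le, inv_mul_eq_div]
  have hmem : Memℓp (fun α => (((Real.sqrt (multiFact α))⁻¹ * m α : ℝ) : ℂ)) 2 := by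
    refine memℓp_gen ?_
    simpa only [ENNReal.toReal_ofNat, Real.rpow_two, hsq] using hsum.summable
  obtain ⟨Φ, hΦ⟩ : ∃ Φ, Φ = B.repr.symm ⟨_, hmem⟩ := ⟨_, rfl⟩
  have hBΦ : ∀ α, ⟪B α, Φ⟫_ℂ = (((Real.sqrt (multiFact α))⁻¹ * m α : ℝ) : ℂ) := fun α => by
    rw [← B.repr_apply_apply, hΦ, LinearIsometryEquiv.apply_symm_apply]
  have hin : ∀ α, ⟪toFock (mono e α), Φ⟫_ℂ = m α := fun α => by
    have h := hBΦ α
    rw [hB, inner_smul_left, Complex.conj_ofReal, Complex.ofReal_mul] at h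
    refine mul_left_cancel₀ ?_ h
    exact_mod_cast (inv_pos.2 (Real.sqrt_pos.2 (multiFact_pos α))).ne'
  refine ⟨Φ, ?_, ?_, ?_⟩
  · have h := hin 0
    rw [mono_zero] at h
    rw [h, hm]
    simp
  · have h := hasSum_norm_inner_sq B Φ
    simp only [hBΦ, hsq] at h
    exact h.unique hsum
  -- The Gaussian equation is checked on basis vectors and monomials, then extended by linearity, by
  -- continuity in θ in a fixed degree, and finally by continuity in v.
  · have hmono : ∀ i α, ⟪toFock (gen (e i) * mono e α), Φ⟫_ℂ =
        ⟪toFock (annihilator (Z (e i)) (mono e α)), Φ⟫_ℂ := fun i α => by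
      rw [← mono_add_single, hin, hl, annihilator_smul, LinearMap.smul_apply,
        annihilator_mono e.orthonormal, map_smul, map_smul, inner_smul_left, inner_smul_left, hin,
        Complex.conj_conj, Complex.conj_natCast, hm]
      simp only
      rw [gaussCoeff_prod_add_single]
      push_cast
      rfl
    have hpoly : ∀ i Q, ⟪toFock (gen (e i) * monom e Q), Φ⟫_ℂ =
        ⟪toFock (annihilator (Z (e i)) (monom e Q)), Φ⟫_ℂ := fun i Q => by
      have h := monom_mem_span e Q
      generalize monom e Q = θ at h ⊢
      induction h using Submodule.span_induction with
      | mem v hv => obtain ⟨α, rfl⟩ := hv; exact hmono i α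
      | zero => simp
      | add u v _ _ hu hv =>
        simp only [mul_add, map_add, inner_add_left, hu, hv]
      | smul r u _ hu =>
        simp only [mul_smul_comm, map_smul, inner_smul_left, hu]
    have hdeg : ∀ i n θ, ⟪toFock (gen (e i) * degPart n θ), Φ⟫_ℂ =
        ⟪toFock (annihilator (Z (e i)) (degPart n θ)), Φ⟫_ℂ := fun i n θ => by
      have h2 : ((Submodule.span ℂ (Set.range (mono e)) : Submodule ℂ (SymAlgC V)) :
          Set (SymAlgC V)) ⊆ {θ | ⟪toFock (gen (e i) * degPart n θ), Φ⟫_ℂ =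
            ⟪toFock (annihilator (Z (e i)) (degPart n θ)), Φ⟫_ℂ} := fun η hη => by
        obtain ⟨Q, rfl⟩ := exists_monom_of_mem_span hη
        obtain ⟨Q', hQ'⟩ := exists_monom_of_mem_span (degPart_mono_mem_span e n Q)
        rw [Set.mem_ofPred_eq, ← hQ']
        exact hpoly i Q'
      refine closure_minimal h2 (isClosed_eq ?_ ?_) (span_mono_dense e θ)
      · exact (toFock.continuous.comp (continuous_gen_mul_degPart _ _)).inner continuous_const
      · exact (toFock.continuous.comp (continuous_annihilator_degPart _ _)).inner continuous_const
    intro v θ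
    obtain ⟨N, hN⟩ := exists_sum_degPart θ
    rw [← hN N le_rfl, Finset.mul_sum, map_sum, map_sum, map_sum, sum_inner, sum_inner]
    refine Finset.sum_congr rfl fun n _ => ?_
    refine hilbertBasis_induction e (P := fun v => ⟪toFock (gen v * degPart n θ), Φ⟫_ℂ =
      ⟪toFock (annihilator (Z v) (degPart n θ)), Φ⟫_ℂ) (isClosed_eq ?_ ?_) ?_ ?_ ?_
      (fun i => hdeg i n θ) v
    · exact (toFock.continuous.comp (continuous_gen_mul_left _ _)).inner continuous_const
    · exact (toFock.continuous.comp ((continuous_annihilator_left _ _).comp hZ)).inner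
        continuous_const
    · have e1 : annihilator (0 : V) (degPart n θ) = 0 := map_zero (annihilatorMap (degPart n θ))
      rw [show (gen (0 : V) : SymAlgC V) = 0 from map_zero _, zero_mul, map_zero Z, e1]
    · intro v w hv hw
      rw [gen_add, add_mul, map_add Z, annihilator_add, LinearMap.add_apply, map_add, map_add,
        inner_add_left, inner_add_left, hv, hw]
    · intro r v hv
      rw [show (gen (r • v) : SymAlgC V) = r • gen v from map_smul _ _ _, smul_mul_assoc,
        map_smulₛₗ Z, annihilator_smul, LinearMap.smul_apply, map_smul, map_smul, inner_smul_left,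
        inner_smul_left, hv, Complex.conj_conj]

end GaussianVector

/-! ### Fredholm determinants of diagonal operators -/

section FredholmDet

variable {V : Type*} [NormedAddCommGroup V] [InnerProductSpace ℂ V] {ι : Type*}

/-- The eigenspaces of a symmetric operator that is diagonal in a Hilbert basis. -/
theorem eigenspace_eq_span_of_hilbertBasis {T : Module.End ℂ V} (hT : T.IsSymmetric)
    (e : HilbertBasis ι ℂ V) {d : ι → ℝ} (hd : ∀ i, T (e i) = (d i : ℂ) • e i) {ν : ℂ}
    (hfin : Finite {i // (d i : ℂ) = ν}) :
    T.eigenspace ν = Submodule.span ℂ (Set.range fun i : {i // (d i : ℂ) = ν} => e i) := by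
  classical
  have := Fintype.ofFinite {i // (d i : ℂ) = ν}
  refine le_antisymm (fun x hx => ?_) (Submodule.span_le.2 ?_)
  · rw [Module.End.mem_eigenspace_iff] at hx
    have h0 : ∀ i, (d i : ℂ) ≠ ν → ⟪e i, x⟫_ℂ = 0 := fun i hi => by
      have h := hT (e i) x
      rw [hx, hd, inner_smul_left, inner_smul_right, Complex.conj_ofReal] at h
      exact (mul_eq_mul_right_iff.1 h).resolve_left hi
    have h1 : x = ∑ i : {i // (d i : ℂ) = ν}, ⟪e i, x⟫_ℂ • e i := by
      have hsum := e.hasSum_repr x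
      simp only [e.repr_apply_apply] at hsum
      refine hsum.unique ?_
      have hsub : Function.support (fun i => ⟪e i, x⟫_ℂ • e i) ⊆ {i | (d i : ℂ) = ν} :=
        fun i hi => by
          by_contra hne
          exact hi (by simp only [h0 i hne, zero_smul])
      have hsum' := hasSum_fintype fun i : {i // (d i : ℂ) = ν} => ⟪e i, x⟫_ℂ • e i
      exact (hasSum_subtype_iff_of_support_subset hsub).1 hsum'
    rw [h1]
    exact sum_mem fun i _ => Submodule.smul_mem _ _ (Submodule.subset_span ⟨i, rfl⟩)
  · rintro _ ⟨i, rfl⟩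
    rw [SetLike.mem_coe, Module.End.mem_eigenspace_iff]
    rw [hd, i.2]

/-- The Fredholm determinant of a symmetric operator that is diagonal in a Hilbert basis. -/
theorem fredholmDet_of_hilbertBasis {T : Module.End ℂ V} (hT : T.IsSymmetric)
    (e : HilbertBasis ι ℂ V) {d : ι → ℝ} (hd : ∀ i, T (e i) = (d i : ℂ) • e i)
    (hfin : ∀ ν : ℂ, ν ≠ 1 → Finite {i // (d i : ℂ) = ν}) {D : ℝ} (hD : HasProd d D) :
    fredholmDet T = D := by
  have hD' : HasProd (fun i => (d i : ℂ)) (D : ℂ) :=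
    hD.map Complex.ofRealHom Complex.continuous_ofReal
  -- Grouping the diagonal entries by value turns the product over basis vectors into a product over
  -- eigenvalues.
  have h1 := (Equiv.sigmaFiberEquiv fun i => (d i : ℂ)).hasProd_iff.2 hD'
  refine (h1.sigma fun ν => ?_).tprod_eq
  have h2 : (fun i : {i // (d i : ℂ) = ν} => (d (Equiv.sigmaFiberEquiv (fun i => (d i : ℂ))
      ⟨ν, i⟩) : ℂ)) = fun _ => ν := funext fun i => i.2
  simp only [Function.comp_apply, h2]
  by_cases hν : ν = 1
  -- The eigenvalue 1 may have infinite multiplicity, but any power of 1 is 1, so the value of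
  -- `finrank` there is irrelevant.
  · subst hν
    simp
  · have := hfin ν hν
    have := Fintype.ofFinite {i // (d i : ℂ) = ν}
    have h3 : Module.finrank ℂ (T.maxGenEigenspace ν) = Fintype.card {i // (d i : ℂ) = ν} := by
      rw [hT.isFinitelySemisimple.maxGenEigenspace_eq_eigenspace,
        eigenspace_eq_span_of_hilbertBasis hT e hd (hfin ν hν)]
      exact finrank_span_eq_card
        (e.orthonormal.linearIndependent.comp _ Subtype.val_injective)
    rw [h3]
    convert hasProd_fintype (fun _ : {i // (d i : ℂ) = ν} => ν) using 1
    simp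

theorem finite_of_summable_sq {l : ι → ℝ} (hs : Summable fun i => l i ^ 2) {c : ℝ} (hc : 0 < c) :
    {i | c ≤ l i ^ 2}.Finite := by
  have h := hs.tendsto_cofinite_zero.eventually (gt_mem_nhds hc)
  rw [Filter.eventually_cofinite] at h
  simpa using h

/-- The Fredholm determinant of `1 - Z²` for a diagonal symmetric antilinear operator `Z`. -/
theorem fredholmDet_one_sub_sq {Z : V →ₗ⋆[ℂ] V} (hZ : ∀ x y, ⟪y, Z x⟫_ℂ = ⟪x, Z y⟫_ℂ)
    (e : HilbertBasis ι ℂ V) {l : ι → ℝ} (hl : ∀ i, Z (e i) = (l i : ℂ) • e i)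
    (hs : Summable fun i => l i ^ 2) {D : ℝ} (hD : HasProd (fun i => 1 - l i ^ 2) D) :
    fredholmDet (1 - Z.comp Z) = D := by
  refine fredholmDet_of_hilbertBasis (fun x y => ?_) e (fun i => ?_) (fun ν hν => ?_) hD
  · simp only [LinearMap.sub_apply, Module.End.one_apply, LinearMap.comp_apply, inner_sub_left,
      inner_sub_right]
    rw [← inner_conj_symm (Z (Z x)) y, hZ (Z x) y, inner_conj_symm, hZ x (Z y)]
  · simp only [LinearMap.sub_apply, Module.End.one_apply, LinearMap.comp_apply]
    rw [hl, map_smulₛₗ, hl, Complex.conj_ofReal, smul_smul]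
    push_cast
    rw [sub_smul, one_smul, sq]
  -- An eigenvalue `1 - l i²` other than 1 has `l i² > 0`, and only finitely many entries of a
  -- summable family reach that size.
  · by_cases h : ∃ i, ((1 - l i ^ 2 : ℝ) : ℂ) = ν
    · obtain ⟨i, rfl⟩ := h
      have hi : 0 < l i ^ 2 := by
        rcases eq_or_ne (l i) 0 with h | h
        · simp [h] at hν
        · positivity
      refine ((finite_of_summable_sq hs hi).subset fun j (hj : _ = _) => ?_).to_subtype
      have hj' := Complex.ofReal_injective hj
      exact (sub_right_injective hj').ge
    · have : IsEmpty {i // ((1 - l i ^ 2 : ℝ) : ℂ) = ν} := ⟨fun i => h ⟨i.1, i.2⟩⟩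
      infer_instance

end FredholmDet

/-! ### Construction and normalization of the metaplectic operator -/

section Sufficiency

variable {V : Type*} [NormedAddCommGroup V] [InnerProductSpace ℂ V]

theorem fockToDual_apply (Φ : Fock V) (θ : SymAlgC V) : fockToDual Φ θ = ⟪toFock θ, Φ⟫_ℂ := rfl

/-- Scaling of Gaussians in each degree. -/
theorem gaussian_scale_degPart {Φ Φ' : AntiDual V} {Z : V → V} {t : ℂ}
    (h : ∀ v θ, Φ (gen v * θ) = Φ (annihilator (Z v) θ))
    (h' : ∀ v θ, Φ' (gen v * θ) = t ^ 2 * Φ' (annihilator (Z v) θ)) (h1 : Φ' 1 = Φ 1)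
    (n : ℕ) (θ : SymAlgC V) : Φ' (degPart n θ) = t ^ n * Φ (degPart n θ) := by
  induction n using Nat.strong_induction_on generalizing θ with
  | _ n ih =>
    induction θ using sym_induction with
    | one =>
      rw [degPart_one]
      split_ifs with hn
      · rw [hn, h1, pow_zero, one_mul]
      · simp
    | gen_mul w θ _ =>
      match n, ih with
      | 0, _ => rw [degPart_zero_gen_mul, map_zero, map_zero, mul_zero]
      | 1, _ =>
        rw [degPart_succ_gen_mul, h, h', annihilator_degPart_zero, map_zero, map_zero, mul_zero,
          mul_zero]
      | n + 2, ih =>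
        rw [degPart_succ_gen_mul, h, h', annihilator_degPart_succ, ih n (by omega)]
        ring
    | add θ η hθ hη => simp only [map_add, hθ, hη, mul_add]
    | smul r θ hθ =>
      simp only [map_smul, map_smulₛₗ, hθ, smul_eq_mul]
      ring

/-- Only finitely many entries reach 1/2, so the `l i` are bounded by some m < 1, which leaves room
for a dilation. -/
theorem exists_scale {ι : Type*} {l : ι → ℝ} (h0 : ∀ i, 0 ≤ l i) (h1 : ∀ i, l i < 1)
    (hs : Summable fun i => l i ^ 2) : ∃ t : ℝ, 1 < t ∧ ∀ i, t ^ 2 * l i < 1 := by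
  obtain ⟨m, hm0, hm1, hm⟩ : ∃ m : ℝ, 0 ≤ m ∧ m < 1 ∧ ∀ i, l i ≤ m := by
    have hfin := finite_of_summable_sq hs (c := (1 / 2) ^ 2) (by positivity)
    have hlt : ∀ i, i ∉ {i | (1 / 2 : ℝ) ^ 2 ≤ l i ^ 2} → l i ≤ 1 / 2 := fun i hi =>
      le_of_lt (lt_of_pow_lt_pow_left₀ 2 (by norm_num) (not_le.1 hi))
    rcases Set.eq_empty_or_nonempty {i | (1 / 2 : ℝ) ^ 2 ≤ l i ^ 2} with he | hne
    · exact ⟨1 / 2, by norm_num, by norm_num, fun i => hlt i (by rw [he]; exact fun h => h)⟩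
    · obtain ⟨j, -, hj⟩ := Set.exists_max_image _ l hfin hne
      refine ⟨max (l j) (1 / 2), le_max_of_le_left (h0 j), max_lt (h1 j) (by norm_num), fun i => ?_⟩
      by_cases hi : i ∈ {i | (1 / 2 : ℝ) ^ 2 ≤ l i ^ 2}
      · exact le_max_of_le_left (hj i hi)
      · exact le_max_of_le_right (hlt i hi)
  -- With this t, `t² m < 1` amounts to `4m < (1 + m)²`, that is `(1 - m)² > 0`.
  refine ⟨2 / (1 + m), by rw [lt_div_iff₀ (by positivity)]; linarith, fun i => ?_⟩
  refine (mul_le_mul_of_nonneg_left (hm i) (by positivity)).trans_lt ?_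
  rw [div_pow, div_mul_eq_mul_div, div_lt_one (by positivity)]
  nlinarith [mul_pos (sub_pos.2 hm1) (sub_pos.2 hm1)]

theorem norm_toFock_one : ‖toFock (1 : SymAlgC V)‖ = 1 := by
  have h : ⟪(1 : SymAlgC V), 1⟫_ℂ = 1 := by rw [sym_inner_def, symToDual_one, vac_one]
  rw [LinearIsometry.norm_map, ← sq_eq_sq₀ (norm_nonneg _) zero_le_one, one_pow]
  rw [inner_self_eq_norm_sq_to_K] at h
  exact Complex.ofReal_injective ((Complex.ofReal_pow _ 2).trans h)

theorem Intertwines.norm_apply {g : SpGroup V} {T : Fock V →L[ℂ] Fock V}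
    (hT : Intertwines g (restr T)) (Φ : Fock V) : ‖T Φ‖ = ‖T (toFock 1)‖ * ‖Φ‖ := by
  induction Φ using fock_induction with
  | hP => exact isClosed_eq (by fun_prop) (by fun_prop)
  | h θ => rw [LinearIsometry.norm_map]; exact hT.norm_map θ

theorem Intertwines.smul {g : SpGroup V} {T : Fock V →L[ℂ] Fock V}
    (hT : Intertwines g (restr T)) (c : ℂ) : Intertwines g (restr (c • T)) := by
  intro v φ
  have h := hT v φ
  rw [isFieldValue_iff] at h ⊢
  intro θ
  rw [restr_apply, restr_apply, smul_apply, smul_apply,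
    inner_smul_right, inner_smul_right]
  exact congrArg _ (h θ)

/-- A bounded intertwiner is a multiple of an isometry, so its operator norm is attained at the
vacuum; T and its adjoint have the same operator norm. -/
theorem Intertwines.norm_adjoint_apply_one {g : SpGroup V} {T : Fock V →L[ℂ] Fock V}
    (hT : Intertwines g (restr T)) :
    ‖ContinuousLinearMap.adjoint T (toFock 1)‖ = ‖T (toFock 1)‖ := by
  have key : ∀ {g : SpGroup V} {T : Fock V →L[ℂ] Fock V}, Intertwines g (restr T) →
      ‖T‖ = ‖T (toFock 1)‖ := fun {g T} hT => by
    refine le_antisymm (T.opNorm_le_bound (norm_nonneg _) fun Φ => (hT.norm_apply Φ).le) ?_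
    exact (T.le_opNorm (toFock 1)).trans_eq (by rw [norm_toFock_one, mul_one])
  rw [← key hT, ← key hT.adjoint, LinearIsometryEquiv.norm_map]

theorem Intertwines.mem_unitary {g : SpGroup V} {T : Fock V →L[ℂ] Fock V}
    (hT : Intertwines g (restr T)) (h1 : ‖T (toFock 1)‖ = 1) :
    T ∈ unitary (Fock V →L[ℂ] Fock V) := by
  have key : ∀ {g : SpGroup V} {T : Fock V →L[ℂ] Fock V}, Intertwines g (restr T) →
      ‖T (toFock 1)‖ = 1 → ContinuousLinearMap.adjoint T ∘L T = 1 := fun {g T} hT h1 =>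
    (ContinuousLinearMap.norm_map_iff_adjoint_comp_self T).1 fun Φ => by
      rw [hT.norm_apply, h1, one_mul]
  refine Unitary.mem_iff.2 ⟨key hT h1, ?_⟩
  have h := key hT.adjoint (hT.norm_adjoint_apply_one.trans h1)
  rwa [ContinuousLinearMap.adjoint_adjoint] at h

theorem eq_of_fockToDual_eq {Φ Ψ : Fock V} (h : fockToDual Φ = fockToDual Ψ) : Φ = Ψ :=
  sub_eq_zero.1 (fockToDual_injective fun θ => by
    rw [inner_sub_right, sub_eq_zero]; exact congrArg (fun F => F θ) h)

variable [CompleteSpace V]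

/-- The relation `U c(v) = (c(Cv) + a(Av)) U` generates every `U φ` from the vacuum image by
operators that preserve geometric decay. -/
theorem geomDecay_weakOp {g : SpGroup V} (h : GeomDecay (weakOp g 1)) (φ : SymAlgC V) :
    GeomDecay (weakOp g φ) := by
  induction φ using sym_induction with
  | one => exact h
  | gen_mul v φ ih =>
    have : weakOp g (gen v * φ) =
        (weakOp g φ).comp (annihilator (Cg g v)) + antiShift (gen (Ag g v)) (weakOp g φ) :=
      LinearMap.ext fun ψ => weakOp_creator g v φ ψ
    rw [this]
    exact (ih.comp_annihilator _).add (ih.comp_gen_mul _)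
  | add φ ψ h h' => rw [map_add]; exact h.add h'
  | smul r φ h => rw [map_smul]; exact h.smul r

theorem intertwines_of_weakOp {g : SpGroup V} {U : SymAlgC V →ₗ[ℂ] Fock V}
    (hU : ∀ φ, fockToDual (U φ) = weakOp g φ) : Intertwines g U := fun v φ => by
  rw [IsFieldValue, hU, hU]
  exact (isWeakMetaplectic_weakOp g).2 v φ

/-- If the vacuum is mapped to a vector of geometric decay, then the weak metaplectic operator
extends to a bounded operator. -/
theorem exists_extension_weakOp {g : SpGroup V} (h : GeomDecay (weakOp g 1)) :
    ∃ T : Fock V →L[ℂ] Fock V, ∀ φ, fockToDual (T (toFock φ)) = weakOp g φ := by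
  choose U hU using fun φ => (geomDecay_weakOp h φ).exists_fock
  let U' : SymAlgC V →ₗ[ℂ] Fock V :=
    { toFun := U
      map_add' := fun φ ψ => eq_of_fockToDual_eq (by rw [map_add, hU, hU, hU, map_add])
      map_smul' := fun r φ => eq_of_fockToDual_eq (by
        rw [RingHom.id_apply, map_smul, hU, hU, map_smul]) }
  have hU' : ∀ φ, fockToDual (U' φ) = weakOp g φ := hU
  -- No estimate of the kernel is needed: once the values lie in Fock space, the intertwining
  -- property makes `U'` a multiple of an isometry.
  let f : SymAlgC V →L[ℂ] Fock V := U'.mkContinuous ‖U' 1‖ fun φ =>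
    ((intertwines_of_weakOp hU').norm_map φ).le
  refine ⟨f.extend toFock.toContinuousLinearMap, fun φ => ?_⟩
  rw [← hU']
  exact congrArg fockToDual (f.extend_eq (e := toFock.toContinuousLinearMap) denseRange_toFock
    toFock.isometry.isUniformInducing φ)

/-- The Gaussian vector of `g⁻¹` for Hilbert-Schmidt `Z_g`. -/
theorem exists_gaussian_of_isHilbertSchmidt {g : SpGroup V} (hHS : IsHilbertSchmidt (Zg g)) :
    ∃ D : ℝ, 0 < D ∧ fredholmDet (1 - (Zg g).comp (Zg g)) = D ∧ GeomDecay (weakOp g⁻¹ 1) ∧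
      ∃ Φ : Fock V, fockToDual Φ = weakOp g⁻¹ 1 ∧ ‖Φ‖ ^ 2 = D ^ (-1 / 2 : ℝ) := by
  obtain ⟨s, e, l, h0, hl, hs⟩ := exists_takagi_basis (inner_Zg g) hHS
  have hw : ∀ v θ, weakOp g⁻¹ 1 (gen v * θ) = weakOp g⁻¹ 1 (annihilator (Zg g v) θ) :=
    fun v θ => by rw [weakOp_one_gen_mul, inv_inv]
  have h1 : ∀ i, l i < 1 := fun i => by
    have h := norm_Zg_lt g (e.orthonormal.ne_zero i)
    rw [hl, norm_smul, e.orthonormal.1 i, mul_one, Complex.norm_real, Real.norm_eq_abs] at h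
    exact (le_abs_self _).trans_lt h
  have hsq : ∀ {m : s → ℝ}, (∀ i, 0 ≤ m i) → (∀ i, m i < 1) → ∀ i, m i ^ 2 < 1 :=
    fun h h' i => pow_lt_one₀ (h i) (h' i) two_ne_zero
  obtain ⟨D, hD0, hD, hP⟩ := hasProd_rpow_of_summable (hsq h0 h1) hs
  refine ⟨D, hD0, fredholmDet_one_sub_sq (inner_Zg g) e hl hs hD, ?_, ?_⟩
  -- The Gaussian of `t² Z_g` is also a Fock vector, and in degree n it is tⁿ times the Gaussian of
  -- `Z_g`; hence decay with ratio `t⁻¹`.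
  · obtain ⟨t, ht1, ht⟩ := exists_scale h0 h1 hs
    have ht0 : 0 < t := one_pos.trans ht1
    obtain ⟨_, -, -, hP'⟩ := hasProd_rpow_of_summable (l := fun i => t ^ 2 * l i)
      (hsq (fun i => mul_nonneg (sq_nonneg t) (h0 i)) ht) (by
        simp only [mul_pow]
        exact hs.mul_left _)
    obtain ⟨Φ, hΦ1, -, hΦ⟩ := exists_gaussian_vector (Z := ((t ^ 2 : ℝ) : ℂ) • Zg g)
      (hHS.1.const_smul _) e (fun i => mul_nonneg (sq_nonneg t) (h0 i)) ht (fun i => by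
        rw [LinearMap.smul_apply, hl, smul_smul, Complex.ofReal_mul]) hP'
    have key := gaussian_scale_degPart (Φ := weakOp g⁻¹ 1) (Φ' := fockToDual Φ) (t := (t : ℂ)) hw
      (fun v θ => by
        rw [fockToDual_apply, hΦ, LinearMap.smul_apply, annihilator_smul, LinearMap.smul_apply,
          map_smul, inner_smul_left, Complex.conj_conj, fockToDual_apply, Complex.ofReal_pow])
      (by rw [fockToDual_apply, hΦ1, weakOp_one_one])
    refine ⟨‖Φ‖, t⁻¹, norm_nonneg _, inv_pos.2 ht0, inv_lt_one_of_one_lt₀ ht1, fun n θ => ?_⟩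
    have hn := congrArg norm (key n θ)
    rw [norm_mul, norm_pow, Complex.norm_real, Real.norm_of_nonneg ht0.le] at hn
    have hb : ‖fockToDual Φ (degPart n θ)‖ ≤ ‖θ‖ * ‖Φ‖ := by
      refine (norm_inner_le_norm (𝕜 := ℂ) (toFock (degPart n θ)) Φ).trans ?_
      rw [LinearIsometry.norm_map]
      gcongr
      exact norm_degPart_le n θ
    rw [hn] at hb
    rw [inv_pow, mul_comm ‖Φ‖, mul_assoc, inv_mul_eq_div, le_div_iff₀ (by positivity)]
    linarith
  · obtain ⟨Φ, hΦ1, hΦ2, hΦ⟩ := exists_gaussian_vector hHS.1 e h0 h1 hl hP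
    refine ⟨Φ, ?_, hΦ2⟩
    exact antiDual_eq_of_contract (f := fun v => (innerSL ℂ (Zg g v)).toLinearMap) hΦ hw
      (by rw [fockToDual_apply, hΦ1, weakOp_one_one])

/-- If `Z_g` is Hilbert-Schmidt, then the weak metaplectic operator, suitably normalized, extends
to a unitary metaplectic operator. -/
theorem exists_isUnitaryMetaplectic {g : SpGroup V} (hHS : IsHilbertSchmidt (Zg g)) :
    ∃ U : Fock V →L[ℂ] Fock V, (∀ φ, fockToDual (U (toFock φ)) = weakOp g φ) ∧
      IsUnitaryMetaplectic g ((fredholmDet (1 - (Zg g).comp (Zg g)) ^ (1 / 4 : ℂ)) • U) := by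
  obtain ⟨D, hD0, hD, hdecay, Φ, hΦ, hnorm⟩ := exists_gaussian_of_isHilbertSchmidt hHS
  -- T extends the operator for g⁻¹, whose vacuum image is the Gaussian of `Z_g` itself. Its adjoint
  -- extends `weakOp g` because the two kernels are adjoint.
  obtain ⟨T, hT⟩ := exists_extension_weakOp hdecay
  have hTi : Intertwines g⁻¹ (restr T) := intertwines_of_weakOp hT
  have hTadj := hTi.adjoint
  rw [inv_inv] at hTadj
  have hTΦ : T (toFock 1) = Φ := eq_of_fockToDual_eq (by rw [hT, hΦ])
  have hc : (D : ℂ) ^ (1 / 4 : ℂ) = ((D ^ (1 / 4 : ℝ) : ℝ) : ℂ) := by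
    rw [Complex.ofReal_cpow hD0.le]; norm_num
  refine ⟨ContinuousLinearMap.adjoint T, fun φ => ?_, ?_⟩
  · ext ψ
    rw [fockToDual_apply, ContinuousLinearMap.adjoint_inner_right, ← weakOp_inv, ← hT,
      fockToDual_apply, inner_conj_symm]
  · rw [hD, hc, isUnitaryMetaplectic_iff]
    have h := hTadj.smul ((D ^ (1 / 4 : ℝ) : ℝ) : ℂ)
    refine ⟨h.mem_unitary ?_, h⟩
    -- The vacuum image has squared norm `D^(-1/2)`, so the factor `D^(1/4)` makes its norm 1.
    rw [smul_apply, norm_smul, hTi.norm_adjoint_apply_one, hTΦ,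
      Complex.norm_real, Real.norm_of_nonneg (by positivity),
      ← sq_eq_sq₀ (by positivity) zero_le_one, mul_pow, hnorm, ← Real.rpow_natCast,
      ← Real.rpow_mul hD0.le, ← Real.rpow_add hD0]
    norm_num

end Sufficiency

end BosonicFock

end

theorem mainTheorem1 {V : Type*} [NormedAddCommGroup V] [InnerProductSpace ℂ V] [CompleteSpace V]
    (g : BosonicFock.SpGroup V) :
    ((∃ T : BosonicFock.Fock V →L[ℂ] BosonicFock.Fock V, BosonicFock.IsUnitaryMetaplectic g T) ↔
        BosonicFock.IsHilbertSchmidt (BosonicFock.Zg g)) ∧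
      ((∃ T : BosonicFock.Fock V →L[ℂ] BosonicFock.Fock V, BosonicFock.IsUnitaryImplementer g T) ↔
        BosonicFock.IsHilbertSchmidt (BosonicFock.Zg g)) ∧
      (BosonicFock.IsHilbertSchmidt (BosonicFock.Zg g) →
        ∃ U : BosonicFock.Fock V →L[ℂ] BosonicFock.Fock V,
          (∀ φ : BosonicFock.SymAlgC V,
            BosonicFock.fockToDual (U (BosonicFock.toFock φ)) = BosonicFock.weakOp g φ) ∧
          BosonicFock.IsUnitaryMetaplectic g
            ((BosonicFock.fredholmDet (1 - (BosonicFock.Zg g).comp (BosonicFock.Zg g)) ^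
              (1 / 4 : ℂ)) • U) ∧
          BosonicFock.IsUnitaryImplementer g
            ((BosonicFock.fredholmDet (1 - (BosonicFock.Zg g).comp (BosonicFock.Zg g)) ^
              (1 / 4 : ℂ)) • U)) := by
  have key : ∀ T : BosonicFock.Fock V →L[ℂ] BosonicFock.Fock V,
      BosonicFock.IsUnitaryImplementer g T ↔ BosonicFock.IsUnitaryMetaplectic g T :=
    BosonicFock.isUnitaryImplementer_iff g
  simp only [key, and_self]
  have h1 : (∃ T : BosonicFock.Fock V →L[ℂ] BosonicFock.Fock V,
      BosonicFock.IsUnitaryMetaplectic g T) ↔ BosonicFock.IsHilbertSchmidt (BosonicFock.Zg g) :=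
    ⟨fun ⟨_, hT⟩ => hT.isHilbertSchmidt, fun h =>
      let ⟨_, _, hU⟩ := BosonicFock.exists_isUnitaryMetaplectic h
      ⟨_, hU⟩⟩
  exact ⟨h1, h1, BosonicFock.exists_isUnitaryMetaplectic⟩
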